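/- Let $\mathbb{F}$ be a field. For a path-connected space $X$ with fundamental group $\pi=\pi_1(X)$ and universal cover $\widetilde X$, a homomorphism $\varepsilon:\pi\to\mathbb{Z}$ and a representation $\rho:\pi\to GL_\ell(\mathbb{F})$, let $\mathbb{V}=\mathbb{F}^\ell$ be the space of row vectors, with right $\pi$-action $v\cdot\alpha=v\rho(\alpha)$, and let $H_i^{\varepsilon,\rho}(X,\mathbb{F}[t^{\pm1}])$ be the $i$-th homology of the complex of $\mathbb{F}[t^{\pm1}]$-modules $$(\mathbb{F}[t^{\pm1}]\otimes_{\mathbb F}\mathbb{V})\otimes_{\mathbb{F}[\pi]}C_*(\widetilde X;\mathbb{F}),\qquad (p\otimes v)\cdot\alpha=p\,t^{\varepsilon(\alpha)}\otimes v\rho(\alpha),$$ where $C_*(\widetilde X;\mathbb{F})$ is the singular chain complex, on which $\pi$ acts by deck transformations. Let $\Delta_i^{\varepsilon,\rho}\in\mathbb{F}[t^{\pm1}]$ be the order of the torsion part of $H_i^{\varepsilon,\rho}(X,\mathbb{F}[t^{\pm1}])$, well defined up to units: if this torsion part is isomorphic to $\bigoplus_k\mathbb{F}[t^{\pm1}]/(q_k)$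 (a finite sum with all $q_k\neq0$), then $\Delta_i^{\varepsilon,\rho}=\prod_kq_k$. Let $d\geq2$ and let $K\subset S^3$ be the Hopf link with $d$ components, i.e. the image of $\{(x,y)\in S^3\subset\mathbb{C}^2 : x^d=y^d\}$ under a homeomorphism of $S^3$. Then $\pi_1(S^3\setminus K)$ has a presentation $$\pi_1(S^3\setminus K)\cong\langle x_0,x_1,\dots,x_{d-1}\mid x_0x_ix_0^{-1}x_i^{-1},\ i=1,\dots,d-1\rangle .$$ Fix any such presentation. Let $\varepsilon:\pi_1(S^3\setminus K)\to\mathbb{Z}$ be an epimorphism with $\varepsilon(x_0)\neq0$, and let $\rho:\pi_1(S^3\setminus K)\to GL_\ell(\mathbb{F})$ be a representation. Then: (a) $H_i^{\varepsilon,\rho}(S^3\setminus K,\mathbb{F}[t^{\pm1}])$ is a torsion $\mathbb{F}[t^{\pm1}]$-module for $i=0,1$, and it has an order $\Delta_i^{\varepsilon,\rho}$. (b) $H_i^{\varepsilon,\rho}(S^3\setminus K,\mathbb{F}[t^{\pm1}])=0$ for all $i\geq2$. (c) $\Delta_0^{\varepsilon,\rho}$ is a greatest common divisor of the $\ell\times\ell$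 minors of the $d\ell\times\ell$ matrix $$\left(\rho(x_i)t^{\varepsilon(x_i)}-\mathrm{Id}\right)_{i=0,\dots,d-1}$$ obtained by stacking the $d$ blocks in a column. (d) Up to a unit of $\mathbb{F}[t^{\pm1}]$, $$\Delta_1^{\varepsilon,\rho}=\Delta_0^{\varepsilon,\rho}\cdot\det\left(\rho(x_0)t^{\varepsilon(x_0)}-\mathrm{Id}\right)^{d-2}.$$ -/

import Mathlib

open CategoryTheory TensorProduct
open scoped unitInterval LaurentPolynomial

universe u v

/-! ### The fundamental group and the universal cover -/

section Cover

variable {X : Type u} [TopologicalSpace X]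

/-- The fundamental group of `X` at `b`, where the product `α * β` is the class of the loop
"first `α`, then `β`". (Mathlib's `FundamentalGroup` composes in the opposite order, hence the
opposite group.) -/
abbrev LoopGroup (b : X) : Type u := (FundamentalGroup X b)ᵐᵒᵖ

/-- The homotopy class of paths underlying an element of the fundamental group. -/
def LoopGroup.toPath {b : X} (α : LoopGroup b) : Path.Homotopic.Quotient b b := α.unop

/-- The universal cover of `X` (based at `b`): the set of homotopy classes, relative to the
endpoints, of paths starting at `b`. -/
def UniversalCover (b : X) : Type u := Σ x : X, Path.Homotopic.Quotient b x

/-- The space of paths in `X` starting at `b`, with the compact-open topology. -/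
abbrev PathsFrom (b : X) : Type u := {γ : C(I, X) // γ 0 = b}

/-- A path starting at `b`, as a path from `b` to its endpoint. -/
def PathsFrom.path {b : X} (γ : PathsFrom b) : Path b (γ.1 1) := ⟨γ.1, γ.2, rfl⟩

/-- The map which sends a path starting at `b` to its homotopy class. -/
def UniversalCover.mk {b : X} (γ : PathsFrom b) : UniversalCover b :=
  ⟨γ.1 1, Path.Homotopic.Quotient.mk γ.path⟩

/-- The universal cover has the quotient topology of the compact-open topology on paths. -/
instance (b : X) : TopologicalSpace (UniversalCover b) :=
  TopologicalSpace.coinduced UniversalCover.mk inferInstance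

theorem UniversalCover.mk_surjective (b : X) :
    Function.Surjective (UniversalCover.mk (b := b)) := by
  rintro ⟨x, p⟩
  induction p using Path.Homotopic.Quotient.ind with
  | _ p =>
    obtain ⟨f, h0, h1⟩ := p
    subst h1
    exact ⟨⟨f, h0⟩, rfl⟩

/-- The covering projection: a path is sent to its endpoint. -/
def UniversalCover.proj {b : X} (e : UniversalCover b) : X := e.1

/-- The fundamental group acts (on the left) on the universal cover by deck transformations:
`α • [γ]` is the class of "first `α`, then `γ`". -/
noncomputable instance (b : X) : MulAction (LoopGroup b) (UniversalCover b) where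
  smul α e := ⟨e.1, α.toPath.trans e.2⟩
  one_smul e := by
    obtain ⟨x, p⟩ := e
    exact congrArg (Sigma.mk x) (Category.id_comp (obj := FundamentalGroupoid X)
      (X := ⟨b⟩) (Y := ⟨x⟩) p)
  mul_smul α β e := by
    obtain ⟨x, p⟩ := e
    exact congrArg (Sigma.mk x) (Category.assoc (obj := FundamentalGroupoid X)
      (W := ⟨b⟩) (X := ⟨b⟩) (Y := ⟨b⟩) (Z := ⟨x⟩) α.unop β.unop p)

theorem UniversalCover.smul_def {b : X} (α : LoopGroup b) (e : UniversalCover b) :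
    α • e = ⟨e.1, α.toPath.trans e.2⟩ := rfl

/-- Concatenation of a loop at `b` with a path starting at `b`. -/
noncomputable def PathsFrom.cons {b : X} (a : Path b b) (γ : PathsFrom b) : PathsFrom b :=
  ⟨(a.trans γ.path).toContinuousMap, (a.trans γ.path).source⟩

theorem PathsFrom.continuous_cons {b : X} (a : Path b b) :
    Continuous (PathsFrom.cons a) := by
  refine Continuous.subtype_mk ?_ _
  refine ContinuousMap.continuous_of_continuous_uncurry _ ?_
  exact Path.trans_continuous_family (fun _ : PathsFrom b => a) (by fun_prop)
    (fun γ => γ.path) (by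
      change Continuous fun q : PathsFrom b × I => q.1.1 q.2
      fun_prop)

theorem UniversalCover.smul_mk {b : X} (a : Path b b) (α : LoopGroup b)
    (h : α.toPath = Path.Homotopic.Quotient.mk a) (γ : PathsFrom b) :
    α • UniversalCover.mk γ = UniversalCover.mk (PathsFrom.cons a γ) := by
  have h1 : ∀ (x : X) (hx : x = γ.1 1) (δ : Path b x) (_ : δ.toContinuousMap = (a.trans γ.path).toContinuousMap),
      (⟨γ.1 1, Path.Homotopic.Quotient.mk (a.trans γ.path)⟩ : UniversalCover b) =
        ⟨x, Path.Homotopic.Quotient.mk δ⟩ := by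
    rintro x rfl δ hδ
    congr 2
    ext t
    exact (DFunLike.congr_fun hδ t).symm
  rw [UniversalCover.smul_def, h]
  refine Eq.trans ?_ (h1 _ ?_ (PathsFrom.cons a γ).path rfl)
  · rfl
  · exact (a.trans γ.path).target

instance (b : X) : ContinuousConstSMul (LoopGroup b) (UniversalCover b) where
  continuous_const_smul α := by
    obtain ⟨a, ha⟩ := Path.Homotopic.Quotient.mk_surjective α.toPath
    rw [continuous_coinduced_dom]
    have : (fun e : UniversalCover b => α • e) ∘ UniversalCover.mk =
        UniversalCover.mk ∘ PathsFrom.cons a :=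
      funext fun γ => UniversalCover.smul_mk a α ha.symm γ
    rw [this]
    exact continuous_coinduced_rng.comp (PathsFrom.continuous_cons a)

end Cover

/-! ### Twisted chain complexes and twisted Alexander modules -/

section Twisted

variable {F : Type v} [Field F] {G : Type u} [Group G] {l : ℕ}

/-- The matrix `t ^ ε(α) ρ(α)` over `F[t,t⁻¹]`. -/
noncomputable def twistedMatrix (ε : G →* Multiplicative ℤ) (ρ : G →* GL (Fin l) F) (α : G) :
    Matrix (Fin l) (Fin l) F[T;T⁻¹] :=
  (LaurentPolynomial.T (ε α).toAdd : F[T;T⁻¹]) •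
    (ρ α : Matrix (Fin l) (Fin l) F).map LaurentPolynomial.C

/-- The right action of `α` on `F[t,t⁻¹] ⊗_F V`, where `V = F ^ l` is the space of row vectors,
so that `F[t,t⁻¹] ⊗_F V = F[t,t⁻¹] ^ l`; see `twistedAct_smul_C` for the formula
`(p ⊗ v) · α = p t ^ ε(α) ⊗ v ρ(α)`. -/
noncomputable def twistedAct (ε : G →* Multiplicative ℤ) (ρ : G →* GL (Fin l) F) (α : G) :
    (Fin l → F[T;T⁻¹]) →ₗ[F[T;T⁻¹]] (Fin l → F[T;T⁻¹]) :=
  Matrix.vecMulLinear (twistedMatrix ε ρ α)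

theorem twistedAct_smul_C (ε : G →* Multiplicative ℤ) (ρ : G →* GL (Fin l) F) (α : G)
    (p : F[T;T⁻¹]) (v : Fin l → F) :
    twistedAct ε ρ α (p • fun i => LaurentPolynomial.C (v i)) =
      (p * LaurentPolynomial.T (ε α).toAdd) •
        fun i => LaurentPolynomial.C (Matrix.vecMul v (ρ α : Matrix (Fin l) (Fin l) F) i) := by
  rw [map_smul, mul_smul]
  congr 1
  funext i
  simp [twistedAct, twistedMatrix, Matrix.vecMul, dotProduct, Finset.mul_sum, mul_left_comm]

/-- This is a right action: `(m · α) · β = m · (α β)`. -/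
theorem twistedAct_mul (ε : G →* Multiplicative ℤ) (ρ : G →* GL (Fin l) F) (α β : G)
    (m : Fin l → F[T;T⁻¹]) :
    twistedAct ε ρ (α * β) m = twistedAct ε ρ β (twistedAct ε ρ α m) := by
  have h : twistedMatrix ε ρ (α * β) = twistedMatrix ε ρ α * twistedMatrix ε ρ β := by
    simp only [twistedMatrix, map_mul, toAdd_mul, LaurentPolynomial.T_add, Units.val_mul,
      Matrix.map_mul, Matrix.smul_mul, Matrix.mul_smul, mul_smul]
    exact smul_comm _ _ _
  simp only [twistedAct, h, Matrix.vecMulLinear_apply, Matrix.vecMul_vecMul]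

variable (E : Type u) [TopologicalSpace E] [MulAction G E] [ContinuousConstSMul G E]

/-- The action of `α` on the singular simplicial set of `E`. -/
noncomputable def singularSMul (α : G) :
    TopCat.toSSet.obj (TopCat.of E) ⟶ TopCat.toSSet.obj (TopCat.of E) :=
  TopCat.toSSet.map (TopCat.ofHom ⟨fun e : E => α • e, continuous_const_smul α⟩)

/-- Singular chains of `E` in degree `n`, with coefficients in `F`. -/
abbrev SingularChains (F : Type v) [Field F] (n : SimplexCategoryᵒᵖ) : Type (max u v) :=
  (TopCat.toSSet.obj (TopCat.of E)).obj n →₀ F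

/-- The left action of `α` on singular chains. -/
noncomputable def chainSMul (F : Type v) [Field F] (n : SimplexCategoryᵒᵖ) (α : G) :
    SingularChains E F n →ₗ[F] SingularChains E F n :=
  Finsupp.lmapDomain F F (fun s => (singularSMul E α).app n s)

/-- The relations `(m · α) ⊗ c = m ⊗ (α c)` which define the tensor product over `F[G]` as a
quotient of the tensor product over `F`. As `F[G]` is spanned by `G`, it is enough to let `α` run
over `G`. -/
noncomputable def balancedRelations (ε : G →* Multiplicative ℤ) (ρ : G →* GL (Fin l) F)
    (n : SimplexCategoryᵒᵖ) :
    Submodule F[T;T⁻¹] ((Fin l → F[T;T⁻¹]) ⊗[F] SingularChains E F n) :=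
  Submodule.span F[T;T⁻¹]
    {z | ∃ (α : G) (m : Fin l → F[T;T⁻¹]) (c : SingularChains E F n),
      z = twistedAct ε ρ α m ⊗ₜ[F] c - m ⊗ₜ[F] chainSMul E F n α c}

/-- `(F[t,t⁻¹] ⊗_F V) ⊗_{F[G]} C_n(E; F)`, as a module over `F[t,t⁻¹]`. -/
abbrev TwistedChains (ε : G →* Multiplicative ℤ) (ρ : G →* GL (Fin l) F)
    (n : SimplexCategoryᵒᵖ) : Type (max u v) :=
  ((Fin l → F[T;T⁻¹]) ⊗[F] SingularChains E F n) ⧸ balancedRelations E ε ρ n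

/-- The map on singular chains given by a simplicial operator (such as a face map). -/
noncomputable def chainOperator (F : Type v) [Field F] {n m : SimplexCategoryᵒᵖ} (f : n ⟶ m) :
    SingularChains E F n →ₗ[F] SingularChains E F m :=
  Finsupp.lmapDomain F F (fun s => (TopCat.toSSet.obj (TopCat.of E)).map f s)

/-- `id ⊗ f` for a simplicial operator `f`, before passing to the quotient. -/
noncomputable def tensorOperator (F : Type v) [Field F] (l : ℕ) {n m : SimplexCategoryᵒᵖ}
    (f : n ⟶ m) :
    ((Fin l → F[T;T⁻¹]) ⊗[F] SingularChains E F n) →ₗ[F[T;T⁻¹]]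
      ((Fin l → F[T;T⁻¹]) ⊗[F] SingularChains E F m) :=
  TensorProduct.AlgebraTensorModule.lTensor F[T;T⁻¹] (Fin l → F[T;T⁻¹])
    (chainOperator E F f)

theorem chainOperator_chainSMul {n m : SimplexCategoryᵒᵖ} (f : n ⟶ m) (α : G)
    (c : SingularChains E F n) :
    chainOperator E F f (chainSMul E F n α c) = chainSMul E F m α (chainOperator E F f c) := by
  simp only [chainOperator, chainSMul, Finsupp.lmapDomain_apply, ← Finsupp.mapDomain_comp]
  congr 1

theorem balancedRelations_le (ε : G →* Multiplicative ℤ) (ρ : G →* GL (Fin l) F)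
    {n m : SimplexCategoryᵒᵖ} (f : n ⟶ m) :
    balancedRelations E ε ρ n ≤ (balancedRelations E ε ρ m).comap (tensorOperator E F l f) := by
  refine Submodule.span_le.2 ?_
  rintro _ ⟨α, x, c, rfl⟩
  refine Submodule.subset_span ⟨α, x, chainOperator E F f c, ?_⟩
  simp only [map_sub, ← chainOperator_chainSMul, tensorOperator,
    TensorProduct.AlgebraTensorModule.lTensor_tmul]

/-- The map on twisted chains given by a simplicial operator. -/
noncomputable def twistedOperator (ε : G →* Multiplicative ℤ) (ρ : G →* GL (Fin l) F)
    {n m : SimplexCategoryᵒᵖ} (f : n ⟶ m) :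
    TwistedChains E ε ρ n →ₗ[F[T;T⁻¹]] TwistedChains E ε ρ m :=
  Submodule.mapQ _ _ (tensorOperator E F l f) (balancedRelations_le E ε ρ f)

/-- The twisted chains of `E`, as a simplicial module over `F[t,t⁻¹]`. -/
noncomputable def twistedSimplicialModule (ε : G →* Multiplicative ℤ) (ρ : G →* GL (Fin l) F) :
    SimplicialObject (ModuleCat.{max u v} F[T;T⁻¹]) where
  obj n := ModuleCat.of _ (TwistedChains E ε ρ n)
  map f := ModuleCat.ofHom (twistedOperator E ε ρ f)
  map_id n := by
    refine ModuleCat.hom_ext (LinearMap.ext fun x => ?_)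
    obtain ⟨x, rfl⟩ := Submodule.Quotient.mk_surjective _ x
    have : chainOperator E F (𝟙 n) = LinearMap.id := by
      refine LinearMap.ext fun c => ?_
      simp only [chainOperator, CategoryTheory.Functor.map_id_apply]
      exact Finsupp.mapDomain_id
    simp [twistedOperator, tensorOperator, this]
  map_comp {n m k} f g := by
    refine ModuleCat.hom_ext (LinearMap.ext fun x => ?_)
    obtain ⟨x, rfl⟩ := Submodule.Quotient.mk_surjective _ x
    have : chainOperator E F (f ≫ g) = chainOperator E F g ∘ₗ chainOperator E F f := by
      refine LinearMap.ext fun c => ?_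
      simp only [chainOperator, CategoryTheory.Functor.map_comp_apply]
      exact Finsupp.mapDomain_comp
    simp [twistedOperator, tensorOperator, this, TensorProduct.AlgebraTensorModule.lTensor_comp]

variable {X : Type u} [TopologicalSpace X]

/-- The twisted chain complex `(F[t,t⁻¹] ⊗_F V) ⊗_{F[π]} C_*(X̃; F)` of `(X, ε, ρ)`, where `π` is
the fundamental group of `X`, where `V = F ^ l` consists of row vectors on which `α ∈ π` acts from
the right by `ρ α`, and where `C_*(X̃; F)` is the singular chain complex of the universal cover,
with the boundary `∑ (-1)ⁱ dᵢ`. -/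
noncomputable def twistedChainComplex {b : X} (ε : LoopGroup b →* Multiplicative ℤ)
    (ρ : LoopGroup b →* GL (Fin l) F) : ChainComplex (ModuleCat.{max u v} F[T;T⁻¹]) ℕ :=
  AlgebraicTopology.AlternatingFaceMapComplex.obj
    (twistedSimplicialModule (UniversalCover b) ε ρ)

/-- The `i`-th (homological) twisted Alexander module of `(X, ε, ρ)`. -/
noncomputable def twistedAlexanderModule {b : X} (ε : LoopGroup b →* Multiplicative ℤ)
    (ρ : LoopGroup b →* GL (Fin l) F) (i : ℕ) : ModuleCat.{max u v} F[T;T⁻¹] :=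
  (twistedChainComplex ε ρ).homology i

end Twisted

/-! ### Orders and twisted Alexander polynomials -/

/-- `p` is the order of the finitely generated torsion module `M` over the principal ideal domain
`R`: if `M ≅ ⨁ R / (q i)` with all `q i ≠ 0`, the order is `∏ q i`, up to units. -/
def IsModuleOrder (R : Type*) [CommRing R] (M : Type*) [AddCommGroup M] [Module R M] (p : R) :
    Prop :=
  ∃ (n : ℕ) (q : Fin n → R), (∀ i, q i ≠ 0) ∧
    Nonempty (M ≃ₗ[R] ((i : Fin n) → R ⧸ Ideal.span {q i})) ∧ Associated p (∏ i, q i)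

/-- `p` is an `i`-th twisted Alexander polynomial `Δ_i` of `(X, ε, ρ)`: the order of the torsion
part of the `i`-th twisted Alexander module, which is defined up to units of `F[t,t⁻¹]`. -/
def IsTwistedAlexanderPolynomial {F : Type v} [Field F] {l : ℕ} {X : Type u} [TopologicalSpace X]
    {b : X} (ε : LoopGroup b →* Multiplicative ℤ) (ρ : LoopGroup b →* GL (Fin l) F) (i : ℕ)
    (p : F[T;T⁻¹]) : Prop :=
  IsModuleOrder F[T;T⁻¹] (Submodule.torsion F[T;T⁻¹] (twistedAlexanderModule ε ρ i)) p

/-- `g` is a greatest common divisor of the elements of `S`. -/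
def IsGCDOfSet {R : Type*} [CommRing R] (S : Set R) (g : R) : Prop :=
  (∀ s ∈ S, g ∣ s) ∧ ∀ c, (∀ s ∈ S, c ∣ s) → c ∣ g

/-- The matrix `ρ(α) t ^ ε(α) - Id` over `F[t,t⁻¹]`. -/
noncomputable def alexanderBlock {F : Type v} [Field F] {G : Type u} [Group G] {l : ℕ}
    (ε : G →* Multiplicative ℤ) (ρ : G →* GL (Fin l) F) (α : G) :
    Matrix (Fin l) (Fin l) F[T;T⁻¹] :=
  twistedMatrix ε ρ α - 1

/-- The column of blocks `ρ(x i) t ^ ε(x i) - Id`, a matrix with `d * l` rows and `l` columns. -/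
noncomputable def alexanderColumn {F : Type v} [Field F] {G : Type u} [Group G] {d l : ℕ}
    (ε : G →* Multiplicative ℤ) (ρ : G →* GL (Fin l) F) (x : Fin d → G) :
    Matrix (Fin d × Fin l) (Fin l) F[T;T⁻¹] :=
  Matrix.of fun r c => alexanderBlock ε ρ (x r.1) r.2 c

/-- The `l × l` minors of a matrix with `l` columns. -/
def maximalMinors {R : Type*} [CommRing R] {m : Type*} {l : ℕ} (A : Matrix m (Fin l) R) : Set R :=
  {δ | ∃ f : Fin l ↪ m, δ = (A.submatrix f id).det}

/-! ### The Hopf link with `d` components -/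

/-- The unit sphere of `ℂ²`. -/
abbrev S3 : Type := Metric.sphere (0 : EuclideanSpace ℂ (Fin 2)) 1

/-- The standard Hopf link with `d` components: the intersection of the sphere with the `d`
complex lines `{(x, y) | x ^ d = y ^ d}`, that is, `d` fibres of the Hopf fibration. -/
def standardHopfLink (d : ℕ) : Set S3 := {z | z.1 0 ^ d = z.1 1 ^ d}

/-- `K` is a Hopf link with `d` components: some homeomorphism of the sphere takes it to the
standard one. -/
def IsHopfLink (d : ℕ) (K : Set S3) : Prop := ∃ h : S3 ≃ₜ S3, h '' K = standardHopfLink d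

/-- The relators `x₀ xᵢ x₀⁻¹ xᵢ⁻¹`, `1 ≤ i ≤ d - 1`. -/
def hopfRelators (d : ℕ) : Set (FreeGroup (Fin d)) :=
  {r | ∃ j i : Fin d, (j : ℕ) = 0 ∧ 1 ≤ (i : ℕ) ∧
    r = FreeGroup.of j * FreeGroup.of i * (FreeGroup.of j)⁻¹ * (FreeGroup.of i)⁻¹}

/-- The group `⟨x₀, …, x_{d-1} | x₀ xᵢ x₀⁻¹ xᵢ⁻¹, i = 1, …, d - 1⟩`. -/
abbrev HopfGroup (d : ℕ) : Type := PresentedGroup (hopfRelators d)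

/-!
# Twisted Alexander modules of the Hopf link

*Topology of the complement.* In the coordinate `w = i (x + y) / (x - y)` on the base of the Hopf
fibration, the complement of `x ^ d = y ^ d` is the product of a circle with the plane punctured at
`d - 1` real points; indeed `x = y` is one of the fibres in the link, and the fibration is trivial
outside of it (`HopfLink.complementHomeomorph`). The punctured plane, rescaled to a strip, is
homotopy equivalent to a rose (`PuncturedStrip.nonempty_homotopyEquiv_rose`), and the rose is the
quotient of the Cayley tree of a free group by its translations, which are a covering space action
on a contractible space (`FreeTree.isQuotientCoveringMap_toRose`). Hence the fundamental group is
the product of a free group with `ℤ` (`HopfLink.nonempty_loopGroup_mulEquiv`), as is the group of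
the presentation (`HopfLink.groupEquiv`).

*The universal cover is contractible.* It is defined as the space of homotopy classes of paths from
the base point, so it is contractible as soon as every class has a representative which depends
continuously on it: shrink the representative (`HasCanonicalPaths.contractibleSpace`). Such
representatives exist for the base of a covering with contractible total space, and they are
inherited by products and by homotopy retracts. Therefore only the circle and the rose have to be
considered.

*A small resolution.* The singular chains of the universal cover are a projective resolution of the
trivial representation (`singularResolution`), because the space is contractible and the action is
free. The chains of the universal cover of the presentation complex are another one
(`foxResolution`): their contracting homotopy is explicit, since the group is `free × ℤ`. The two
resolutions are homotopy equivalent, and an additive functor preserves this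
(`nonempty_twisted_homotopyEquiv`). So, with `R = F[t,t⁻¹]`, `n = d - 1`, and the commuting blocks
`A j = ρ(x j) t ^ ε(x j) - 1`, the twisted modules are the homology of a complex
`Rˡⁿ ⟶ Rˡ⁽ⁿ⁺¹⁾ ⟶ Rˡ`, whose boundary operators are `alexanderTwo` and `alexanderOne`.

*Orders.* The determinant of `A 0` is not zero, because `ε(x 0) ≠ 0`
(`det_alexanderBlock_ne_zero`). It follows that `alexanderTwo` is injective, which is the vanishing
in degrees at least two. If `C` is the cokernel of `A 0`, the other two modules lie in an exact
sequence `0 ⟶ H₁ ⟶ Cⁿ ⟶ C ⟶ H₀ ⟶ 0` of torsion modules, and orders are multiplicative, which gives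
`Δ₁ · det (A 0) = Δ₀ · det (A 0) ^ n` up to units (`associated_order`). To compare orders with
determinants, all modules are presented by square matrices: the determinant of a square
presentation matrix depends, up to units, only on the module (`IsPresentedBy.associated_det`).
Finally `H₀` is the cokernel of the column of all blocks. Its maximal minors are determinants of
presentations of modules which surject onto `H₀`, so that `Δ₀` divides them; and `Δ₀` is itself the
determinant of a matrix whose rows are combinations of the rows of the column, hence a combination
of the minors (`isGCDOfSet_maximalMinors`).
-/

/-! ### Canonical paths and contractibility of the universal cover -/

section PathSections

variable {X Y : Type*} [TopologicalSpace X] [TopologicalSpace Y]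

theorem UniversalCover.mk_eq_mk_iff {b : X} {γ δ : PathsFrom b} :
    UniversalCover.mk γ = UniversalCover.mk δ ↔ γ.1.HomotopicRel δ.1 {0, 1} := by
  have key : ∀ (x : X) (p : Path b x),
      UniversalCover.mk γ = ⟨x, Path.Homotopic.Quotient.mk p⟩ ↔
        γ.1.HomotopicRel p.toContinuousMap {0, 1} := by
    intro x p
    constructor
    · intro h
      have hx : γ.1 1 = x := congrArg Sigma.fst h
      subst hx
      have h2 := eq_of_heq (Sigma.mk.inj h).2
      exact Path.Homotopic.Quotient.eq.1 h2
    · intro h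
      have hx : γ.1 1 = x := by simpa using h.fst_eq_snd (x := 1) (by simp)
      subst hx
      exact congrArg (Sigma.mk _) (Path.Homotopic.Quotient.eq.2 h)
  exact key _ δ.path

theorem UniversalCover.mk_eq_ofPath {b x : X} (γ : PathsFrom b) (p : Path b x)
    (h : γ.1.HomotopicRel p.toContinuousMap {0, 1}) :
    UniversalCover.mk γ = ⟨x, Path.Homotopic.Quotient.mk p⟩ := by
  have : UniversalCover.mk (b := b) ⟨p.toContinuousMap, p.source⟩ =
      ⟨x, Path.Homotopic.Quotient.mk p⟩ := by
    have hx := p.target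
    obtain ⟨p, h0, h1⟩ := p
    subst h1
    rfl
  rw [← this, UniversalCover.mk_eq_mk_iff]
  exact h

theorem UniversalCover.continuous_mk (b : X) :
    Continuous (UniversalCover.mk (b := b)) := continuous_coinduced_rng

theorem UniversalCover.continuous_proj (b : X) :
    Continuous (UniversalCover.proj (b := b)) := by
  rw [continuous_coinduced_dom]
  change Continuous fun γ : PathsFrom b => γ.1 1
  fun_prop

/-- The map on path spaces induced by a continuous map. -/
def PathsFrom.map (f : C(X, Y)) {b : X} (γ : PathsFrom b) : PathsFrom (f b) :=
  ⟨f.comp γ.1, congrArg f γ.2⟩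

theorem PathsFrom.continuous_map (f : C(X, Y)) (b : X) :
    Continuous (PathsFrom.map f (b := b)) := by
  refine Continuous.subtype_mk ?_ _
  fun_prop

/-- The map on universal covers induced by a continuous map. -/
def UniversalCover.map (f : C(X, Y)) {b : X} (e : UniversalCover b) : UniversalCover (f b) :=
  ⟨f e.1, e.2.map f⟩

theorem UniversalCover.map_mk (f : C(X, Y)) {b : X} (γ : PathsFrom b) :
    UniversalCover.map f (UniversalCover.mk γ) = UniversalCover.mk (PathsFrom.map f γ) := rfl

theorem UniversalCover.continuous_map (f : C(X, Y)) (b : X) :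
    Continuous (UniversalCover.map f (b := b)) := by
  rw [continuous_coinduced_dom]
  exact (UniversalCover.continuous_mk _).comp (PathsFrom.continuous_map f b)

/-- The homotopy classes of paths from `b` have representatives which depend continuously on the
class. In other words, the projection from the path space to the universal cover has a continuous
section; it need not preserve the base point. -/
def HasCanonicalPaths (b : X) : Prop :=
  ∃ K : UniversalCover b → PathsFrom b, Continuous K ∧ ∀ e, UniversalCover.mk (K e) = e

/-- The part of a path up to the time `t`, reparametrized by the unit interval. -/
def PathsFrom.upTo {b : X} (t : I) (γ : PathsFrom b) : PathsFrom b :=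
  ⟨⟨fun s => γ.1 (t * s), by fun_prop⟩, by simpa using γ.2⟩

theorem PathsFrom.continuous_upTo (b : X) :
    Continuous fun q : I × PathsFrom b => PathsFrom.upTo q.1 q.2 := by
  refine Continuous.subtype_mk ?_ _
  refine ContinuousMap.continuous_of_continuous_uncurry _ ?_
  change Continuous fun q : (I × PathsFrom b) × I => q.1.2.1 (q.1.1 * q.2)
  fun_prop

/-- The universal cover is contracted by shrinking the canonical representative of each class. -/
theorem HasCanonicalPaths.contractibleSpace {b : X} (h : HasCanonicalPaths b) :
    ContractibleSpace (UniversalCover b) := by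
  obtain ⟨K, hK, hKe⟩ := h
  rw [contractible_iff_id_nullhomotopic]
  refine ⟨UniversalCover.mk (b := b) ⟨ContinuousMap.const I b, rfl⟩,
    ⟨ContinuousMap.Homotopy.symm ⟨⟨fun q => UniversalCover.mk (PathsFrom.upTo q.1 (K q.2)), ?_⟩,
      ?_, ?_⟩⟩⟩
  · exact (UniversalCover.continuous_mk b).comp ((PathsFrom.continuous_upTo b).comp
      (continuous_fst.prodMk (hK.comp continuous_snd)))
  · intro e
    refine congrArg UniversalCover.mk (Subtype.ext (ContinuousMap.ext fun s => ?_))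
    simpa [PathsFrom.upTo] using (K e).2
  · intro e
    refine Eq.trans (congrArg UniversalCover.mk (Subtype.ext (ContinuousMap.ext fun s => ?_)))
      (hKe e)
    simp [PathsFrom.upTo]

/-- Canonical paths in a product are pairs of canonical paths. -/
theorem HasCanonicalPaths.prod {b : X} {c : Y} (hb : HasCanonicalPaths b)
    (hc : HasCanonicalPaths c) : HasCanonicalPaths (b, c) := by
  obtain ⟨K, hK, hKe⟩ := hb
  obtain ⟨L, hL, hLe⟩ := hc
  have h1 := UniversalCover.continuous_map (ContinuousMap.fst (α := X) (β := Y)) (b, c)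
  have h2 := UniversalCover.continuous_map (ContinuousMap.snd (α := X) (β := Y)) (b, c)
  refine ⟨fun e => ⟨(K (UniversalCover.map ContinuousMap.fst e)).1.prodMk
    (L (UniversalCover.map ContinuousMap.snd e)).1, Prod.ext (K _).2 (L _).2⟩,
    ?_, ?_⟩
  · refine Continuous.subtype_mk ?_ _
    refine ContinuousMap.continuous_of_continuous_uncurry _ ?_
    have h3 := hK.comp h1
    have h4 := hL.comp h2
    refine Continuous.prodMk ?_ ?_
    · exact continuous_eval.comp
        ((continuous_subtype_val.comp (h3.comp continuous_fst)).prodMk continuous_snd)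
    · exact continuous_eval.comp
        ((continuous_subtype_val.comp (h4.comp continuous_fst)).prodMk continuous_snd)
  · intro e
    obtain ⟨γ, rfl⟩ := UniversalCover.mk_surjective _ e
    rw [UniversalCover.mk_eq_mk_iff]
    obtain ⟨F⟩ := (UniversalCover.mk_eq_mk_iff (δ := PathsFrom.map ContinuousMap.fst γ)).1
      (hKe (UniversalCover.map ContinuousMap.fst (UniversalCover.mk γ)))
    obtain ⟨G⟩ := (UniversalCover.mk_eq_mk_iff (δ := PathsFrom.map ContinuousMap.snd γ)).1
      (hLe (UniversalCover.map ContinuousMap.snd (UniversalCover.mk γ)))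
    exact ⟨F.prod G⟩

/-- A homotopy from `g ∘ f` to the identity conjugates the image of a path under `g ∘ f` to the path
itself. -/
theorem Path.Homotopic.conj_homotopy {f : C(X, Y)} {g : C(Y, X)}
    (H : (g.comp f).Homotopy (ContinuousMap.id X)) {b x : X} (p : Path b x)
    (δ : Path (f b) (f x)) (h : δ.Homotopic (p.map f.continuous)) :
    (((H.evalAt b).symm.trans (δ.map g.continuous)).trans (H.evalAt x)).Homotopic p := by
  have h4 := Path.Homotopic.Quotient.eq.2 (Path.Homotopic.map_trans_evalAt H p)
  have h5 : Path.Homotopic.Quotient.mk (δ.map g.continuous) =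
      Path.Homotopic.Quotient.mk (p.map (g.comp f).continuous) :=
    congrArg (fun q => Path.Homotopic.Quotient.map q g) (Path.Homotopic.Quotient.eq.2 h)
  refine Path.Homotopic.Quotient.eq.1 ?_
  change ((Path.Homotopic.Quotient.mk (H.evalAt b)).symm.trans
    (Path.Homotopic.Quotient.mk (δ.map g.continuous))).trans
      (Path.Homotopic.Quotient.mk (H.evalAt x)) = _
  rw [h5, Path.Homotopic.Quotient.trans_assoc]
  refine (congrArg _ h4).trans ?_
  change (Path.Homotopic.Quotient.mk (H.evalAt b)).symm.trans
    ((Path.Homotopic.Quotient.mk (H.evalAt b)).trans (Path.Homotopic.Quotient.mk _)) = _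
  rw [← Path.Homotopic.Quotient.trans_assoc, Path.Homotopic.Quotient.symm_trans,
    Path.Homotopic.Quotient.refl_trans]
  rfl

/-- Canonical paths for a homotopy retract: go back along the homotopy, follow the image of a
canonical path, and return along the homotopy. -/
theorem HasCanonicalPaths.of_homotopy {b : X} (f : C(X, Y)) (g : C(Y, X))
    (H : (g.comp f).Homotopy (ContinuousMap.id X)) (h : HasCanonicalPaths (f b)) :
    HasCanonicalPaths b := by
  obtain ⟨K, hK, hKe⟩ := h
  have hend : ∀ e : UniversalCover b, (K (UniversalCover.map f e)).1 1 = f e.1 :=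
    fun e => congrArg Sigma.fst (hKe (UniversalCover.map f e))
  let δ : ∀ e : UniversalCover b, Path (f b) (f e.1) := fun e =>
    ⟨(K (UniversalCover.map f e)).1, (K (UniversalCover.map f e)).2, hend e⟩
  have hδ : Continuous ↿δ :=
    continuous_eval.comp ((continuous_subtype_val.comp
      ((hK.comp (UniversalCover.continuous_map f b)).comp continuous_fst)).prodMk continuous_snd)
  let R : ∀ e : UniversalCover b, Path b e.1 := fun e =>
    ((H.evalAt b).symm.trans ((δ e).map g.continuous)).trans (H.evalAt e.1)
  have hR : Continuous ↿R := by
    refine Path.trans_continuous_family _ (Path.trans_continuous_family _ ?_ _ ?_) _ ?_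
    · exact (H.evalAt b).symm.continuous.comp continuous_snd
    · exact g.continuous.comp hδ
    · exact H.continuous.comp (continuous_snd.prodMk
        ((UniversalCover.continuous_proj b).comp continuous_fst))
  refine ⟨fun e => ⟨(R e).toContinuousMap, (R e).source⟩, ?_, ?_⟩
  · refine Continuous.subtype_mk ?_ _
    exact ContinuousMap.continuous_of_continuous_uncurry _ hR
  · rintro ⟨x, p⟩
    induction p using Path.Homotopic.Quotient.ind with
    | _ p =>
    refine UniversalCover.mk_eq_ofPath _ _ ?_
    change Path.Homotopic (R ⟨x, Path.Homotopic.Quotient.mk p⟩) p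
    have h1 : Path.Homotopic (δ ⟨x, Path.Homotopic.Quotient.mk p⟩) (p.map f.continuous) := by
      have h2 := hKe (UniversalCover.map f ⟨x, Path.Homotopic.Quotient.mk p⟩)
      have h3 : UniversalCover.mk (K (UniversalCover.map f ⟨x, Path.Homotopic.Quotient.mk p⟩)) =
        UniversalCover.mk (b := f b) ⟨(p.map f.continuous).toContinuousMap,
          (p.map f.continuous).source⟩ := by
        rw [h2]
        refine (UniversalCover.mk_eq_ofPath _ (p.map f.continuous) ?_).symm
        exact ContinuousMap.HomotopicRel.refl _
      exact UniversalCover.mk_eq_mk_iff.1 h3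
    exact Path.Homotopic.conj_homotopy H p _ h1

/-- Canonical paths for the base of a covering with contractible total space: lift the path,
replace the lift by the path of the contraction with the same endpoints, and project. -/
theorem IsCoveringMap.hasCanonicalPaths [ContractibleSpace X] {p : X → Y} (hp : IsCoveringMap p)
    (e₀ : X) : HasCanonicalPaths (p e₀) := by
  let pc : C(X, Y) := ⟨p, hp.continuous⟩
  obtain ⟨c, ⟨H⟩⟩ := id_nullhomotopic X
  let P : ∀ e : X, Path e₀ e := fun e => (H.evalAt e₀).trans (H.evalAt e).symm
  have hP : Continuous ↿P := by
    refine Path.trans_continuous_family _ ?_ _ (Path.symm_continuous_family _ ?_)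
    · exact (H.evalAt e₀).continuous.comp continuous_snd
    · exact H.continuous.comp (continuous_snd.prodMk continuous_fst)
  have hPc : Continuous fun e : X => (⟨(P e).toContinuousMap, (P e).source⟩ : PathsFrom e₀) :=
    Continuous.subtype_mk (ContinuousMap.continuous_of_continuous_uncurry _ hP) _
  -- The endpoint of the lift with origin `e₀` of the paths in a given class.
  let r : UniversalCover (p e₀) → X := fun e => hp.monodromy e.2 ⟨e₀, rfl⟩
  have hr : Continuous r := by
    rw [continuous_coinduced_dom]
    let Γ : C(I × PathsFrom (p e₀), Y) := ⟨fun q => q.2.1 q.1, by fun_prop⟩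
    have h0 : ∀ γ : PathsFrom (p e₀), Γ (0, γ) = p (ContinuousMap.const _ e₀ γ) := fun γ => γ.2
    exact (hp.liftHomotopy Γ (ContinuousMap.const _ e₀) h0).continuous.comp
      (continuous_const.prodMk continuous_id)
  refine ⟨fun e => PathsFrom.map pc ⟨(P (r e)).toContinuousMap, (P (r e)).source⟩,
    (PathsFrom.continuous_map pc e₀).comp (hPc.comp hr), fun e => ?_⟩
  obtain ⟨γ, rfl⟩ := UniversalCover.mk_surjective _ e
  let L : PathsFrom e₀ := ⟨hp.liftPath γ.1 e₀ γ.2, hp.liftPath_zero _ _ _⟩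
  have hL : PathsFrom.map pc L = γ :=
    Subtype.ext (DFunLike.coe_injective (hp.liftPath_lifts γ.1 e₀ γ.2))
  conv_rhs => rw [← hL]
  rw [← UniversalCover.map_mk, ← UniversalCover.map_mk]
  congr 1
  refine (UniversalCover.mk_eq_ofPath L (P (r (UniversalCover.mk γ))) ?_).symm ▸ ?_
  -- The lift and the path through the contraction have the same ends.
  · exact SimplyConnectedSpace.paths_homotopic L.path (P (L.1 1))
  · refine UniversalCover.mk_eq_ofPath _ _ ?_
    exact ContinuousMap.HomotopicRel.refl _

end PathSections

/-! ### Fundamental groups -/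

section FundamentalGroups

variable {X Y : Type*} [TopologicalSpace X] [TopologicalSpace Y]

/-- The fundamental group of a product. -/
def FundamentalGroup.prodMulEquiv (x : X) (y : Y) :
    FundamentalGroup (X × Y) (x, y) ≃* FundamentalGroup X x × FundamentalGroup Y y where
  toFun p := (Path.Homotopic.projLeft p, Path.Homotopic.projRight p)
  invFun q := Path.Homotopic.prod q.1 q.2
  left_inv p := Path.Homotopic.prod_projLeft_projRight p
  right_inv q := Prod.ext (Path.Homotopic.projLeft_prod _ _) (Path.Homotopic.projRight_prod _ _)
  map_mul' p q := by
    exact Prod.ext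
      ((FundamentalGroup.map (ContinuousMap.fst (α := X) (β := Y)) (x, y)).map_mul p q)
      ((FundamentalGroup.map (ContinuousMap.snd (α := X) (β := Y)) (x, y)).map_mul p q)

theorem ContinuousMap.HomotopyEquiv.nonempty_fundamentalGroup_mulEquiv
    (h : ContinuousMap.HomotopyEquiv X Y) (x : X) :
    Nonempty (FundamentalGroup X x ≃* FundamentalGroup Y (h x)) := by
  let e := FundamentalGroupoidFunctor.equivOfHomotopyEquiv h
  exact ⟨e.fullyFaithfulFunctor.mulEquivEnd ⟨x⟩⟩

end FundamentalGroups

/-! ### The Cayley tree of a free group -/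

namespace FreeTree

variable {α : Type} [DecidableEq α]

/-- `1` if the reduced word of `a` ends with the inverse of the letter `i`, and `0` otherwise. -/
def lastInv (a : FreeGroup α) (i : α) : ℝ :=
  if a.toWord.getLast? = some (i, false) then 1 else 0

theorem toWord_cons {a : FreeGroup α} {x : α × Bool} {L : List (α × Bool)}
    (h : a.toWord = x :: L) :
    (FreeGroup.mk L).toWord = L ∧ a = FreeGroup.mk [x] * FreeGroup.mk L := by
  constructor
  · rw [FreeGroup.toWord_mk]
    refine FreeGroup.IsReduced.reduce_eq ?_
    have := FreeGroup.isReduced_toWord (x := a)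
    rw [h] at this
    exact List.IsChain.tail this
  · rw [FreeGroup.mul_mk, List.singleton_append, ← h, FreeGroup.mk_toWord]

theorem toWord_of_inv_mul (k : α) (a : FreeGroup α) :
    ((FreeGroup.of k)⁻¹ * a).toWord = (k, false) :: a.toWord ∨
      a.toWord = (k, true) :: ((FreeGroup.of k)⁻¹ * a).toWord := by
  have h : ((FreeGroup.of k)⁻¹ * a).toWord = FreeGroup.reduce ((k, false) :: a.toWord) := by
    rw [FreeGroup.toWord_mul, FreeGroup.toWord_inv, FreeGroup.toWord_of]
    rfl
  rw [FreeGroup.reduce.cons, FreeGroup.reduce_toWord] at h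
  generalize a.toWord = L at *
  rw [h]
  cases L with
  | nil => exact Or.inl rfl
  | cons y L =>
    obtain ⟨j, b⟩ := y
    by_cases hy : k = j ∧ b = true
    · obtain ⟨rfl, rfl⟩ := hy
      right
      simp
    · left
      have : ¬ ((k, false).1 = (j, b).1 ∧ (k, false).2 = !(j, b).2) := by simpa using hy
      exact if_neg this

theorem lastInv_of_inv_mul {k i : α} {a : FreeGroup α} (h : a ≠ 1 ∨ i ≠ k) :
    lastInv ((FreeGroup.of k)⁻¹ * a) i = lastInv a i := by
  unfold lastInv
  rcases toWord_of_inv_mul k a with h1 | h1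
  · rw [h1]
    cases h2 : a.toWord with
    | nil =>
      have : a = 1 := by rwa [FreeGroup.toWord_eq_nil_iff] at h2
      have hik : i ≠ k := by tauto
      simp [Ne.symm hik]
    | cons y L => rw [List.getLast?_cons_cons]
  · rw [h1]
    cases h2 : ((FreeGroup.of k)⁻¹ * a).toWord with
    | nil => simp
    | cons y L => rw [List.getLast?_cons_cons]

@[simp] theorem lastInv_one (i : α) : lastInv (1 : FreeGroup α) i = 0 := by simp [lastInv]

@[simp] theorem lastInv_of_inv (i : α) : lastInv (FreeGroup.of i)⁻¹ i = 1 := by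
  simp [lastInv, FreeGroup.toWord_inv, FreeGroup.invRev]

theorem lastInv_mem (a : FreeGroup α) (i : α) : lastInv a i = 0 ∨ lastInv a i = 1 := by
  unfold lastInv
  split <;> simp

/-- The coordinate functions of the vertex `u` of the tree: the coordinate at the edge
`(h, i)`, which joins `h` to `h * i`, says on which side of this edge `u` lies. -/
def vertexCoord (u : FreeGroup α) (e : FreeGroup α × α) : ℝ := lastInv (u⁻¹ * e.1) e.2

/-- The point at position `s` of the edge which joins `u` to `u * k`. -/
def edgeCoord (u : FreeGroup α) (k : α) (s : ℝ) : FreeGroup α × α → ℝ :=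
  Function.update (vertexCoord u) (u, k) s

theorem vertexCoord_mem (u : FreeGroup α) (e : FreeGroup α × α) :
    vertexCoord u e = 0 ∨ vertexCoord u e = 1 := lastInv_mem _ _

theorem vertexCoord_self (u : FreeGroup α) (k : α) : vertexCoord u (u, k) = 0 := by
  simp [vertexCoord]

theorem vertexCoord_mul_of_self (u : FreeGroup α) (k : α) :
    vertexCoord (u * FreeGroup.of k) (u, k) = 1 := by
  simp [vertexCoord, mul_assoc]

/-- The vertices at the ends of an edge have the same coordinate at every other edge. -/
theorem vertexCoord_mul_of {u : FreeGroup α} {k : α} {e : FreeGroup α × α} (h : e ≠ (u, k)) :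
    vertexCoord (u * FreeGroup.of k) e = vertexCoord u e := by
  unfold vertexCoord
  rw [mul_inv_rev, mul_assoc]
  refine lastInv_of_inv_mul ?_
  by_contra hc
  simp only [not_or, not_not, ne_eq] at hc
  refine h (Prod.ext ?_ hc.2)
  exact (inv_mul_eq_one.1 hc.1).symm

theorem edgeCoord_zero (u : FreeGroup α) (k : α) : edgeCoord u k 0 = vertexCoord u := by
  rw [edgeCoord, ← vertexCoord_self u k, Function.update_eq_self]

theorem edgeCoord_one (u : FreeGroup α) (k : α) :
    edgeCoord u k 1 = vertexCoord (u * FreeGroup.of k) := by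
  funext e
  by_cases h : e = (u, k)
  · subst h
    simp [edgeCoord, vertexCoord_mul_of_self]
  · rw [edgeCoord, Function.update_of_ne h, vertexCoord_mul_of h]

/-- Every vertex other than `1` is joined by an edge to one which is nearer to `1`. -/
theorem exists_parent {u : FreeGroup α} (h : u ≠ 1) :
    ∃ (v : FreeGroup α) (k : α), u.norm = v.norm + 1 ∧
      (u = v * FreeGroup.of k ∨ v = u * FreeGroup.of k) := by
  cases h1 : (u⁻¹).toWord with
  | nil =>
    rw [FreeGroup.toWord_eq_nil_iff, inv_eq_one] at h1
    exact absurd h1 h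
  | cons x L =>
    obtain ⟨h2, h3⟩ := toWord_cons h1
    refine ⟨(FreeGroup.mk L)⁻¹, x.1, ?_, ?_⟩
    · rw [FreeGroup.norm_inv_eq, ← FreeGroup.norm_inv_eq (x := u), FreeGroup.norm, FreeGroup.norm,
      h1, h2]
      rfl
    · obtain ⟨k, b⟩ := x
      have h4 : u = (FreeGroup.mk L)⁻¹ * (FreeGroup.mk [(k, b)])⁻¹ := by
        rw [← mul_inv_rev, ← h3, inv_inv]
      cases b with
      | false => left; rw [h4]; rfl
      | true => right; rw [h4]; exact (inv_mul_cancel_right _ (FreeGroup.of k)).symm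

/-- The distance from `1` to the far end of an edge. -/
def depth (e : FreeGroup α × α) : ℕ := max e.1.norm (e.1 * FreeGroup.of e.2).norm

theorem depth_pos (e : FreeGroup α × α) : 1 ≤ depth e := by
  by_contra h
  have h1 : depth e = 0 := by omega
  have h2 : e.1.norm = 0 := Nat.eq_zero_of_le_zero (h1 ▸ le_max_left _ _)
  have h3 : (e.1 * FreeGroup.of e.2).norm = 0 := Nat.eq_zero_of_le_zero (h1 ▸ le_max_right _ _)
  rw [FreeGroup.norm_eq_zero] at h2 h3
  rw [h2, one_mul] at h3
  exact FreeGroup.of_ne_one _ h3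

/-- A vertex differs from `1` only in the coordinates at the edges on the way from `1` to it, whose
depth is at most its distance from `1`. -/
theorem depth_le_of_vertexCoord_ne {e : FreeGroup α × α} (n : ℕ) {u : FreeGroup α}
    (hn : u.norm = n) (h : vertexCoord u e ≠ vertexCoord 1 e) : depth e ≤ u.norm := by
  induction n generalizing u with
  | zero =>
    rw [FreeGroup.norm_eq_zero] at hn
    exact absurd (hn ▸ rfl) h
  | succ n ih =>
    have hu : u ≠ 1 := by
      rintro rfl
      simp at hn
    obtain ⟨v, k, h1, h2⟩ := exists_parent hu
    rcases h2 with h2 | h2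
    · by_cases he : e = (v, k)
      · subst he
        simp only [depth, ← h2]
        omega
      · rw [h2, vertexCoord_mul_of he] at h
        have := ih (by omega) h
        omega
    · by_cases he : e = (u, k)
      · subst he
        simp only [depth, ← h2]
        omega
      · rw [← vertexCoord_mul_of he, ← h2] at h
        have := ih (by omega) h
        omega

/-- Some edge at the vertex `1` separates a vertex `u ≠ 1` from `1`. -/
theorem exists_separating {u : FreeGroup α} (h : u ≠ 1) :
    ∃ i, vertexCoord u (1, i) = 1 ∨ (vertexCoord u ((FreeGroup.of i)⁻¹, i) = 0) := by
  cases h1 : u.toWord with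
  | nil => exact absurd (by rwa [FreeGroup.toWord_eq_nil_iff] at h1) h
  | cons x L =>
    obtain ⟨i, b⟩ := x
    refine ⟨i, ?_⟩
    cases b with
    | true =>
      left
      simp [vertexCoord, lastInv, FreeGroup.toWord_inv, h1, FreeGroup.invRev]
    | false =>
      right
      obtain ⟨h2, h3⟩ := toWord_cons h1
      have h4 : u⁻¹ * (FreeGroup.of i)⁻¹ = (FreeGroup.mk L)⁻¹ := by
        rw [h3, mul_inv_rev, mul_assoc]
        have : (FreeGroup.mk [(i, false)])⁻¹ = FreeGroup.of i := rfl
        rw [this, mul_inv_cancel, mul_one]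
      have h5 := FreeGroup.isReduced_toWord (x := u)
      rw [h1] at h5
      simp only [vertexCoord, lastInv, h4, FreeGroup.toWord_inv, h2]
      refine if_neg ?_
      cases L with
      | nil => simp [FreeGroup.invRev]
      | cons y L =>
        obtain ⟨j, b⟩ := y
        have := (List.isChain_cons_cons.1 h5).1
        simp [FreeGroup.invRev]
        rintro rfl
        simpa using this rfl

/-- The time at which the edges of depth `n` are contracted. These functions of `t` increase from
`0` to `1`, and the one for `n` reaches `1` before the one for `n + 1` leaves `0`. -/
noncomputable def schedule (n : ℕ) (t : ℝ) : ℝ := max 0 (min 1 (2 ^ n * (t - 1) + 2))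

theorem continuous_schedule (n : ℕ) : Continuous (schedule n) := by
  unfold schedule
  fun_prop

theorem schedule_nonneg (n : ℕ) (t : ℝ) : 0 ≤ schedule n t := le_max_left _ _

theorem schedule_zero {n : ℕ} (hn : 1 ≤ n) : schedule n 0 = 0 := by
  have : (2 : ℝ) ^ 1 ≤ 2 ^ n := pow_le_pow_right₀ (by norm_num) hn
  refine max_eq_left ((min_le_right _ _).trans ?_)
  linarith

theorem schedule_one (n : ℕ) : schedule n 1 = 1 := by norm_num [schedule]

theorem schedule_eq_one {m n : ℕ} (h : m < n) {t : ℝ} (ht : schedule n t ≠ 0) (ht1 : t ≤ 1) :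
    schedule m t = 1 := by
  have h1 : 0 < 2 ^ n * (t - 1) + 2 := by
    by_contra hc
    exact ht (max_eq_left ((min_le_right _ _).trans (not_lt.1 hc)))
  have h2 : (2 : ℝ) ^ (m + 1) ≤ 2 ^ n := pow_le_pow_right₀ (by norm_num) h
  rw [pow_succ] at h2
  have h3 : 1 ≤ 2 ^ m * (t - 1) + 2 := by nlinarith
  unfold schedule
  rw [min_eq_left h3, max_eq_right zero_le_one]

/-- Move the coordinates of a point towards those of the vertex `1`, to distance at most
`schedule (depth e) t` from it in the coordinate `e`. As `t` decreases from `1` to `0`, this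
retracts the tree to the vertex `1`, the edges which are farthest away first. -/
noncomputable def contract (t : ℝ) (φ : FreeGroup α × α → ℝ) (e : FreeGroup α × α) : ℝ :=
  vertexCoord 1 e +
    max (-schedule (depth e) t) (min (schedule (depth e) t) (φ e - vertexCoord 1 e))

theorem contract_apply_of_eq {t : ℝ} {φ : FreeGroup α × α → ℝ} {e : FreeGroup α × α}
    (h : φ e = vertexCoord 1 e) : contract t φ e = φ e := by
  have := schedule_nonneg (depth e) t
  simp [contract, h, this]

theorem contract_apply_of_schedule_eq_zero {t : ℝ} {φ : FreeGroup α × α → ℝ}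
    {e : FreeGroup α × α} (h : schedule (depth e) t = 0) : contract t φ e = vertexCoord 1 e := by
  rw [contract, h]
  rcases le_total 0 (φ e - vertexCoord 1 e) with h | h <;> simp [h]

theorem contract_apply_of_schedule_eq_one {t : ℝ} {φ : FreeGroup α × α → ℝ}
    {e : FreeGroup α × α} (h : schedule (depth e) t = 1) (h0 : φ e ∈ Set.Icc (0 : ℝ) 1) :
    contract t φ e = φ e := by
  obtain ⟨h1, h2⟩ := h0
  have := vertexCoord_mem 1 e
  rw [contract, h, min_eq_right (by rcases this with h | h <;> linarith),
    max_eq_right (by rcases this with h | h <;> linarith)]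
  ring

theorem contract_apply_mem (t : ℝ) {φ : FreeGroup α × α → ℝ} {e : FreeGroup α × α}
    (h0 : φ e ∈ Set.Icc (0 : ℝ) 1) : contract t φ e ∈ Set.Icc (0 : ℝ) 1 := by
  obtain ⟨h1, h2⟩ := h0
  have h3 := schedule_nonneg (depth e) t
  unfold contract
  rcases vertexCoord_mem 1 e with h | h <;>
    rw [h] <;> constructor
  · have := le_max_right (-schedule (depth e) t) (min (schedule (depth e) t) (φ e - 0))
    have h4 : 0 ≤ min (schedule (depth e) t) (φ e - 0) := le_min h3 (by linarith)
    linarith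
  · have h5 := min_le_right (schedule (depth e) t) (φ e - 0)
    have : max (-schedule (depth e) t) (min (schedule (depth e) t) (φ e - 0)) ≤ 1 :=
      max_le (by linarith) (by linarith)
    linarith
  · have h4 := le_max_right (-schedule (depth e) t) (min (schedule (depth e) t) (φ e - 1))
    have h5 : min (schedule (depth e) t) (φ e - 1) = φ e - 1 := min_eq_right (by linarith)
    linarith
  · have h5 := min_le_right (schedule (depth e) t) (φ e - 1)
    have : max (-schedule (depth e) t) (min (schedule (depth e) t) (φ e - 1)) ≤ 0 :=
      max_le (by linarith) (by linarith)
    linarith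

/-- The points of the tree, as functions on the set of edges. -/
def IsPoint (φ : FreeGroup α × α → ℝ) : Prop :=
  ∃ (u : FreeGroup α) (k : α) (s : ℝ), s ∈ Set.Icc (0 : ℝ) 1 ∧ φ = edgeCoord u k s

theorem isPoint_edgeCoord (u : FreeGroup α) (k : α) {s : ℝ} (hs : s ∈ Set.Icc (0 : ℝ) 1) :
    IsPoint (edgeCoord u k s) := ⟨u, k, s, hs, rfl⟩

theorem isPoint_vertexCoord [Nonempty α] (u : FreeGroup α) : IsPoint (vertexCoord u) :=
  ⟨u, Classical.arbitrary α, 0, by simp, (edgeCoord_zero _ _).symm⟩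

/-- The contraction of a point on an edge `e` whose near end is the vertex `v`: either `e` has
already been collapsed to `v`, or the point moves along `e`. -/
theorem contract_update {t : ℝ} (ht1 : t ≤ 1) {v : FreeGroup α} {e : FreeGroup α × α}
    (hd : depth e = v.norm + 1) (s : ℝ) (hs : s ∈ Set.Icc (0 : ℝ) 1) :
    (schedule (depth e) t = 0 ∧
      contract t (Function.update (vertexCoord v) e s) = contract t (vertexCoord v)) ∨
    ∃ s' ∈ Set.Icc (0 : ℝ) 1, contract t (Function.update (vertexCoord v) e s) =
      Function.update (vertexCoord v) e s' := by
  by_cases hc : schedule (depth e) t = 0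
  · left
    refine ⟨hc, funext fun e' => ?_⟩
    by_cases he : e' = e
    · subst he
      rw [contract_apply_of_schedule_eq_zero hc, contract_apply_of_schedule_eq_zero hc]
    · simp only [contract, Function.update_of_ne he]
  · right
    refine ⟨contract t (Function.update (vertexCoord v) e s) e,
      contract_apply_mem t (by simpa using hs), funext fun e' => ?_⟩
    by_cases he : e' = e
    · subst he
      simp
    -- As the edge `e` has begun to move, all edges between `1` and `v` are still extended.
    · rw [Function.update_of_ne he]
      have h1 : Function.update (vertexCoord v) e s e' = vertexCoord v e' :=
        Function.update_of_ne he _ _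
      by_cases h2 : vertexCoord v e' = vertexCoord 1 e'
      · rw [contract_apply_of_eq (by rw [h1, h2]), h1]
      · have h3 := depth_le_of_vertexCoord_ne _ rfl h2
        rw [contract_apply_of_schedule_eq_one (schedule_eq_one (by omega) hc ht1), h1]
        rw [h1]
        rcases vertexCoord_mem v e' with h | h <;>
          simp [h]

/-- The points of an edge, in terms of the vertex at its end instead of the one at its origin. -/
theorem edgeCoord_eq_update (u : FreeGroup α) (k : α) (s : ℝ) :
    edgeCoord u k s = Function.update (vertexCoord (u * FreeGroup.of k)) (u, k) s := by
  funext e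
  by_cases h : e = (u, k)
  · subst h
    simp [edgeCoord]
  · rw [edgeCoord, Function.update_of_ne h, Function.update_of_ne h, vertexCoord_mul_of h]

theorem isPoint_contract_vertexCoord [Nonempty α] {t : ℝ} (ht1 : t ≤ 1) (n : ℕ)
    {u : FreeGroup α} (hn : u.norm = n) : IsPoint (contract t (vertexCoord u)) := by
  induction n generalizing u with
  | zero =>
    rw [FreeGroup.norm_eq_zero] at hn
    subst hn
    have : contract t (vertexCoord (1 : FreeGroup α)) = vertexCoord 1 :=
      funext fun e => contract_apply_of_eq rfl
    rw [this]
    exact isPoint_vertexCoord 1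
  | succ n ih =>
    have hu : u ≠ 1 := by
      rintro rfl
      simp at hn
    obtain ⟨v, k, h1, h2⟩ := exists_parent hu
    have hv := ih (u := v) (by omega)
    rcases h2 with h2 | h2
    · have h3 : vertexCoord u = Function.update (vertexCoord v) (v, k) 1 := by
        rw [h2, ← edgeCoord_one]
        rfl
      have hd : depth (v, k) = v.norm + 1 := by
        simp only [depth, ← h2]
        omega
      rcases contract_update ht1 hd 1 (by simp) with ⟨-, h4⟩ | ⟨s', hs', h4⟩
      · rw [h3, h4]
        exact hv
      · rw [h3, h4]
        exact isPoint_edgeCoord v k hs'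
    · have h3 : vertexCoord u = Function.update (vertexCoord v) (u, k) 0 := by
        rw [h2, ← edgeCoord_eq_update, edgeCoord_zero]
      have hd : depth (u, k) = v.norm + 1 := by
        simp only [depth, ← h2]
        omega
      rcases contract_update ht1 hd 0 (by simp) with ⟨-, h4⟩ | ⟨s', hs', h4⟩
      · rw [h3, h4]
        exact hv
      · rw [h3, h4, h2, ← edgeCoord_eq_update]
        exact isPoint_edgeCoord u k hs'

/-- One of the two ends of an edge is nearer to `1` than the other. -/
theorem norm_mul_of (u : FreeGroup α) (k : α) :
    (u * FreeGroup.of k).norm = u.norm + 1 ∨ u.norm = (u * FreeGroup.of k).norm + 1 := by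
  have h1 : (u * FreeGroup.of k).norm = ((FreeGroup.of k)⁻¹ * u⁻¹).toWord.length := by
    rw [← mul_inv_rev, ← FreeGroup.norm_inv_eq]
    rfl
  have h2 : u.norm = (u⁻¹).toWord.length := by
    rw [← FreeGroup.norm_inv_eq]
    rfl
  rw [h1, h2]
  rcases toWord_of_inv_mul k u⁻¹ with h | h
  · left
    rw [h]
    rfl
  · right
    conv_lhs => rw [h]
    rfl

/-- The contraction preserves the tree. -/
theorem isPoint_contract [Nonempty α] {t : ℝ} (ht1 : t ≤ 1) {φ : FreeGroup α × α → ℝ}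
    (hφ : IsPoint φ) : IsPoint (contract t φ) := by
  obtain ⟨u, k, s, hs, rfl⟩ := hφ
  rcases norm_mul_of u k with h | h
  · have hd : depth (u, k) = u.norm + 1 := by
      simp only [depth]
      omega
    rcases contract_update ht1 hd s hs with ⟨-, h4⟩ | ⟨s', hs', h4⟩
    · exact (show contract t (edgeCoord u k s) = _ from h4) ▸
        isPoint_contract_vertexCoord ht1 _ rfl
    · exact (show contract t (edgeCoord u k s) = _ from h4) ▸ isPoint_edgeCoord u k hs'
  · have hd : depth (u, k) = (u * FreeGroup.of k).norm + 1 := by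
      simp only [depth]
      omega
    rw [edgeCoord_eq_update]
    rcases contract_update ht1 hd s hs with ⟨-, h4⟩ | ⟨s', hs', h4⟩
    · rw [h4]
      exact isPoint_contract_vertexCoord ht1 _ rfl
    · rw [h4, ← edgeCoord_eq_update]
      exact isPoint_edgeCoord u k hs'

variable (α) in
/-- The Cayley tree of the free group on `α`, as a space of functions on the set of edges: the
coordinate of a point at an edge is the position of its projection to this edge. The topology is
that of pointwise convergence. -/
def Tree : Type := {φ : FreeGroup α × α → ℝ // IsPoint φ}

instance : TopologicalSpace (Tree α) := instTopologicalSpaceSubtype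

instance : T2Space (Tree α) := inferInstanceAs (T2Space {φ : FreeGroup α × α → ℝ // IsPoint φ})

theorem continuous_coord (e : FreeGroup α × α) : Continuous fun p : Tree α => p.1 e :=
  (continuous_apply e).comp continuous_subtype_val

theorem vertexCoord_translate (g u h : FreeGroup α) (i : α) :
    vertexCoord u (g⁻¹ * h, i) = vertexCoord (g * u) (h, i) := by
  simp [vertexCoord, mul_assoc]

theorem edgeCoord_translate (g u h : FreeGroup α) (k i : α) (s : ℝ) :
    edgeCoord u k s (g⁻¹ * h, i) = edgeCoord (g * u) k s (h, i) := by
  unfold edgeCoord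
  by_cases hc : (h, i) = (g * u, k)
  · obtain ⟨rfl, rfl⟩ := Prod.mk.inj hc
    simp
  · have hc' : (g⁻¹ * h, i) ≠ (u, k) := by
      rintro h1
      obtain ⟨rfl, rfl⟩ := Prod.mk.inj h1
      simp at hc
    rw [Function.update_of_ne hc, Function.update_of_ne hc', vertexCoord_translate]

/-- The free group acts on its Cayley tree by translations. -/
instance : MulAction (FreeGroup α) (Tree α) where
  smul g p := ⟨fun e => p.1 (g⁻¹ * e.1, e.2), by
    obtain ⟨_, u, k, s, hs, rfl⟩ := p
    exact ⟨g * u, k, s, hs, funext fun e => edgeCoord_translate g u e.1 k e.2 s⟩⟩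
  one_smul p := Subtype.ext (funext fun e => by
    change p.1 (1⁻¹ * e.1, e.2) = p.1 e
    simp)
  mul_smul g h p := Subtype.ext (funext fun e => by
    change p.1 ((g * h)⁻¹ * e.1, e.2) = p.1 (h⁻¹ * (g⁻¹ * e.1), e.2)
    rw [mul_inv_rev, mul_assoc])

theorem smul_coord (g : FreeGroup α) (p : Tree α) (e : FreeGroup α × α) :
    (g • p).1 e = p.1 (g⁻¹ * e.1, e.2) := rfl

instance : ContinuousConstSMul (FreeGroup α) (Tree α) where
  continuous_const_smul g :=
    Continuous.subtype_mk (continuous_pi fun e : FreeGroup α × α =>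
      continuous_coord (g⁻¹ * e.1, e.2)) _

/-- The point at position `s` of the edge from `u` to `u * k`. -/
def edge (u : FreeGroup α) (k : α) (s : I) : Tree α := ⟨edgeCoord u k s, u, k, s, s.2, rfl⟩

theorem continuous_edge (u : FreeGroup α) (k : α) : Continuous (edge u k) := by
  refine Continuous.subtype_mk (continuous_pi fun e => ?_) _
  by_cases he : e = (u, k)
  · subst he
    simpa [edgeCoord] using continuous_subtype_val
  · simp only [edgeCoord, Function.update_of_ne he]
    exact continuous_const

theorem exists_edge (p : Tree α) : ∃ u k s, p = edge u k s := by
  obtain ⟨_, u, k, s, hs, rfl⟩ := p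
  exact ⟨u, k, ⟨s, hs⟩, rfl⟩

theorem smul_edge (g u : FreeGroup α) (k : α) (s : I) : g • edge u k s = edge (g * u) k s :=
  Subtype.ext (funext fun e => edgeCoord_translate g u e.1 k e.2 s)

theorem edge_one_eq (u : FreeGroup α) (k j : α) :
    edge u k 1 = edge (u * FreeGroup.of k) j 0 :=
  Subtype.ext ((edgeCoord_one u k).trans (edgeCoord_zero _ j).symm)

theorem edge_zero_eq (u : FreeGroup α) (k j : α) : edge u k 0 = edge u j 0 :=
  Subtype.ext ((edgeCoord_zero u k).trans (edgeCoord_zero _ j).symm)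

theorem edge_coord_self (u : FreeGroup α) (k : α) (s : I) : (edge u k s).1 (u, k) = s := by
  simp [edge, edgeCoord]

/-- The Cayley tree is contractible, by retraction to the vertex `1`. -/
instance [Nonempty α] : ContractibleSpace (Tree α) := by
  rw [contractible_iff_id_nullhomotopic]
  have hv : IsPoint (vertexCoord (1 : FreeGroup α)) := isPoint_vertexCoord 1
  refine ⟨⟨vertexCoord 1, hv⟩, ⟨ContinuousMap.Homotopy.symm
    ⟨⟨fun q => ⟨contract q.1 q.2.1, isPoint_contract q.1.2.2 q.2.2⟩, ?_⟩, ?_, ?_⟩⟩⟩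
  · refine Continuous.subtype_mk (continuous_pi fun e => ?_) _
    have h1 : Continuous fun q : I × Tree α => schedule (depth e) (q.1 : ℝ) :=
      (continuous_schedule _).comp (continuous_subtype_val.comp continuous_fst)
    have h2 : Continuous fun q : I × Tree α => q.2.1 e := (continuous_coord e).comp continuous_snd
    exact continuous_const.add (h1.neg.max (h1.min (h2.sub continuous_const)))
  · intro p
    exact Subtype.ext (funext fun e =>
      contract_apply_of_schedule_eq_zero (schedule_zero (depth_pos e)))
  · rintro ⟨_, u, k, s, hs, rfl⟩
    refine Subtype.ext (funext fun e => contract_apply_of_schedule_eq_one (schedule_one _) ?_)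
    change edgeCoord u k s e ∈ _
    by_cases he : e = (u, k)
    · subst he
      simpa [edgeCoord] using hs
    · rw [edgeCoord, Function.update_of_ne he]
      rcases vertexCoord_mem u e with h | h <;> simp [h]

/-- The open star of the vertex `1`. -/
def openStar : Set (Tree α) :=
  {p | ∀ i, p.1 (1, i) < 1 ∧ 0 < p.1 ((FreeGroup.of i)⁻¹, i)}

theorem isOpen_openStar [Finite α] : IsOpen (openStar (α := α)) := by
  have : openStar (α := α) =
      ⋂ i, ({p | p.1 (1, i) < 1} ∩ {p | 0 < p.1 ((FreeGroup.of i)⁻¹, i)}) := by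
    ext p
    simp [openStar]
  rw [this]
  exact isOpen_iInter_of_finite fun i =>
    (isOpen_lt (continuous_coord _) continuous_const).inter
      (isOpen_lt continuous_const (continuous_coord _))

/-- The open star consists of points on the edges which start or end at the vertex `1`. -/
theorem eq_edge_of_mem_openStar {p : Tree α} (hp : p ∈ openStar) :
    ∃ (i : α) (s : I), p = edge 1 i s ∨ p = edge (FreeGroup.of i)⁻¹ i s := by
  obtain ⟨u, k, s, rfl⟩ := exists_edge p
  refine ⟨k, s, ?_⟩
  by_contra hc
  rw [not_or] at hc
  have hu1 : u ≠ 1 := by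
    rintro rfl
    exact hc.1 rfl
  have huk : u ≠ (FreeGroup.of k)⁻¹ := by
    rintro rfl
    exact hc.2 rfl
  obtain ⟨i, h | h⟩ := exists_separating hu1
  · have h1 := (hp i).1
    have : (edge u k s).1 (1, i) = vertexCoord u (1, i) :=
      Function.update_of_ne (fun h => hu1 (Prod.mk.inj h).1.symm) _ _
    linarith
  · have h1 := (hp i).2
    have : (edge u k s).1 ((FreeGroup.of i)⁻¹, i) = vertexCoord u ((FreeGroup.of i)⁻¹, i) := by
      refine Function.update_of_ne (fun h => ?_) _ _
      obtain ⟨rfl, rfl⟩ := Prod.mk.inj h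
      exact huk rfl
    linarith

theorem vertexCoord_inv_of (i : α) (e : FreeGroup α × α) (h : e ≠ ((FreeGroup.of i)⁻¹, i)) :
    vertexCoord (FreeGroup.of i)⁻¹ e = vertexCoord 1 e := by
  rw [← vertexCoord_mul_of h, inv_mul_cancel]

/-- The points at distance less than `1 / 2` from the vertex `1`. -/
def halfStar : Set (Tree α) :=
  {p | ∀ i, p.1 (1, i) < 1 / 2 ∧ 1 / 2 < p.1 ((FreeGroup.of i)⁻¹, i)}

theorem isOpen_halfStar [Finite α] : IsOpen (halfStar (α := α)) := by
  have : halfStar (α := α) =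
      ⋂ i, ({p | p.1 (1, i) < 1 / 2} ∩ {p | 1 / 2 < p.1 ((FreeGroup.of i)⁻¹, i)}) := by
    ext p
    simp [halfStar]
  rw [this]
  exact isOpen_iInter_of_finite fun i =>
    (isOpen_lt (continuous_coord _) continuous_const).inter
      (isOpen_lt continuous_const (continuous_coord _))

theorem vertexCoord_one_one (i : α) : vertexCoord (1 : FreeGroup α) (1, i) = 0 :=
  vertexCoord_self 1 i

theorem vertexCoord_one_inv_of (i : α) :
    vertexCoord (1 : FreeGroup α) ((FreeGroup.of i)⁻¹, i) = 1 := by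
  simp [vertexCoord]

/-- All coordinates of a point of the half star are near to those of the vertex `1`. -/
theorem abs_sub_lt_of_mem_halfStar {p : Tree α} (hp : p ∈ halfStar) (e : FreeGroup α × α) :
    |p.1 e - vertexCoord 1 e| < 1 / 2 := by
  have hp' : p ∈ openStar := fun i => ⟨by linarith [(hp i).1], by linarith [(hp i).2]⟩
  obtain ⟨i, s, rfl | rfl⟩ := eq_edge_of_mem_openStar hp'
  · by_cases he : e = (1, i)
    · subst he
      have := (hp i).1
      rw [edge_coord_self] at this ⊢
      rw [vertexCoord_one_one, sub_zero, abs_of_nonneg s.2.1]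
      exact this
    · have : (edge 1 i s).1 e = vertexCoord 1 e := Function.update_of_ne he _ _
      rw [this]
      norm_num
  · by_cases he : e = ((FreeGroup.of i)⁻¹, i)
    · subst he
      have := (hp i).2
      rw [edge_coord_self] at this ⊢
      rw [vertexCoord_one_inv_of, abs_sub_comm, abs_of_nonneg (by linarith [s.2.2])]
      linarith
    · have : (edge (FreeGroup.of i)⁻¹ i s).1 e = vertexCoord (FreeGroup.of i)⁻¹ e :=
        Function.update_of_ne he _ _
      rw [this, vertexCoord_inv_of i e he]
      norm_num

theorem eq_one_of_mem_halfStar {g : FreeGroup α} {p : Tree α} (h1 : p ∈ halfStar)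
    (h2 : g • p ∈ halfStar) : g = 1 := by
  by_contra hg
  obtain ⟨i, h | h⟩ := exists_separating (u := g) hg
  · have h3 := abs_lt.1 (abs_sub_lt_of_mem_halfStar h1 (g⁻¹ * 1, i))
    rw [vertexCoord_translate, mul_one g, h] at h3
    have h4 := (h2 i).1
    rw [smul_coord] at h4
    linarith [h3.1]
  · have h3 := abs_lt.1 (abs_sub_lt_of_mem_halfStar h1 (g⁻¹ * (FreeGroup.of i)⁻¹, i))
    rw [vertexCoord_translate, mul_one g, h] at h3
    have h4 := (h2 i).2
    rw [smul_coord] at h4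
    linarith [h3.2]

theorem mem_halfStar_edge_zero (i : α) : edge 1 i 0 ∈ halfStar (α := α) := by
  intro j
  rw [edge_zero_eq 1 i j]
  have : (edge (1 : FreeGroup α) j 0).1 = vertexCoord 1 := edgeCoord_zero 1 j
  rw [this, vertexCoord_one_one, vertexCoord_one_inv_of]
  norm_num

/-- The free group acts on its Cayley tree as a group of deck transformations: the
neighbourhoods are half stars of vertices and interiors of edges. -/
theorem exists_nhds_disjoint [Finite α] (p : Tree α) :
    ∃ U ∈ nhds p, ∀ g : FreeGroup α, ((g • ·) '' U ∩ U).Nonempty → g = 1 := by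
  obtain ⟨u, k, s, rfl⟩ := exists_edge p
  have hvert : ∀ u : FreeGroup α, ∀ k : α, ∃ U ∈ nhds (edge u k 0), ∀ g : FreeGroup α,
      ((g • ·) '' U ∩ U).Nonempty → g = 1 := by
    intro u k
    refine ⟨(u⁻¹ • ·) ⁻¹' halfStar,
      (isOpen_halfStar.preimage (continuous_const_smul u⁻¹)).mem_nhds ?_, ?_⟩
    · change u⁻¹ • edge u k 0 ∈ halfStar
      rw [smul_edge, inv_mul_cancel]
      exact mem_halfStar_edge_zero k
    · rintro g ⟨_, ⟨q, hq, rfl⟩, hgq⟩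
      have h2 : (u⁻¹ * g * u) • (u⁻¹ • q) ∈ halfStar := by
        rw [← mul_smul, mul_inv_cancel_right, mul_smul]
        exact hgq
      have h3 := eq_one_of_mem_halfStar hq h2
      have h4 : u⁻¹ * g = u⁻¹ := by rwa [mul_eq_one_iff_eq_inv] at h3
      simpa using h4
  by_cases h0 : s = 0
  · subst h0
    exact hvert u k
  by_cases h1 : s = 1
  · subst h1
    rw [edge_one_eq u k k]
    exact hvert _ k
  refine ⟨{q | 0 < q.1 (u, k) ∧ q.1 (u, k) < 1},
    ((isOpen_lt continuous_const (continuous_coord _)).inter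
      (isOpen_lt (continuous_coord _) continuous_const)).mem_nhds ?_, ?_⟩
  · change 0 < (edge u k s).1 (u, k) ∧ (edge u k s).1 (u, k) < 1
    rw [edge_coord_self]
    exact ⟨unitInterval.pos_iff_ne_zero.2 h0, unitInterval.lt_one_iff_ne_one.2 h1⟩
  · have key : ∀ (q : Tree α) (v : FreeGroup α) (j : α) (r : I) (e : FreeGroup α × α),
        q = edge v j r → 0 < q.1 e → q.1 e < 1 → e = (v, j) := by
      rintro q v j r e rfl h0 h1
      by_contra hne
      have : (edge v j r).1 e = vertexCoord v e := Function.update_of_ne hne _ _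
      rw [this] at h0 h1
      rcases vertexCoord_mem v e with h | h <;> linarith
    rintro g ⟨_, ⟨q, hq, rfl⟩, hgq⟩
    obtain ⟨v, j, r, hv⟩ := exists_edge q
    have e1 := key q v j r _ hv hq.1 hq.2
    have e2 := key q v j r (g⁻¹ * u, k) hv hgq.1 hgq.2
    have := congrArg Prod.fst (e2.trans e1.symm)
    simpa using this

/-- A function on the tree is continuous if it is continuous along each edge. Up to translation, it
suffices to consider points of the open star of `1`, which is covered by finitely many edges. -/
theorem continuous_of_edges [Finite α] {Z : Type*} [TopologicalSpace Z] {f : Tree α → Z}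
    (hf : ∀ u k, Continuous fun s => f (edge u k s)) : Continuous f := by
  have hedge : ∀ (g : Tree α → Z) (u : FreeGroup α) (k : α),
      (Continuous fun s => g (edge u k s)) → ContinuousOn g (Set.range (edge u k)) := by
    intro g u k hg
    have hinj : Function.Injective (edge u k) := fun s t h => by
      have := congrArg (fun p : Tree α => p.1 (u, k)) h
      simp only [edge_coord_self] at this
      exact Subtype.ext this
    have hemb : Topology.IsClosedEmbedding (edge u k) :=
      (continuous_edge u k).isClosedEmbedding hinj
    rw [← Set.image_univ]
    exact (hemb.isInducing.continuousOn_image_iff).2 hg.continuousOn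
  have hstar : ∀ g : Tree α → Z, (∀ u k, Continuous fun s => g (edge u k s)) →
      ∀ p ∈ openStar, ContinuousAt g p := by
    intro g hg p hp
    let C : α ⊕ α → Set (Tree α) := Sum.elim (fun i => Set.range (edge 1 i))
      (fun i => Set.range (edge (FreeGroup.of i)⁻¹ i))
    have hC : ContinuousOn g (⋃ a, C a) := by
      refine (locallyFinite_of_finite C).continuousOn_iUnion ?_ ?_
      · rintro (i | i)
        · exact (isCompact_range (continuous_edge _ _)).isClosed
        · exact (isCompact_range (continuous_edge _ _)).isClosed
      · rintro (i | i)
        · exact hedge g _ _ (hg _ _)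
        · exact hedge g _ _ (hg _ _)
    refine hC.continuousAt (Filter.mem_of_superset (isOpen_openStar.mem_nhds hp) ?_)
    intro q hq
    obtain ⟨i, s, h | h⟩ := eq_edge_of_mem_openStar hq
    · exact Set.mem_iUnion.2 ⟨Sum.inl i, s, h.symm⟩
    · exact Set.mem_iUnion.2 ⟨Sum.inr i, s, h.symm⟩
  rw [continuous_iff_continuousAt]
  intro p
  have hmem : ∃ u : FreeGroup α, u⁻¹ • p ∈ openStar := by
    have hsub : halfStar (α := α) ⊆ openStar := fun p hp i =>
      ⟨by linarith [(hp i).1], by linarith [(hp i).2]⟩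
    obtain ⟨u, k, s, rfl⟩ := exists_edge p
    by_cases h1 : s = 1
    · refine ⟨u * FreeGroup.of k, ?_⟩
      subst h1
      rw [edge_one_eq u k k, smul_edge, inv_mul_cancel]
      exact hsub (mem_halfStar_edge_zero k)
    · refine ⟨u, ?_⟩
      rw [smul_edge, inv_mul_cancel]
      intro i
      constructor
      · by_cases hik : i = k
        · subst hik
          rw [edge_coord_self]
          exact unitInterval.lt_one_iff_ne_one.2 h1
        · have : (edge 1 k s).1 (1, i) = vertexCoord 1 (1, i) :=
            Function.update_of_ne (fun h => hik (Prod.mk.inj h).2) _ _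
          rw [this, vertexCoord_one_one]
          norm_num
      · have hne : ((FreeGroup.of i)⁻¹, i) ≠ ((1 : FreeGroup α), k) := fun h => by
          have := (Prod.mk.inj h).1
          rw [inv_eq_one] at this
          exact FreeGroup.of_ne_one i this
        have : (edge 1 k s).1 ((FreeGroup.of i)⁻¹, i) = vertexCoord 1 ((FreeGroup.of i)⁻¹, i) :=
          Function.update_of_ne hne (s : ℝ) (vertexCoord 1)
        rw [this, vertexCoord_one_inv_of]
        norm_num
  obtain ⟨u, hu⟩ := hmem
  have h1 : ContinuousAt (fun q => f (u • q)) (u⁻¹ • p) :=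
    hstar (fun q => f (u • q)) (fun v k => by simpa only [smul_edge] using hf (u * v) k) _ hu
  have h2 : ContinuousAt (fun q : Tree α => u⁻¹ • q) p :=
    (continuous_const_smul u⁻¹).continuousAt
  have h3 := ContinuousAt.comp (f := fun q : Tree α => u⁻¹ • q) h1 h2
  simpa [Function.comp_def] using h3

variable (α) in
/-- The rose: the quotient of the tree by the free group, a wedge of circles. -/
abbrev Rose : Type := MulAction.orbitRel.Quotient (FreeGroup α) (Tree α)

/-- The projection from the tree to the rose. -/
def toRose : Tree α → Rose α := Quotient.mk (MulAction.orbitRel (FreeGroup α) (Tree α))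

theorem toRose_eq_iff {p q : Tree α} : toRose p = toRose q ↔ p ∈ MulAction.orbit (FreeGroup α) q :=
  Quotient.eq''

theorem isQuotientCoveringMap_toRose [Finite α] :
    IsQuotientCoveringMap (toRose (α := α)) (FreeGroup α) where
  toIsQuotientMap := isQuotientMap_quotient_mk'
  continuous_const_smul := continuous_const_smul
  apply_eq_iff_mem_orbit := toRose_eq_iff
  disjoint := exists_nhds_disjoint

end FreeTree

/-! ### The punctured strip and coordinates around its punctures -/

/-- The strip `0 < x < n + 1` without the points `(1, 0), …, (n, 0)`. -/
abbrev PuncturedStrip (n : ℕ) : Type :=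
  {p : ℝ × ℝ // 0 < p.1 ∧ p.1 < n + 1 ∧ ∀ k : Fin n, p ≠ ((k : ℝ) + 1, 0)}

namespace PuncturedStrip

open FreeTree

/-- The truncation of a real number to the unit interval. -/
noncomputable def cut (y : ℝ) : ℝ := max 0 (min 1 y)

theorem continuous_cut : Continuous cut := by
  unfold cut
  fun_prop

theorem cut_nonneg (y : ℝ) : 0 ≤ cut y := le_max_left _ _

theorem cut_le_one (y : ℝ) : cut y ≤ 1 := max_le zero_le_one (min_le_left _ _)

theorem cut_of_mem {y : ℝ} (h : y ∈ Set.Icc (0 : ℝ) 1) : cut y = y := by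
  rw [cut, min_eq_right h.2, max_eq_right h.1]

theorem cut_of_nonpos {y : ℝ} (h : y ≤ 0) : cut y = 0 := max_eq_left ((min_le_right _ _).trans h)

theorem cut_of_one_le {y : ℝ} (h : 1 ≤ y) : cut y = 1 := by
  rw [cut, min_eq_left h, max_eq_right zero_le_one]

theorem cut_pos {y : ℝ} (h : 0 < y) : 0 < cut y :=
  lt_max_of_lt_right (lt_min one_pos h)

theorem cut_mono : Monotone cut := fun _ _ h => max_le_max le_rfl (min_le_min le_rfl h)

/-- The horizontal coordinate of a point in the cone `|x| ≤ cut y / 4` over the origin, which is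
`0` on its left side and `1` on its right side. The value outside the cone is `0` on the left and
`1` on the right, except that it is `0` on the ray `x = 0`, `y ≤ 0`, where the denominator
vanishes. -/
noncomputable def coneCoord (x y : ℝ) : ℝ :=
  max 0 (cut y / 4 + x) / (max 0 (cut y / 4 + x) + max 0 (cut y / 4 - x))

theorem coneCoord_mem (x y : ℝ) : coneCoord x y ∈ Set.Icc (0 : ℝ) 1 := by
  have h1 : 0 ≤ max 0 (cut y / 4 + x) := le_max_left _ _
  have h2 : 0 ≤ max 0 (cut y / 4 - x) := le_max_left _ _
  exact ⟨div_nonneg h1 (add_nonneg h1 h2), div_le_one_of_le₀ (by linarith) (add_nonneg h1 h2)⟩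

theorem coneCoord_of_le {x y : ℝ} (h : x ≤ -(cut y / 4)) : coneCoord x y = 0 := by
  rw [coneCoord, max_eq_left (by linarith : cut y / 4 + x ≤ 0), zero_div]

theorem coneCoord_of_ge {x y : ℝ} (h : cut y / 4 ≤ x) (hx : 0 < x) : coneCoord x y = 1 := by
  have := cut_nonneg y
  rw [coneCoord, max_eq_left (by linarith : cut y / 4 - x ≤ 0), add_zero, div_self]
  rw [max_eq_right (by linarith)]
  linarith

theorem coneCoord_of_nonpos {x y : ℝ} (hy : y ≤ 0) : coneCoord x y = 0 ∨ coneCoord x y = 1 := by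
  rcases le_or_gt x 0 with h | h
  · exact Or.inl (coneCoord_of_le (by rw [cut_of_nonpos hy]; linarith))
  · exact Or.inr (coneCoord_of_ge (by rw [cut_of_nonpos hy]; linarith) h)

/-- `coneCoord` is a proper coordinate only inside the cone. -/
theorem mem_cone_of_coneCoord {x y : ℝ} (h0 : coneCoord x y ≠ 0) (h1 : coneCoord x y ≠ 1) :
    0 < y ∧ |x| < cut y / 4 := by
  have hy : 0 < y := by
    by_contra hc
    rcases coneCoord_of_nonpos (x := x) (not_lt.1 hc) with h | h
    · exact h0 h
    · exact h1 h
  refine ⟨hy, abs_lt.2 ⟨?_, ?_⟩⟩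
  · by_contra hc
    exact h0 (coneCoord_of_le (by linarith))
  · by_contra hc
    have := cut_pos hy
    exact h1 (coneCoord_of_ge (not_lt.1 hc) (by linarith))

theorem coneCoord_eq {x y : ℝ} (h : |x| < cut y / 4) :
    coneCoord x y = (cut y / 4 + x) / (cut y / 2) := by
  rw [abs_lt] at h
  rw [coneCoord, max_eq_right (by linarith), max_eq_right (by linarith)]
  congr 1
  ring

theorem continuousOn_coneCoord :
    ContinuousOn (fun p : ℝ × ℝ => coneCoord p.1 p.2) {p | 0 < p.2 ∨ p.1 ≠ 0} := by
  have hc := continuous_cut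
  refine ContinuousOn.div (by fun_prop) (by fun_prop) ?_
  rintro ⟨x, y⟩ h
  have h3 := cut_nonneg y
  have h1 := le_max_right 0 (cut y / 4 + x)
  have h2 := le_max_right 0 (cut y / 4 - x)
  have h4 : 0 ≤ max 0 (cut y / 4 + x) := le_max_left _ _
  have h5 : 0 ≤ max 0 (cut y / 4 - x) := le_max_left _ _
  change max 0 (cut y / 4 + x) + max 0 (cut y / 4 - x) ≠ 0
  intro h0
  rcases h with h | h
  · have := cut_pos h
    linarith
  · rcases lt_or_gt_of_ne h with h | h
    · change x < 0 at h
      linarith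
    · change 0 < x at h
      linarith

variable {n : ℕ}

/-- The coordinate of a point in the cone over the `k`-th puncture. -/
noncomputable def param (k : Fin n) (p : ℝ × ℝ) : ℝ := coneCoord (p.1 - (k + 1)) p.2

theorem param_mem (k : Fin n) (p : ℝ × ℝ) : param k p ∈ Set.Icc (0 : ℝ) 1 := coneCoord_mem _ _

theorem mem_cone_of_param {k : Fin n} {p : ℝ × ℝ} (h0 : param k p ≠ 0) (h1 : param k p ≠ 1) :
    0 < p.2 ∧ |p.1 - (k + 1)| < 1 / 4 := by
  obtain ⟨h2, h3⟩ := mem_cone_of_coneCoord h0 h1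
  exact ⟨h2, by linarith [cut_le_one p.2]⟩

theorem eq_of_abs_sub_lt {j k : Fin n} {x : ℝ} (hj : |x - (j + 1)| < 1 / 4)
    (hk : |x - (k + 1)| < 3 / 4) : j = k := by
  rw [abs_lt] at hj hk
  have h1 : (j : ℝ) < k + 1 := by linarith
  have h2 : (k : ℝ) < j + 1 := by linarith
  have h3 : (j : ℕ) < k + 1 := by exact_mod_cast h1
  have h4 : (k : ℕ) < j + 1 := by exact_mod_cast h2
  exact Fin.ext (by omega)

/-- A function of the cone coordinate with equal values at `0` and `1` is continuous on the
punctured strip, even across the ray below the puncture, where the cone coordinate jumps. -/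
theorem continuous_comp_param {A Z : Type*} [TopologicalSpace A] [TopologicalSpace Z]
    (k : Fin n) {D : A × I → Z} (hD : Continuous D) (h01 : ∀ a, D (a, 0) = D (a, 1)) :
    Continuous fun q : A × PuncturedStrip n => D (q.1, ⟨param k q.2.1, param_mem k q.2.1⟩) := by
  rw [← continuousOn_univ]
  have hcov : (Set.univ : Set (A × PuncturedStrip n)) =
      {q | q.2.1.2 ≤ 0} ∪ {q | 0 ≤ q.2.1.2} := by
    ext q
    simpa using le_total _ _
  rw [hcov]
  refine ContinuousOn.union_of_isClosed ?_ ?_ (isClosed_le (by fun_prop) continuous_const)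
    (isClosed_le continuous_const (by fun_prop))
  · refine ContinuousOn.congr (f := fun q => D (q.1, 0)) (by fun_prop) ?_
    rintro ⟨a, p⟩ hp
    rcases coneCoord_of_nonpos (x := p.1.1 - (k + 1)) (y := p.1.2) hp with h | h
    · exact congrArg (fun s => D (a, s)) (Subtype.ext h)
    · exact (congrArg (fun s => D (a, s)) (Subtype.ext h)).trans (h01 a).symm
  · refine hD.comp_continuousOn (continuous_fst.continuousOn.prodMk ?_)
    rw [Topology.IsInducing.subtypeVal.continuousOn_iff]
    refine continuousOn_coneCoord.comp (f := fun q : A × PuncturedStrip n =>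
      (q.2.1.1 - (k + 1), q.2.1.2)) (by fun_prop) ?_
    rintro ⟨a, p⟩ hp
    change 0 < p.1.2 ∨ p.1.1 - (k + 1) ≠ 0
    by_contra hc
    rw [not_or, not_not, not_lt, sub_eq_zero] at hc
    exact p.2.2.2 k (Prod.ext hc.2 (le_antisymm hc.1 hp))

/-! ### The map from the punctured strip to the rose -/

open Classical in
/-- The map to the rose which sends the cone over the `k`-th puncture around the `k`-th petal, and
the rest of the punctured strip to the vertex. -/
noncomputable def toRose (v : Rose (Fin n)) (p : PuncturedStrip n) : Rose (Fin n) :=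
  if h : ∃ k, param k p.1 ≠ 0 ∧ param k p.1 ≠ 1 then
    FreeTree.toRose (edge 1 h.choose ⟨param h.choose p.1, param_mem _ _⟩)
  else v

theorem toRose_edge_one (k : Fin n) :
    FreeTree.toRose (edge 1 k 1) = FreeTree.toRose (edge 1 k 0) := by
  rw [toRose_eq_iff]
  exact ⟨FreeGroup.of k, by
    change FreeGroup.of k • edge 1 k 0 = _
    rw [smul_edge, edge_one_eq 1 k k, mul_one, one_mul]⟩

/-- Near the `k`-th puncture, the map to the rose is the cone coordinate followed by the `k`-th
petal, also outside the cone. -/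
theorem toRose_of_abs_lt {v : Rose (Fin n)} (hv : ∀ k, FreeTree.toRose (edge 1 k 0) = v) {k : Fin n}
    {p : PuncturedStrip n} (hk : |p.1.1 - (k + 1)| < 3 / 4) :
    toRose v p = FreeTree.toRose (edge 1 k ⟨param k p.1, param_mem _ _⟩) := by
  unfold toRose
  split_ifs with h
  · have h1 := h.choose_spec
    have h2 := eq_of_abs_sub_lt (mem_cone_of_param h1.1 h1.2).2 hk
    have h3 : ∀ j, j = k → FreeTree.toRose (edge 1 j ⟨param j p.1, param_mem _ _⟩) =
        FreeTree.toRose (edge 1 k ⟨param k p.1, param_mem _ _⟩) := by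
      rintro j rfl
      rfl
    exact h3 _ h2
  · push Not at h
    by_cases h0 : param k p.1 = 0
    · rw [← hv k]
      congr 2
      exact Subtype.ext h0.symm
    · rw [← hv k, ← toRose_edge_one]
      congr 2
      exact Subtype.ext (h k h0).symm

theorem toRose_of_forall_not {v : Rose (Fin n)} {p : PuncturedStrip n}
    (h : ∀ k : Fin n, param k p.1 = 0 ∨ param k p.1 = 1) : toRose v p = v := by
  refine dif_neg ?_
  rintro ⟨k, h0, h1⟩
  rcases h k with h | h
  · exact h0 h
  · exact h1 h

theorem continuous_toRose_edge_param (k : Fin n) : Continuous fun q : PuncturedStrip n =>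
    FreeTree.toRose (edge 1 k ⟨param k q.1, param_mem _ _⟩) := by
  have h1 : Continuous fun s : Unit × I => FreeTree.toRose (edge (1 : FreeGroup (Fin n)) k s.2) :=
    (isQuotientCoveringMap_toRose.continuous.comp (continuous_edge 1 k)).comp continuous_snd
  have h2 := continuous_comp_param k h1 fun _ => (toRose_edge_one k).symm
  have h3 : Continuous fun q : PuncturedStrip n => ((), q) := by fun_prop
  exact h2.comp h3

theorem continuous_toRose {v : Rose (Fin n)} (hv : ∀ k, FreeTree.toRose (edge 1 k 0) = v) :
    Continuous (toRose v) := by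
  rw [continuous_iff_continuousAt]
  intro p
  by_cases hp : ∃ k : Fin n, |p.1.1 - (k + 1)| < 3 / 4
  · obtain ⟨k, hk⟩ := hp
    refine (continuous_toRose_edge_param k).continuousAt.congr ?_
    have hopen : IsOpen {q : PuncturedStrip n | |q.1.1 - (k + 1)| < 3 / 4} :=
      isOpen_lt (by fun_prop) continuous_const
    filter_upwards [hopen.mem_nhds hk] with q hq
    exact (toRose_of_abs_lt hv hq).symm
  · push Not at hp
    refine (continuousAt_const (y := v)).congr ?_
    have hopen : IsOpen {q : PuncturedStrip n | ∀ k : Fin n, 1 / 4 < |q.1.1 - (k + 1)|} := by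
      have : {q : PuncturedStrip n | ∀ k : Fin n, 1 / 4 < |q.1.1 - (k + 1)|} =
          ⋂ k : Fin n, {q : PuncturedStrip n | 1 / 4 < |q.1.1 - (k + 1)|} := by
        ext q
        simp
      rw [this]
      exact isOpen_iInter_of_finite fun k => isOpen_lt continuous_const (by fun_prop)
    filter_upwards [hopen.mem_nhds (fun k => by linarith [hp k])] with q hq
    refine (toRose_of_forall_not fun k => ?_).symm
    by_contra hc
    rw [not_or] at hc
    have := (mem_cone_of_param hc.1 hc.2).2
    linarith [hq k]

/-! ### Loops around the punctures -/

/-- A rectangular loop around the `k`-th puncture. For `0 ≤ r ≤ 5` it starts and ends at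
`(k + 1, -1)`; the initial and final pieces `-1 ≤ r ≤ 0` and `5 ≤ r ≤ 6` join this point to
`(1 / 2, -1)`. -/
noncomputable def loop (k : Fin n) (r : ℝ) : ℝ × ℝ :=
  (1 / 2 + (k + 1 / 2) * cut (r + 1) - cut r / 4 + cut (r - 2) / 2 - cut (r - 4) / 4 -
    (k + 1 / 2) * cut (r - 5), -1 + 2 * cut (r - 1) - 2 * cut (r - 3))

theorem continuous_loop (k : Fin n) : Continuous (loop k) := by
  have := continuous_cut
  unfold loop
  fun_prop

theorem loop_of_le_zero (k : Fin n) {r : ℝ} (h : r ≤ 0) :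
    loop k r = (1 / 2 + (k + 1 / 2) * cut (r + 1), -1) := by
  rw [loop, cut_of_nonpos h, cut_of_nonpos (by linarith : r - 1 ≤ 0),
    cut_of_nonpos (by linarith : r - 2 ≤ 0), cut_of_nonpos (by linarith : r - 3 ≤ 0),
    cut_of_nonpos (by linarith : r - 4 ≤ 0), cut_of_nonpos (by linarith : r - 5 ≤ 0)]
  norm_num

theorem loop_of_five_le (k : Fin n) {r : ℝ} (h : 5 ≤ r) :
    loop k r = (1 / 2 + (k + 1 / 2) * (1 - cut (r - 5)), -1) := by
  rw [loop, cut_of_one_le (by linarith : 1 ≤ r), cut_of_one_le (by linarith : 1 ≤ r - 1),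
    cut_of_one_le (by linarith : 1 ≤ r - 2), cut_of_one_le (by linarith : 1 ≤ r - 3),
    cut_of_one_le (by linarith : 1 ≤ r - 4), cut_of_one_le (by linarith : 1 ≤ r + 1)]
  refine Prod.ext ?_ ?_ <;> ring_nf

theorem loop_of_mem (k : Fin n) {r : ℝ} (h0 : 0 ≤ r) (h5 : r ≤ 5) :
    loop k r = (k + 1 - cut r / 4 + cut (r - 2) / 2 - cut (r - 4) / 4,
      -1 + 2 * cut (r - 1) - 2 * cut (r - 3)) := by
  rw [loop, cut_of_one_le (by linarith : 1 ≤ r + 1), cut_of_nonpos (by linarith : r - 5 ≤ 0)]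
  refine Prod.ext ?_ ?_ <;> ring_nf

theorem abs_loop_sub_le (k : Fin n) {r : ℝ} (h0 : 0 ≤ r) (h5 : r ≤ 5) :
    |(loop k r).1 - (k + 1)| ≤ 1 / 4 := by
  rw [loop_of_mem k h0 h5, abs_le]
  have h1 := cut_le_one r
  have h2 : cut (r - 2) ≤ cut r := cut_mono (by linarith)
  have h3 : cut (r - 4) ≤ cut (r - 2) := cut_mono (by linarith)
  have h4 := cut_nonneg (r - 4)
  constructor <;> dsimp only <;> linarith

theorem loop_of_snd_eq_zero (k : Fin n) {r : ℝ} (h : (loop k r).2 = 0) :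
    0 ≤ r ∧ r ≤ 5 ∧ ((loop k r).1 = k + 1 - 1 / 4 ∨ (loop k r).1 = k + 1 + 1 / 4) := by
  have h0 : 0 < r := by
    by_contra hc
    rw [loop_of_le_zero k (not_lt.1 hc)] at h
    norm_num at h
  have h5 : r < 5 := by
    by_contra hc
    rw [loop_of_five_le k (not_lt.1 hc)] at h
    norm_num at h
  refine ⟨h0.le, h5.le, ?_⟩
  rw [loop_of_mem k h0.le h5.le] at h ⊢
  dsimp only at h ⊢
  have h1 : 1 ≤ r := by
    by_contra hc
    rw [cut_of_nonpos (by linarith : r - 1 ≤ 0), cut_of_nonpos (by linarith : r - 3 ≤ 0)] at h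
    norm_num at h
  have h4 : r ≤ 4 := by
    by_contra hc
    rw [cut_of_one_le (by linarith : 1 ≤ r - 1), cut_of_one_le (by linarith : 1 ≤ r - 3)] at h
    norm_num at h
  rw [cut_of_one_le h1, cut_of_nonpos (by linarith : r - 4 ≤ 0)]
  rcases le_or_gt r 2 with h2 | h2
  · rw [cut_of_nonpos (by linarith : r - 2 ≤ 0)]
    left
    ring
  · have h3 : 3 ≤ r := by
      by_contra hc
      rw [cut_of_one_le (by linarith : 1 ≤ r - 1), cut_of_nonpos (by linarith : r - 3 ≤ 0)] at h
      norm_num at h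
    rw [cut_of_one_le (by linarith : 1 ≤ r - 2)]
    right
    ring

theorem cast_add_one_le (k : Fin n) : (k : ℝ) + 1 ≤ n := by exact_mod_cast k.2

/-- The loops avoid the punctures. -/
theorem loop_mem (k : Fin n) (r : ℝ) :
    0 < (loop k r).1 ∧ (loop k r).1 < n + 1 ∧ ∀ j : Fin n, loop k r ≠ ((j : ℝ) + 1, 0) := by
  have hk0 : (0 : ℝ) ≤ k := Nat.cast_nonneg _
  have hk := cast_add_one_le k
  refine ⟨?_, ?_, fun j hj => ?_⟩
  · rcases le_total r 0 with h | h
    · rw [loop_of_le_zero k h]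
      have := cut_nonneg (r + 1)
      positivity
    rcases le_total r 5 with h5 | h5
    · have := (abs_le.1 (abs_loop_sub_le k h h5)).1
      linarith
    · rw [loop_of_five_le k h5]
      have : 0 ≤ 1 - cut (r - 5) := by linarith [cut_le_one (r - 5)]
      positivity
  · rcases le_total r 0 with h | h
    · rw [loop_of_le_zero k h]
      dsimp only
      nlinarith [cut_le_one (r + 1)]
    rcases le_total r 5 with h5 | h5
    · have := (abs_le.1 (abs_loop_sub_le k h h5)).2
      linarith
    · rw [loop_of_five_le k h5]
      dsimp only
      nlinarith [cut_nonneg (r - 5)]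
  · obtain ⟨h0, h5, h⟩ := loop_of_snd_eq_zero k (congrArg Prod.snd hj)
    have h1 := congrArg Prod.fst hj
    dsimp only at h1
    have h2 : j = k := eq_of_abs_sub_lt (x := (loop k r).1) (by rw [h1]; norm_num)
      ((abs_loop_sub_le k h0 h5).trans_lt (by norm_num))
    rw [h1, h2] at h
    rcases h with h | h <;> linarith

/-- Above the line `y = 0`, the loop runs through the cone over the puncture for `2 ≤ r ≤ 3`, where
it is parametrized by the cone coordinate, and it is outside of the cone otherwise. -/
theorem param_loop (k : Fin n) {r : ℝ} (h0 : 0 < (loop k r).2) :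
    param k (loop k r) = cut (r - 2) := by
  have h1 : 1 ≤ r := by
    by_contra hc
    rcases le_total r 0 with h | h
    · rw [loop_of_le_zero k h] at h0
      norm_num at h0
    · rw [loop_of_mem k h (by linarith), cut_of_nonpos (by linarith : r - 1 ≤ 0),
        cut_of_nonpos (by linarith : r - 3 ≤ 0)] at h0
      norm_num at h0
  have h4 : r ≤ 4 := by
    by_contra hc
    rcases le_total 5 r with h | h
    · rw [loop_of_five_le k h] at h0
      norm_num at h0
    · rw [loop_of_mem k (by linarith) h, cut_of_one_le (by linarith : 1 ≤ r - 1),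
        cut_of_one_le (by linarith : 1 ≤ r - 3)] at h0
      norm_num at h0
  rw [loop_of_mem k (by linarith) (by linarith), param, cut_of_one_le h1,
    cut_of_nonpos (by linarith : r - 4 ≤ 0)]
  dsimp only
  rcases le_or_gt r 2 with h2 | h2
  · rw [cut_of_nonpos (by linarith : r - 2 ≤ 0)]
    exact coneCoord_of_le (by linarith [cut_le_one (-1 + 2 * cut (r - 1) - 2 * cut (r - 3))])
  rcases lt_or_ge r 3 with h3 | h3
  · rw [cut_of_one_le (by linarith : 1 ≤ r - 1), cut_of_nonpos (by linarith : r - 3 ≤ 0),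
      cut_of_mem (y := r - 2) ⟨by linarith, by linarith⟩, coneCoord_eq]
    · rw [cut_of_one_le (by norm_num)]
      ring
    · rw [cut_of_one_le (by norm_num), abs_lt]
      constructor <;> linarith
  · rw [cut_of_one_le (by linarith : 1 ≤ r - 2)]
    exact coneCoord_of_ge (by linarith [cut_le_one (-1 + 2 * cut (r - 1) - 2 * cut (r - 3))])
      (by linarith)

/-! ### The deformation of the punctured strip -/

/-- A monotone function with the constant value `k + 1` near `k + 1`, for `k < n`. It maps all
of the `k`-th cone to the origin of the `k`-th loop. -/
noncomputable def flat (n : ℕ) (x : ℝ) : ℝ :=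
  max (1 / 2) (min (n + 1 / 2) (∑ j ∈ Finset.range (n + 1), cut (2 * (x - j) - 1 / 2)))

theorem continuous_flat (n : ℕ) : Continuous (flat n) := by
  have := continuous_cut
  unfold flat
  fun_prop

theorem flat_mono (n : ℕ) : Monotone (flat n) := fun x y h =>
  max_le_max le_rfl (min_le_min le_rfl (Finset.sum_le_sum fun j _ => cut_mono (by linarith)))

theorem flat_mem (n : ℕ) (x : ℝ) : flat n x ∈ Set.Icc (1 / 2 : ℝ) (n + 1 / 2) :=
  ⟨le_max_left _ _, max_le (by linarith [(Nat.cast_nonneg n : (0 : ℝ) ≤ n)]) (min_le_left _ _)⟩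

theorem flat_of_abs_le {k : Fin n} {x : ℝ} (h : |x - (k + 1)| ≤ 1 / 4) : flat n x = k + 1 := by
  rw [abs_le] at h
  have hk := k.2
  have h1 : ∑ j ∈ Finset.range (n + 1), cut (2 * (x - j) - 1 / 2) = k + 1 := by
    have h4 : ∑ j ∈ Finset.range (k + 1), cut (2 * (x - j) - 1 / 2) = k + 1 := by
      rw [Finset.sum_congr rfl (g := fun _ => (1 : ℝ))]
      · simp
      · intro j hj
        have : (j : ℝ) ≤ (k : ℕ) := by exact_mod_cast Nat.lt_succ_iff.1 (Finset.mem_range.1 hj)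
        exact cut_of_one_le (by linarith)
    rw [← Finset.sum_range_add_sum_Ico _ (by omega : (k : ℕ) + 1 ≤ n + 1), h4,
      Finset.sum_eq_zero, add_zero]
    intro j hj
    have : ((k : ℕ) : ℝ) + 1 ≤ j := by exact_mod_cast (Finset.mem_Ico.1 hj).1
    exact cut_of_nonpos (by linarith)
  have h2 := cast_add_one_le k
  have h3 : (0 : ℝ) ≤ k := Nat.cast_nonneg _
  rw [flat, h1, min_eq_right (by linarith), max_eq_right (by linarith)]

/-- The displacement of the point `((1 - t) (k + 1) + t / 2, -1)` along the `k`-th loop. The loop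
which starts and ends at this point is parametrized by `-t ≤ r ≤ 5 + t`. -/
noncomputable def displacement (k : Fin n) (q : I × I) : ℝ × ℝ :=
  loop k ((5 + 2 * q.1) * q.2 - q.1) - ((1 - q.1) * ((k : ℝ) + 1) + q.1 / 2, -1)

theorem continuous_displacement (k : Fin n) : Continuous (displacement k) := by
  have := continuous_loop k
  unfold displacement
  fun_prop

theorem displacement_zero (k : Fin n) (t : I) : displacement k (t, 0) = 0 := by
  have ht := t.2
  rw [displacement, loop_of_le_zero k (by simpa using ht.1), cut_of_mem]
  · refine Prod.ext ?_ ?_ <;> simp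
    ring
  · constructor <;> simp <;> linarith [ht.1, ht.2]

theorem displacement_one (k : Fin n) (t : I) : displacement k (t, 1) = 0 := by
  have ht := t.2
  have h1 : (5 + 2 * (t : ℝ)) * (1 : I) - t = 5 + t := by simp; ring
  rw [displacement]
  dsimp only
  rw [h1, loop_of_five_le k (by linarith [ht.1]), add_sub_cancel_left, cut_of_mem ht]
  refine Prod.ext ?_ ?_ <;> simp
  ring

/-- The deformation which pushes the complement of the cones to the line `y = -1`, the cones to the
loops, and then the line to the point `(1 / 2, -1)`. -/
noncomputable def deform (q : I × PuncturedStrip n) : ℝ × ℝ :=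
  ((1 - q.1) * flat n q.2.1.1 + q.1 / 2, -1) +
    ∑ k : Fin n, displacement k (q.1, ⟨param k q.2.1, param_mem _ _⟩)

theorem continuous_deform : Continuous (deform (n := n)) := by
  refine Continuous.add ?_ (continuous_finsetSum _ fun k _ => ?_)
  · have := continuous_flat n
    fun_prop
  · exact continuous_comp_param k (continuous_displacement k) fun t => by
      rw [displacement_zero, displacement_one]

theorem displacement_param_eq_zero {k : Fin n} {p : ℝ × ℝ} (h : param k p = 0 ∨ param k p = 1)
    (t : I) : displacement k (t, ⟨param k p, param_mem _ _⟩) = 0 := by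
  rcases h with h | h
  · rw [← displacement_zero k t]
    congr 2
    exact Subtype.ext h
  · rw [← displacement_one k t]
    congr 2
    exact Subtype.ext h

theorem deform_of_forall {p : PuncturedStrip n}
    (h : ∀ k : Fin n, param k p.1 = 0 ∨ param k p.1 = 1) (t : I) :
    deform (t, p) = ((1 - t) * flat n p.1.1 + t / 2, -1) := by
  rw [deform, Finset.sum_eq_zero fun k _ => displacement_param_eq_zero (h k) t, add_zero]

theorem deform_of_param {p : PuncturedStrip n} {k : Fin n}
    (h0 : param k p.1 ≠ 0) (h1 : param k p.1 ≠ 1) (t : I) :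
    deform (t, p) = loop k ((5 + 2 * t) * param k p.1 - t) := by
  have h := (mem_cone_of_param h0 h1).2
  rw [deform, Finset.sum_eq_single k]
  · rw [displacement, flat_of_abs_le h.le, add_sub_cancel]
  · intro j _ hj
    refine displacement_param_eq_zero ?_ t
    by_contra hc
    rw [not_or] at hc
    exact hj (eq_of_abs_sub_lt (mem_cone_of_param hc.1 hc.2).2 (by linarith))
  · simp

theorem forall_or_exists_param (p : ℝ × ℝ) :
    (∀ k : Fin n, param k p = 0 ∨ param k p = 1) ∨
      ∃ k : Fin n, param k p ≠ 0 ∧ param k p ≠ 1 := by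
  by_contra! h
  obtain ⟨⟨k, h1⟩, h2⟩ := h
  exact h1.2 (h2 k h1.1)

theorem deform_mem (q : I × PuncturedStrip n) : 0 < (deform q).1 ∧ (deform q).1 < n + 1 ∧
    ∀ k : Fin n, deform q ≠ ((k : ℝ) + 1, 0) := by
  obtain ⟨t, p⟩ := q
  rcases forall_or_exists_param (n := n) p.1 with h | ⟨k, h0, h1⟩
  · rw [deform_of_forall h]
    have ht := t.2
    have hf := flat_mem n p.1.1
    have hn : (0 : ℝ) ≤ n := Nat.cast_nonneg n
    refine ⟨?_, ?_, fun k hk => ?_⟩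
    · dsimp only
      nlinarith [ht.1, ht.2, hf.1]
    · dsimp only
      nlinarith [ht.1, ht.2, hf.2]
    · have := congrArg Prod.snd hk
      norm_num at this
  · rw [deform_of_param h0 h1]
    exact loop_mem k _

end PuncturedStrip

namespace PuncturedStrip

open FreeTree

variable {n : ℕ}

theorem loop_fst_le (k : Fin n) {r : ℝ} (h0 : 0 ≤ r) (h : r ≤ 5 / 2) : (loop k r).1 ≤ k + 1 := by
  rw [loop_of_mem k h0 (by linarith), cut_of_nonpos (by linarith : r - 4 ≤ 0)]
  dsimp only
  rcases le_total r 1 with h1 | h1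
  · rw [cut_of_nonpos (by linarith : r - 2 ≤ 0)]
    linarith [cut_nonneg r]
  · have h2 : cut (r - 2) ≤ cut (1 / 2) := cut_mono (by linarith)
    rw [cut_of_mem (y := 1 / 2) (by norm_num)] at h2
    rw [cut_of_one_le h1]
    linarith

theorem le_loop_fst (k : Fin n) {r : ℝ} (h : 5 / 2 ≤ r) (h5 : r ≤ 5) : k + 1 ≤ (loop k r).1 := by
  rw [loop_of_mem k (by linarith) h5, cut_of_one_le (by linarith : 1 ≤ r)]
  dsimp only
  rcases le_total r 4 with h1 | h1
  · rw [cut_of_nonpos (by linarith : r - 4 ≤ 0)]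
    have h2 : cut (1 / 2) ≤ cut (r - 2) := cut_mono (by linarith)
    rw [cut_of_mem (y := 1 / 2) (by norm_num)] at h2
    linarith
  · rw [cut_of_one_le (by linarith : 1 ≤ r - 2)]
    linarith [cut_le_one (r - 4)]

theorem param_eq_half {k : Fin n} {p : ℝ × ℝ} (h : p.1 = k + 1) (h0 : 0 < p.2) :
    param k p = 1 / 2 := by
  have := cut_pos h0
  rw [param, h, sub_self, coneCoord_eq (by rw [abs_zero]; positivity)]
  field_simp
  norm_num

/-- The first stage of the deformation does not move a point across a puncture. -/
theorem deform_zero_side (p : PuncturedStrip n) (j : Fin n) :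
    (p.1.1 < j + 1 ∧ (deform (0, p)).1 ≤ j + 1) ∨
      ((j : ℝ) + 1 < p.1.1 ∧ j + 1 ≤ (deform (0, p)).1) ∨
      (0 < p.1.2 ∧ 0 < (deform (0, p)).2) ∨ (p.1.2 < 0 ∧ (deform (0, p)).2 < 0) := by
  have hflat : flat n (j + 1) = j + 1 := flat_of_abs_le (by norm_num)
  rcases forall_or_exists_param (n := n) p.1 with h | ⟨k, h0, h1⟩
  · rw [deform_of_forall h]
    simp only [Set.Icc.coe_zero, sub_zero, one_mul, zero_div, add_zero]
    rcases lt_trichotomy p.1.1 (j + 1) with hx | hx | hx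
    · exact Or.inl ⟨hx, hflat ▸ flat_mono n hx.le⟩
    · refine Or.inr (Or.inr (Or.inr ⟨?_, by norm_num⟩))
      by_contra hc
      rcases (not_lt.1 hc).eq_or_lt with hy | hy
      · exact p.2.2.2 j (Prod.ext hx hy.symm)
      · have := h j
        rw [param_eq_half hx hy] at this
        norm_num at this
    · exact Or.inr (Or.inl ⟨hx, by simpa only [hflat] using flat_mono n hx.le⟩)
  · rw [deform_of_param h0 h1]
    simp only [Set.Icc.coe_zero, mul_zero, add_zero, sub_zero]
    obtain ⟨hs0, hs1⟩ := param_mem k p.1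
    obtain ⟨hy, hx⟩ := mem_cone_of_param h0 h1
    have hloop := abs_loop_sub_le k (r := 5 * param k p.1) (by linarith) (by linarith)
    by_cases hjk : j = k
    · subst hjk
      have hcone := (mem_cone_of_coneCoord h0 h1).2
      have hs : param j p.1 = (cut p.1.2 / 4 + (p.1.1 - (j + 1))) / (cut p.1.2 / 2) :=
        coneCoord_eq hcone
      have hcut := cut_pos hy
      rw [eq_div_iff (by positivity)] at hs
      rcases lt_trichotomy p.1.1 (j + 1) with hx | hx | hx
      · refine Or.inl ⟨hx, loop_fst_le j (by linarith) ?_⟩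
        by_contra hc
        nlinarith
      · refine Or.inr (Or.inr (Or.inl ⟨hy, ?_⟩))
        rw [param_eq_half hx hy, loop_of_mem j (by norm_num) (by norm_num),
          cut_of_one_le (by norm_num : (1 : ℝ) ≤ 5 * (1 / 2) - 1),
          cut_of_nonpos (by norm_num : 5 * (1 / 2) - (3 : ℝ) ≤ 0)]
        norm_num
      · refine Or.inr (Or.inl ⟨hx, le_loop_fst j ?_ (by linarith)⟩)
        by_contra hc
        nlinarith
    · rw [abs_lt] at hx
      rw [abs_le] at hloop
      rcases lt_or_gt_of_ne hjk with hlt | hlt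
      · have h3 : (j : ℝ) + 1 ≤ k := by exact_mod_cast hlt
        exact Or.inr (Or.inl ⟨by linarith, by linarith⟩)
      · have h3 : (k : ℝ) + 1 ≤ j := by exact_mod_cast hlt
        exact Or.inl ⟨by linarith, by linarith⟩

/-- The straight line from a point to its image under the first stage of the deformation avoids the
punctures. -/
theorem segment_mem (t : I) (p : PuncturedStrip n) :
    0 < ((1 - (t : ℝ)) • p.1 + (t : ℝ) • deform (0, p)).1 ∧
    ((1 - (t : ℝ)) • p.1 + (t : ℝ) • deform (0, p)).1 < n + 1 ∧
    ∀ k : Fin n, (1 - (t : ℝ)) • p.1 + (t : ℝ) • deform (0, p) ≠ ((k : ℝ) + 1, 0) := by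
  obtain ⟨ha0, ha1, ha2⟩ := p.2
  obtain ⟨hb0, hb1, hb2⟩ := deform_mem (0, p)
  rcases eq_or_lt_of_le t.2.2 with ht | ht
  · rw [ht, sub_self, zero_smul, one_smul, zero_add]
    exact ⟨hb0, hb1, hb2⟩
  have ht0 := t.2.1
  simp only [Prod.fst_add, Prod.smul_fst, smul_eq_mul]
  refine ⟨by nlinarith, by nlinarith, fun j hj => ?_⟩
  have hx := congrArg Prod.fst hj
  have hy := congrArg Prod.snd hj
  simp only [Prod.fst_add, Prod.smul_fst, Prod.snd_add, Prod.smul_snd, smul_eq_mul] at hx hy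
  rcases deform_zero_side p j with ⟨h1, h2⟩ | ⟨h1, h2⟩ | ⟨h1, h2⟩ | ⟨h1, h2⟩ <;> nlinarith

/-! ### The punctured strip is homotopy equivalent to the rose -/

/-- The point `(1 / 2, -1)` of the punctured strip. -/
noncomputable def basePoint (n : ℕ) : PuncturedStrip n :=
  ⟨(1 / 2, -1), by norm_num, by
    have : (0 : ℝ) ≤ n := Nat.cast_nonneg n
    dsimp only
    linarith, fun k hk => by
    have := congrArg Prod.snd hk
    norm_num at this⟩

theorem edge_coord_of_ne {u : FreeGroup (Fin n)} {k : Fin n} {s : I}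
    {e : FreeGroup (Fin n) × Fin n} (h : e ≠ (u, k)) :
    (edge u k s).1 e = 0 ∨ (edge u k s).1 e = 1 := by
  simp only [edge, edgeCoord, Function.update_of_ne h]
  exact vertexCoord_mem _ _

open Classical in
/-- The map from the tree to the punctured strip which takes each edge labelled `k` around the
`k`-th loop. -/
noncomputable def ofTree (p : FreeTree.Tree (Fin n)) : PuncturedStrip n :=
  if h : ∃ e, p.1 e ≠ 0 ∧ p.1 e ≠ 1 then
    ⟨loop h.choose.2 (7 * p.1 h.choose - 1), loop_mem _ _⟩
  else basePoint n

theorem ofTree_edge (u : FreeGroup (Fin n)) (k : Fin n) (s : I) :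
    ofTree (edge u k s) = ⟨loop k (7 * s - 1), loop_mem _ _⟩ := by
  unfold ofTree
  split_ifs with h
  · have h1 := h.choose_spec
    have h2 : h.choose = (u, k) := by
      by_contra hc
      rcases edge_coord_of_ne (s := s) hc with h | h
      · exact h1.1 h
      · exact h1.2 h
    have h3 : ∀ e, e = (u, k) → (⟨loop e.2 (7 * (edge u k s).1 e - 1), loop_mem _ _⟩ :
        PuncturedStrip n) = ⟨loop k (7 * s - 1), loop_mem _ _⟩ := by
      rintro e rfl
      simp only [edge_coord_self]
    exact h3 _ h2
  · push Not at h
    have h1 := h (u, k)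
    rw [edge_coord_self] at h1
    refine Subtype.ext ?_
    change (1 / 2, -1) = loop k (7 * s - 1)
    by_cases hs : (s : ℝ) = 0
    · rw [loop_of_le_zero k (by linarith), cut_of_nonpos (by linarith), mul_zero, add_zero]
    · have := h1 hs
      rw [loop_of_five_le k (by linarith), cut_of_one_le (by linarith), sub_self, mul_zero,
        add_zero]

theorem continuous_ofTree : Continuous (ofTree (n := n)) := by
  refine continuous_of_edges fun u k => ?_
  simp only [ofTree_edge]
  have := continuous_loop k
  exact Continuous.subtype_mk (by fun_prop) _

theorem ofTree_smul (g : FreeGroup (Fin n)) (p : FreeTree.Tree (Fin n)) :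
    ofTree (g • p) = ofTree p := by
  obtain ⟨u, k, s, rfl⟩ := exists_edge p
  rw [smul_edge, ofTree_edge, ofTree_edge]

/-- The map from the rose to the punctured strip which takes the `k`-th petal around the `k`-th
loop. -/
noncomputable def ofRose : Rose (Fin n) → PuncturedStrip n :=
  Quotient.lift ofTree fun p q h => by
    obtain ⟨g, rfl⟩ := h
    exact ofTree_smul g q

theorem ofRose_toRose (p : FreeTree.Tree (Fin n)) : ofRose (FreeTree.toRose p) = ofTree p := rfl

theorem continuous_ofRose : Continuous (ofRose (n := n)) := continuous_ofTree.quotient_lift _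

/-- The composite `PuncturedStrip → Rose → PuncturedStrip` is the end of the deformation. -/
theorem ofRose_toRose_eq {v : Rose (Fin n)} (hv : ∀ k, FreeTree.toRose (edge 1 k 0) = v)
    (hv' : ofRose v = basePoint n) (p : PuncturedStrip n) :
    (ofRose (toRose v p)).1 = deform (1, p) := by
  rcases forall_or_exists_param (n := n) p.1 with h | ⟨k, h0, h1⟩
  · rw [toRose_of_forall_not h, deform_of_forall h, hv']
    simp [basePoint]
  · rw [toRose_of_abs_lt hv ((mem_cone_of_param h0 h1).2.trans (by norm_num)), ofRose_toRose,
      ofTree_edge, deform_of_param h0 h1]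
    norm_num

/-- The effect of the composite `Rose → PuncturedStrip → Rose` on an edge, joined to the identity by
a straight line. The loop, parametrized by `7 s - 1`, is in the cone for `3 ≤ 7 s ≤ 4`. -/
noncomputable def squash (t : I) (s : I) : I :=
  ⟨(1 - t) * cut (7 * s - 3) + t * s, by
    have h1 := cut_nonneg (7 * s - 3)
    have h2 := cut_le_one (7 * s - 3)
    have ht := t.2
    have hs := s.2
    constructor
    · nlinarith [ht.1, ht.2, hs.1]
    · nlinarith [ht.1, ht.2, hs.2]⟩

/-- The map on the tree which applies `squash` to each coordinate. -/
noncomputable def squashTree (q : I × FreeTree.Tree (Fin n)) : FreeTree.Tree (Fin n) :=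
  ⟨fun e => (1 - q.1) * cut (7 * q.2.1 e - 3) + q.1 * q.2.1 e, by
    obtain ⟨t, p⟩ := q
    obtain ⟨u, k, s, rfl⟩ := exists_edge p
    refine ⟨u, k, squash t s, (squash t s).2, funext fun e => ?_⟩
    by_cases he : e = (u, k)
    · subst he
      simp only [edge_coord_self, edgeCoord, Function.update_self]
      rfl
    · simp only [edge, edgeCoord, Function.update_of_ne he]
      rcases vertexCoord_mem u e with h | h <;> rw [h]
      · rw [cut_of_nonpos (by norm_num)]
        ring
      · rw [cut_of_one_le (by norm_num)]
        ring⟩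

theorem continuous_squashTree : Continuous (squashTree (n := n)) := by
  refine Continuous.subtype_mk (continuous_pi fun e => ?_) _
  have h1 := continuous_coord (α := Fin n) e
  have h2 := continuous_cut
  have h3 : Continuous fun q : I × FreeTree.Tree (Fin n) => q.2.1 e := h1.comp continuous_snd
  fun_prop

theorem squashTree_edge (t : I) (u : FreeGroup (Fin n)) (k : Fin n) (s : I) :
    squashTree (t, edge u k s) = edge u k (squash t s) := by
  refine Subtype.ext (funext fun e => ?_)
  change (1 - (t : ℝ)) * cut (7 * (edge u k s).1 e - 3) + t * (edge u k s).1 e = _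
  by_cases he : e = (u, k)
  · subst he
    simp only [edge_coord_self]
    rfl
  · simp only [edge, edgeCoord, Function.update_of_ne he]
    rcases vertexCoord_mem u e with h | h <;> rw [h]
    · rw [cut_of_nonpos (by norm_num)]
      ring
    · rw [cut_of_one_le (by norm_num)]
      ring

theorem squashTree_smul (t : I) (g : FreeGroup (Fin n)) (p : FreeTree.Tree (Fin n)) :
    squashTree (t, g • p) = g • squashTree (t, p) := rfl

/-- `squashTree`, on the rose. -/
noncomputable def squashRose (q : I × Rose (Fin n)) : Rose (Fin n) :=
  Quotient.lift (fun p => FreeTree.toRose (squashTree (q.1, p))) (fun p p' h => by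
    obtain ⟨g, rfl⟩ := h
    change FreeTree.toRose (squashTree (q.1, g • p')) = _
    rw [squashTree_smul, toRose_eq_iff]
    exact ⟨g, rfl⟩) q.2

theorem continuous_squashRose : Continuous (squashRose (n := n)) := by
  have h1 : IsOpenQuotientMap
    (Prod.map id FreeTree.toRose : I × FreeTree.Tree (Fin n) → I × Rose (Fin n)) :=
    IsOpenQuotientMap.id.prodMap (MulAction.isOpenQuotientMap_quotientMk)
  rw [h1.isQuotientMap.continuous_iff]
  exact isQuotientCoveringMap_toRose.continuous.comp continuous_squashTree

/-- The map to the rose takes the `k`-th loop once around the `k`-th petal. -/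
theorem toRose_loop {v : Rose (Fin n)} (hv : ∀ k, FreeTree.toRose (edge 1 k 0) = v)
    (k : Fin n) (r : ℝ) : toRose v ⟨loop k r, loop_mem k r⟩ =
      FreeTree.toRose (edge 1 k ⟨cut (r - 2), cut_nonneg _, cut_le_one _⟩) := by
  rcases le_or_gt (loop k r).2 0 with h | h
  · rw [toRose_of_forall_not fun j => coneCoord_of_nonpos h]
    have h1 : cut (r - 2) = 0 ∨ cut (r - 2) = 1 := by
      rcases le_total r 2 with h2 | h2
      · exact Or.inl (cut_of_nonpos (by linarith))
      rcases le_total 3 r with h3 | h3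
      · exact Or.inr (cut_of_one_le (by linarith))
      · rw [loop_of_mem k (by linarith) (by linarith), cut_of_one_le (by linarith : 1 ≤ r - 1),
          cut_of_nonpos (by linarith : r - 3 ≤ 0)] at h
        norm_num at h
    rcases h1 with h1 | h1
    · rw [← hv k]
      congr 2
      exact Subtype.ext h1.symm
    · rw [← hv k, ← toRose_edge_one]
      congr 2
      exact Subtype.ext h1.symm
  · have h0 : 0 ≤ r := by
      by_contra hc
      rw [loop_of_le_zero k (by linarith)] at h
      norm_num at h
    have h5 : r ≤ 5 := by
      by_contra hc
      rw [loop_of_five_le k (by linarith)] at h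
      norm_num at h
    rw [toRose_of_abs_lt hv ((abs_loop_sub_le k h0 h5).trans_lt (by norm_num))]
    congr 2
    exact Subtype.ext (param_loop k h)

theorem toRose_eq_toRose_one (u : FreeGroup (Fin n)) (k : Fin n) (s : I) :
    FreeTree.toRose (edge u k s) = FreeTree.toRose (edge 1 k s) := by
  rw [toRose_eq_iff]
  refine ⟨u, ?_⟩
  change u • edge 1 k s = _
  rw [smul_edge, mul_one]

/-- The strip with `n` punctures is homotopy equivalent to the rose with `n` petals. -/
theorem nonempty_homotopyEquiv_rose (n : ℕ) [NeZero n] :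
    Nonempty (ContinuousMap.HomotopyEquiv (PuncturedStrip n) (Rose (Fin n))) := by
  set v : Rose (Fin n) := FreeTree.toRose (edge 1 0 0) with hv0
  have hv : ∀ k, FreeTree.toRose (edge 1 k 0) = v := fun k => by rw [hv0, edge_zero_eq 1 k 0]
  have hv' : ofRose v = basePoint n := by
    rw [hv0, ofRose_toRose, ofTree_edge]
    refine Subtype.ext ?_
    change loop 0 (7 * (0 : ℝ) - 1) = (1 / 2, -1)
    rw [loop_of_le_zero _ (by norm_num), cut_of_nonpos (by norm_num), mul_zero, add_zero]
  let f : C(PuncturedStrip n, Rose (Fin n)) := ⟨toRose v, continuous_toRose hv⟩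
  let g : C(Rose (Fin n), PuncturedStrip n) := ⟨ofRose, continuous_ofRose⟩
  let m : C(PuncturedStrip n, PuncturedStrip n) :=
    ⟨fun p => ⟨deform (0, p), deform_mem _⟩, Continuous.subtype_mk
      (continuous_deform.comp (by fun_prop)) _⟩
  have H1 : (ContinuousMap.id (PuncturedStrip n)).Homotopy m :=
    { toFun := fun q => ⟨(1 - (q.1 : ℝ)) • q.2.1 + (q.1 : ℝ) • deform (0, q.2), segment_mem _ _⟩
      continuous_toFun := by
        have : Continuous fun q : I × PuncturedStrip n => deform (0, q.2) :=
          continuous_deform.comp (by fun_prop)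
        exact Continuous.subtype_mk (by fun_prop) _
      map_zero_left := fun p => Subtype.ext (by simp)
      map_one_left := fun p => Subtype.ext (by simp [m]) }
  have H2 : m.Homotopy (g.comp f) :=
    { toFun := fun q => ⟨deform q, deform_mem q⟩
      continuous_toFun := Continuous.subtype_mk continuous_deform _
      map_zero_left := fun p => rfl
      map_one_left := fun p => Subtype.ext (ofRose_toRose_eq hv hv' p).symm }
  have H3 : (f.comp g).Homotopy (ContinuousMap.id _) :=
    { toFun := squashRose
      continuous_toFun := continuous_squashRose
      map_zero_left := fun x => by
        obtain ⟨p, rfl⟩ := Quotient.exists_rep x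
        obtain ⟨u, k, s, rfl⟩ := exists_edge p
        change FreeTree.toRose (squashTree (0, edge u k s)) = toRose v (ofTree (edge u k s))
        rw [squashTree_edge, ofTree_edge, toRose_loop hv, toRose_eq_toRose_one]
        congr 2
        refine Subtype.ext ?_
        simp only [squash, Set.Icc.coe_zero, sub_zero, one_mul, zero_mul, add_zero]
        congr 1
        ring
      map_one_left := fun x => by
        obtain ⟨p, rfl⟩ := Quotient.exists_rep x
        obtain ⟨u, k, s, rfl⟩ := exists_edge p
        change FreeTree.toRose (squashTree (1, edge u k s)) = FreeTree.toRose (edge u k s)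
        rw [squashTree_edge]
        congr 2
        refine Subtype.ext ?_
        simp [squash] }
  exact ⟨⟨f, g, ⟨(H1.trans H2).symm⟩, ⟨H3⟩⟩⟩

end PuncturedStrip

/-! ### Coordinates on the complement of the Hopf link -/

namespace HopfLink

open Complex

/-- The coordinate `w = i (x + y) / (x - y)` on the base of the Hopf fibration turns the equation
`x ^ d = y ^ d` into `(w + i) ^ d = (w - i) ^ d`. -/
theorem pow_eq_pow_iff {d : ℕ} {D w : ℂ} (hD : D ≠ 0) :
    (D * (1 - Complex.I * w) / 2) ^ d = (D * (-1 - Complex.I * w) / 2) ^ d ↔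
      (w + Complex.I) ^ d = (w - Complex.I) ^ d := by
  have h1 : D * (1 - Complex.I * w) / 2 = (-Complex.I * D / 2) * (w + Complex.I) := by
    linear_combination (D / 2) * I_mul_I
  have h2 : D * (-1 - Complex.I * w) / 2 = (-Complex.I * D / 2) * (w - Complex.I) := by
    linear_combination (-D / 2) * I_mul_I
  have h3 : -Complex.I * D / 2 ≠ 0 := by simp [hD]
  rw [h1, h2, mul_pow, mul_pow, mul_right_inj' (pow_ne_zero _ h3)]

/-- The angle in `(0, π)` whose cotangent is `t`, rescaled to `(0, d)`. -/
noncomputable def angle (d : ℕ) (t : ℝ) : ℝ := d * (1 / 2 - Real.arctan t / Real.pi)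

theorem angle_pos {d : ℕ} (hd : 0 < d) (t : ℝ) : 0 < angle d t := by
  have h1 := Real.arctan_lt_pi_div_two t
  have h2 := Real.pi_pos
  have h3 : Real.arctan t / Real.pi < 1 / 2 := by
    rw [div_lt_iff₀ h2]
    linarith
  have h4 : (0 : ℝ) < d := by exact_mod_cast hd
  exact mul_pos h4 (by linarith)

theorem angle_lt {d : ℕ} (hd : 0 < d) (t : ℝ) : angle d t < d := by
  have h1 := Real.neg_pi_div_two_lt_arctan t
  have h2 := Real.pi_pos
  have h3 : -(1 / 2) < Real.arctan t / Real.pi := by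
    rw [lt_div_iff₀ h2]
    linarith
  have h4 : (0 : ℝ) < d := by exact_mod_cast hd
  exact mul_lt_of_lt_one_right h4 (by linarith)

theorem continuous_angle (d : ℕ) : Continuous (angle d) := by
  have := Real.continuous_arctan
  unfold angle
  fun_prop

/-- The points of the link in the coordinate `w`. -/
theorem add_I_pow_eq_iff {n : ℕ} (w : ℂ) : (w + Complex.I) ^ (n + 1) = (w - Complex.I) ^ (n + 1) ↔
    ∃ k : Fin n, (angle (n + 1) w.re, w.im) = ((k : ℝ) + 1, 0) := by
  -- If `t = cot θ`, then `t ± i` is a real multiple of `exp (± i θ)`.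
  have key : ∀ t : ℝ, ((t : ℂ) + Complex.I) ^ (n + 1) = (t - Complex.I) ^ (n + 1) ↔
      Real.sin (angle (n + 1) t * Real.pi) = 0 := by
    intro t
    set φ := Real.arctan t with hφ
    have hc : Real.cos φ ≠ 0 := (Real.cos_arctan_pos t).ne'
    have hc' : (Real.cos φ : ℂ) ≠ 0 := by exact_mod_cast hc
    have ht : t = Real.tan φ := (Real.tan_arctan t).symm
    have hs : t * Real.cos φ = Real.sin φ := by rw [ht, Real.tan_mul_cos hc]
    have hs' : (t : ℂ) * Real.cos φ = Real.sin φ := by exact_mod_cast hs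
    have h1 : (Real.cos φ : ℂ) * (t + Complex.I) = exp ((Real.pi / 2 - φ : ℝ) * Complex.I) := by
      rw [exp_mul_I, ← ofReal_cos, ← ofReal_sin, Real.cos_pi_div_two_sub, Real.sin_pi_div_two_sub]
      linear_combination hs'
    have h2 : (Real.cos φ : ℂ) * (t - Complex.I) = exp ((-(Real.pi / 2 - φ) : ℝ) * Complex.I) := by
      rw [exp_mul_I, ← ofReal_cos, ← ofReal_sin, Real.cos_neg, Real.sin_neg,
        Real.cos_pi_div_two_sub, Real.sin_pi_div_two_sub, ofReal_neg]
      linear_combination hs'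
    have h3 : angle (n + 1) t * Real.pi = (n + 1 : ℕ) * (Real.pi / 2 - φ) := by
      have := Real.pi_ne_zero
      rw [angle, ← hφ]
      field_simp
    rw [← mul_right_inj' (pow_ne_zero (n + 1) hc'), ← mul_pow, ← mul_pow, h1, h2, ← exp_nat_mul,
      ← exp_nat_mul, h3]
    generalize Real.pi / 2 - φ = θ
    have h4 : ((n + 1 : ℕ) : ℂ) * ((θ : ℝ) * Complex.I) =
        (((n + 1 : ℕ) * θ : ℝ) : ℂ) * Complex.I := by
      push_cast; ring
    have h5 : ((n + 1 : ℕ) : ℂ) * ((-θ : ℝ) * Complex.I) =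
        ((-((n + 1 : ℕ) * θ) : ℝ) : ℂ) * Complex.I := by
      push_cast; ring
    rw [h4, h5]
    generalize ((n + 1 : ℕ) : ℝ) * θ = x
    rw [exp_mul_I, exp_mul_I, ← ofReal_cos, ← ofReal_sin, ← ofReal_cos, ← ofReal_sin,
      Real.cos_neg, Real.sin_neg]
    constructor
    · intro h
      have := congrArg Complex.im h
      simp only [add_im, mul_im, ofReal_re, ofReal_im, I_re, I_im, mul_one, mul_zero,
        add_zero, zero_add] at this
      linarith
    · intro h
      rw [h]
      simp
  constructor
  · intro h
    -- The points at the same distance from `i` and from `-i` are real.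
    have h1 : ‖w + Complex.I‖ = ‖w - Complex.I‖ := by
      have := congrArg norm h
      rw [norm_pow, norm_pow] at this
      exact (pow_left_inj₀ (norm_nonneg _) (norm_nonneg _) (Nat.succ_ne_zero n)).1 this
    have h2 : w.im = 0 := by
      have h3 : ‖w + Complex.I‖ ^ 2 = ‖w - Complex.I‖ ^ 2 := by rw [h1]
      rw [← normSq_eq_norm_sq, ← normSq_eq_norm_sq, normSq_apply, normSq_apply] at h3
      simp at h3
      linarith
    have h3 : w = (w.re : ℂ) := Complex.ext rfl (by simpa using h2)
    rw [h3, key, Real.sin_eq_zero_iff] at h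
    obtain ⟨m, hm⟩ := h
    have h4 : (m : ℝ) = angle (n + 1) w.re := mul_right_cancel₀ Real.pi_ne_zero hm
    have h5 := angle_pos (Nat.succ_pos n) w.re
    have h6 := angle_lt (Nat.succ_pos n) w.re
    rw [← h4] at h5 h6
    have h7 : 0 < m := by exact_mod_cast h5
    have h8 : m < n + 1 := by exact_mod_cast h6
    refine ⟨⟨(m - 1).toNat, by omega⟩, Prod.ext ?_ h2⟩
    rw [← h4]
    have h9 : m = ((m - 1).toNat : ℤ) + 1 := by omega
    have h10 : (m : ℝ) = (((m - 1).toNat : ℤ) : ℝ) + 1 := by exact_mod_cast h9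
    simpa using h10
  · rintro ⟨k, hk⟩
    have h2 : w.im = 0 := congrArg Prod.snd hk
    have h1 : angle (n + 1) w.re = k + 1 := congrArg Prod.fst hk
    have h3 : w = (w.re : ℂ) := Complex.ext rfl (by simpa using h2)
    rw [h3, key, h1]
    have := Real.sin_nat_mul_pi (k + 1)
    push_cast at this
    exact this

/-- The projection to the base of the Hopf fibration, in the coordinate `i (x + y) / (x - y)`. The
value on the fibre `x = y`, which belongs to the link, is meaningless. -/
noncomputable def base (z : S3) : ℂ := Complex.I * (z.1 0 + z.1 1) / (z.1 0 - z.1 1)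

theorem sub_ne_zero_of_mem {d : ℕ} {z : S3} (h : z ∈ (standardHopfLink d)ᶜ) :
    z.1 0 - z.1 1 ≠ 0 := fun hc => h (by
      rw [sub_eq_zero] at hc
      change z.1 0 ^ d = z.1 1 ^ d
      rw [hc])

theorem base_mem {n : ℕ} {z : S3} (h : z ∈ (standardHopfLink (n + 1))ᶜ) (k : Fin n) :
    (angle (n + 1) (base z).re, (base z).im) ≠ ((k : ℝ) + 1, 0) := by
  have hD := sub_ne_zero_of_mem h
  intro hk
  refine h ?_
  have h1 := (pow_eq_pow_iff hD).2 ((add_I_pow_eq_iff (base z)).2 ⟨k, hk⟩)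
  have h2 : (z.1 0 - z.1 1) * (Complex.I * base z) = -(z.1 0 + z.1 1) := by
    rw [base]
    field_simp
    rw [I_sq]
    ring
  have h3 : (z.1 0 - z.1 1) * (1 - Complex.I * base z) / 2 = z.1 0 := by
    linear_combination (-1 / 2) * h2
  have h4 : (z.1 0 - z.1 1) * (-1 - Complex.I * base z) / 2 = z.1 1 := by
    linear_combination (-1 / 2) * h2
  rwa [h3, h4] at h1

/-- The point of the sphere with the given base coordinate `w` and fibre coordinate `u`. -/
noncomputable def point (w u : ℂ) : EuclideanSpace ℂ (Fin 2) :=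
  !₂[u * (√(2 / (1 + ‖w‖ ^ 2)) : ℝ) * (1 - Complex.I * w) / 2,
    u * (√(2 / (1 + ‖w‖ ^ 2)) : ℝ) * (-1 - Complex.I * w) / 2]

theorem norm_sq_add_norm_sq (a b : ℂ) :
    ‖a + b‖ ^ 2 + ‖a - b‖ ^ 2 = 2 * (‖a‖ ^ 2 + ‖b‖ ^ 2) := by
  have := parallelogram_law_with_norm ℝ a b
  nlinarith

theorem norm_sq_S3 (z : S3) : ‖z.1 0‖ ^ 2 + ‖z.1 1‖ ^ 2 = 1 := by
  have h := mem_sphere_zero_iff_norm.1 z.2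
  have h1 := EuclideanSpace.norm_sq_eq z.1
  rw [h, Fin.sum_univ_two] at h1
  linarith

theorem norm_point (w : ℂ) (u : Circle) : ‖point w u‖ = 1 := by
  have h1 := EuclideanSpace.norm_sq_eq (point w u)
  rw [Fin.sum_univ_two] at h1
  have h2 := norm_sq_add_norm_sq 1 (Complex.I * w)
  have h3 : ‖(-1 : ℂ) - Complex.I * w‖ = ‖1 + Complex.I * w‖ := by
    rw [← norm_neg]
    congr 1
    ring
  have hw : 0 < 1 + ‖w‖ ^ 2 := by positivity
  have h4 : ‖point w u‖ ^ 2 = 1 := by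
    rw [h1]
    simp only [point, PiLp.toLp_apply, Matrix.cons_val_zero, Matrix.cons_val_one, norm_div,
      norm_mul,
      h3, Circle.norm_coe, one_mul, norm_real, Real.norm_eq_abs, abs_of_nonneg (Real.sqrt_nonneg _),
      div_pow, mul_pow, Real.sq_sqrt (by positivity : 0 ≤ 2 / (1 + ‖w‖ ^ 2))]
    simp only [norm_one, norm_mul, norm_I, one_mul, one_pow] at h2
    have h5 : ‖(2 : ℂ)‖ = 2 := by simp
    rw [h5]
    field_simp
    linarith
  exact (pow_eq_one_iff_of_nonneg (norm_nonneg _) two_ne_zero).1 h4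

theorem sqrt_pos (w : ℂ) : 0 < √(2 / (1 + ‖w‖ ^ 2)) := Real.sqrt_pos.2 (by positivity)

theorem point_sub (w u : ℂ) : point w u 0 - point w u 1 = u * (√(2 / (1 + ‖w‖ ^ 2)) : ℝ) := by
  simp only [point, PiLp.toLp_apply, Matrix.cons_val_zero, Matrix.cons_val_one]
  ring

theorem point_add (w u : ℂ) :
    point w u 0 + point w u 1 = -Complex.I * w * (u * (√(2 / (1 + ‖w‖ ^ 2)) : ℝ)) := by
  simp only [point, PiLp.toLp_apply, Matrix.cons_val_zero, Matrix.cons_val_one]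
  ring

theorem norm_sub_S3 (z : S3) (h : z.1 0 - z.1 1 ≠ 0) :
    √(2 / (1 + ‖base z‖ ^ 2)) = ‖z.1 0 - z.1 1‖ := by
  have h1 := norm_sq_S3 z
  have h2 := norm_sq_add_norm_sq (z.1 0) (z.1 1)
  have h3 : 0 < ‖z.1 0 - z.1 1‖ := norm_pos_iff.2 h
  rw [base, norm_div, norm_mul, norm_I, one_mul]
  have h4 : 1 + (‖z.1 0 + z.1 1‖ / ‖z.1 0 - z.1 1‖) ^ 2 = 2 / ‖z.1 0 - z.1 1‖ ^ 2 := by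
    field_simp
    linarith
  rw [h4, div_div_cancel₀ two_ne_zero, Real.sqrt_sq h3.le]

/-! ### The complement is the product of the punctured strip and the circle -/

/-- The fibre coordinate of a point, the argument of `x - y`. -/
noncomputable def fibre {d : ℕ} (z : ((standardHopfLink d)ᶜ : Set S3)) : Circle :=
  ⟨(z.1.1 0 - z.1.1 1) / ‖z.1.1 0 - z.1.1 1‖, by
    rw [Submonoid.unitSphere, ← SetLike.mem_coe]
    change _ ∈ Metric.sphere (0 : ℂ) 1
    rw [mem_sphere_zero_iff_norm, norm_div, norm_real, norm_norm, div_self]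
    exact norm_ne_zero_iff.2 (sub_ne_zero_of_mem z.2)⟩

theorem continuous_fibre (d : ℕ) : Continuous (fibre (d := d)) := by
  refine Continuous.subtype_mk ?_ _
  refine Continuous.div (by fun_prop) (by fun_prop) fun z => ?_
  exact ofReal_ne_zero.2 (norm_ne_zero_iff.2 (sub_ne_zero_of_mem z.2))

theorem continuous_base (d : ℕ) :
    Continuous fun z : ((standardHopfLink d)ᶜ : Set S3) => base z.1 := by
  refine Continuous.div (by fun_prop) (by fun_prop) fun z => ?_
  exact sub_ne_zero_of_mem z.2

theorem base_point {w : ℂ} {u : Circle} (h : point w u ∈ Metric.sphere 0 1) :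
    base ⟨point w u, h⟩ = w := by
  have h1 : (u : ℂ) * (√(2 / (1 + ‖w‖ ^ 2)) : ℝ) ≠ 0 :=
    mul_ne_zero u.coe_ne_zero (ofReal_ne_zero.2 (sqrt_pos w).ne')
  rw [base, point_sub, point_add, div_eq_iff h1]
  linear_combination (-w * ((u : ℂ) * (√(2 / (1 + ‖w‖ ^ 2)) : ℝ))) * I_mul_I

theorem point_base {d : ℕ} (z : ((standardHopfLink d)ᶜ : Set S3)) :
    point (base z.1) (fibre z) = z.1.1 := by
  have hD := sub_ne_zero_of_mem z.2
  have h0 : (‖z.1.1 0 - z.1.1 1‖ : ℂ) ≠ 0 := ofReal_ne_zero.2 (norm_ne_zero_iff.2 hD)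
  have h1 : (fibre z : ℂ) * (√(2 / (1 + ‖base z.1‖ ^ 2)) : ℝ) = z.1.1 0 - z.1.1 1 := by
    rw [norm_sub_S3 z.1 hD]
    exact div_mul_cancel₀ _ h0
  have h2 := point_sub (base z.1) (fibre z)
  have h3 := point_add (base z.1) (fibre z)
  rw [h1] at h2 h3
  have h4 : base z.1 * (z.1.1 0 - z.1.1 1) = Complex.I * (z.1.1 0 + z.1.1 1) := by
    rw [base, div_mul_cancel₀ _ hD]
  have h5 : point (base z.1) (fibre z) 0 + point (base z.1) (fibre z) 1 =
      z.1.1 0 + z.1.1 1 := by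
    rw [h3]
    linear_combination -Complex.I * h4 - (z.1.1 0 + z.1.1 1) * I_mul_I
  ext i
  fin_cases i
  · change point (base z.1) (fibre z) 0 = z.1.1 0
    linear_combination (h2 + h5) / 2
  · change point (base z.1) (fibre z) 1 = z.1.1 1
    linear_combination (h5 - h2) / 2

theorem point_notMem {n : ℕ} {w : ℂ} (u : Circle)
    (hw : ∀ k : Fin n, (angle (n + 1) w.re, w.im) ≠ ((k : ℝ) + 1, 0)) :
    (⟨point w u, mem_sphere_zero_iff_norm.2 (norm_point w u)⟩ : S3) ∈
      (standardHopfLink (n + 1))ᶜ := by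
  intro h
  have h1 : (u : ℂ) * (√(2 / (1 + ‖w‖ ^ 2)) : ℝ) ≠ 0 :=
    mul_ne_zero u.coe_ne_zero (ofReal_ne_zero.2 (sqrt_pos w).ne')
  obtain ⟨k, hk⟩ := (add_I_pow_eq_iff w).1 ((pow_eq_pow_iff (d := n + 1) h1).1 h)
  exact hw k hk

/-- The inverse of `angle`. -/
noncomputable def cotangent (n : ℕ) (x : ℝ) : ℝ := Real.tan (Real.pi * (1 / 2 - x / (n + 1)))

theorem cotangent_arg_mem {n : ℕ} {x : ℝ} (h0 : 0 < x) (h1 : x < n + 1) :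
    Real.pi * (1 / 2 - x / (n + 1)) ∈ Set.Ioo (-(Real.pi / 2)) (Real.pi / 2) := by
  have hn : (0 : ℝ) < n + 1 := by positivity
  have h2 : 0 < x / (n + 1) := by positivity
  have h3 : x / (n + 1) < 1 := (div_lt_one hn).2 h1
  have := Real.pi_pos
  constructor <;> nlinarith

theorem angle_cotangent {n : ℕ} {x : ℝ} (h0 : 0 < x) (h1 : x < n + 1) :
    angle (n + 1) (cotangent n x) = x := by
  have h := cotangent_arg_mem h0 h1
  have := Real.pi_ne_zero
  have hn : (n : ℝ) + 1 ≠ 0 := by positivity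
  rw [angle, cotangent, Real.arctan_tan h.1 h.2]
  push_cast
  field_simp
  ring

theorem cotangent_angle (n : ℕ) (t : ℝ) : cotangent n (angle (n + 1) t) = t := by
  have := Real.pi_ne_zero
  have hn : (n : ℝ) + 1 ≠ 0 := by positivity
  have h : Real.pi * (1 / 2 - angle (n + 1) t / (n + 1)) = Real.arctan t := by
    rw [angle]
    push_cast
    field_simp
    ring
  rw [cotangent, h, Real.tan_arctan]

theorem continuous_cotangent (n : ℕ) :
    Continuous fun p : PuncturedStrip n => cotangent n p.1.1 := by
  rw [continuous_iff_continuousAt]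
  intro p
  have h : Real.cos (Real.pi * (1 / 2 - p.1.1 / (n + 1))) ≠ 0 :=
    (Real.cos_pos_of_mem_Ioo (cotangent_arg_mem p.2.1 p.2.2.1)).ne'
  exact (Real.continuousAt_tan.2 h).comp (f := fun p : PuncturedStrip n =>
    Real.pi * (1 / 2 - p.1.1 / (n + 1))) (by fun_prop)

theorem continuous_point : Continuous fun q : ℂ × Circle => point q.1 q.2 := by
  have h1 : Continuous fun q : ℂ × Circle => √(2 / (1 + ‖q.1‖ ^ 2)) := by
    refine Real.continuous_sqrt.comp (Continuous.div (by fun_prop) (by fun_prop) fun q => ?_)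
    positivity
  have h2 : Continuous fun q : ℂ × Circle => ((√(2 / (1 + ‖q.1‖ ^ 2)) : ℝ) : ℂ) :=
    continuous_ofReal.comp h1
  unfold point
  refine (PiLp.continuous_toLp 2 _).comp (continuous_pi fun i => ?_)
  fin_cases i
  · change Continuous fun q : ℂ × Circle =>
      (q.2 : ℂ) * (√(2 / (1 + ‖q.1‖ ^ 2)) : ℝ) * (1 - Complex.I * q.1) / 2
    fun_prop (disch := norm_num)
  · change Continuous fun q : ℂ × Circle =>
      (q.2 : ℂ) * (√(2 / (1 + ‖q.1‖ ^ 2)) : ℝ) * (-1 - Complex.I * q.1) / 2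
    fun_prop (disch := norm_num)

/-- The complement of the standard Hopf link with `n + 1` components is the product of the strip
with `n` punctures and the circle. -/
noncomputable def complementHomeomorph (n : ℕ) :
    ((standardHopfLink (n + 1))ᶜ : Set S3) ≃ₜ PuncturedStrip n × Circle where
  toFun z := (⟨(angle (n + 1) (base z.1).re, (base z.1).im), angle_pos (Nat.succ_pos n) _, by
    have := angle_lt (Nat.succ_pos n) (base z.1).re
    push_cast at this
    exact this, base_mem z.2⟩, fibre z)
  invFun q := ⟨⟨point ⟨cotangent n q.1.1.1, q.1.1.2⟩ q.2, mem_sphere_zero_iff_norm.2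
    (norm_point _ _)⟩, point_notMem q.2 fun k => by
      dsimp only
      rw [angle_cotangent q.1.2.1 q.1.2.2.1]
      exact q.1.2.2.2 k⟩
  left_inv z := by
    refine Subtype.ext (Subtype.ext ?_)
    dsimp only
    rw [cotangent_angle]
    exact point_base z
  right_inv q := by
    obtain ⟨⟨⟨x, y⟩, hx0, hx1, hp⟩, u⟩ := q
    refine Prod.ext (Subtype.ext ?_) ?_
    · dsimp only
      rw [base_point, angle_cotangent hx0 hx1]
    · refine Circle.ext ?_
      have h1 := sqrt_pos ⟨cotangent n x, y⟩
      have h2 : (√(2 / (1 + ‖(⟨cotangent n x, y⟩ : ℂ)‖ ^ 2)) : ℂ) ≠ 0 :=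
        ofReal_ne_zero.2 h1.ne'
      change (point ⟨cotangent n x, y⟩ u 0 - point ⟨cotangent n x, y⟩ u 1) /
        (‖point ⟨cotangent n x, y⟩ u 0 - point ⟨cotangent n x, y⟩ u 1‖ : ℂ) = u
      rw [point_sub, norm_mul, Circle.norm_coe, one_mul, norm_real, Real.norm_of_nonneg h1.le,
        mul_div_assoc, div_self h2, mul_one]
  continuous_toFun := by
    have h1 := continuous_base (n + 1)
    have h2 := continuous_angle (n + 1)
    have h3 := continuous_fibre (n + 1)
    refine Continuous.prodMk (Continuous.subtype_mk ?_ _) h3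
    exact (h2.comp (continuous_re.comp h1)).prodMk (continuous_im.comp h1)
  continuous_invFun := by
    refine Continuous.subtype_mk (Continuous.subtype_mk ?_ _) _
    have h1 : Continuous fun q : PuncturedStrip n × Circle =>
        ((cotangent n q.1.1.1 : ℂ) + q.1.1.2 * Complex.I) := by
      have := (continuous_cotangent n).comp (continuous_fst (Y := Circle))
      have h2 : Continuous fun q : PuncturedStrip n × Circle => (cotangent n q.1.1.1 : ℂ) :=
        continuous_ofReal.comp this
      have h3 : Continuous fun q : PuncturedStrip n × Circle => (q.1.1.2 : ℂ) :=
        continuous_ofReal.comp (by fun_prop)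
      fun_prop
    have h4 := continuous_point.comp (h1.prodMk continuous_snd)
    refine h4.congr fun q => ?_
    simp only [Function.comp_apply, ← mk_eq_add_mul_I]

end HopfLink

/-! ### The group of the Hopf link -/

namespace HopfLink

/-- The group of deck transformations of the line over the circle is infinite cyclic. -/
theorem nonempty_zmultiples_mulEquiv {a : ℝ} (ha : a ≠ 0) :
    Nonempty (Multiplicative (AddSubgroup.zmultiples a) ≃* Multiplicative ℤ) := by
  let f : ℤ →+ AddSubgroup.zmultiples a := (zmultiplesHom ℝ a).rangeRestrict
  have hf : Function.Bijective f := by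
    refine ⟨fun m n h => ?_, AddMonoidHom.rangeRestrict_surjective _⟩
    have h1 : m • a = n • a := congrArg Subtype.val h
    exact smul_left_injective ℤ ha h1
  exact ⟨(AddEquiv.toMultiplicative (AddEquiv.ofBijective f hf)).symm⟩

theorem hasCanonicalPaths_rose (n : ℕ) [NeZero n] (v : FreeTree.Rose (Fin n)) :
    HasCanonicalPaths v := by
  obtain ⟨e, rfl⟩ := FreeTree.isQuotientCoveringMap_toRose.surjective v
  exact FreeTree.isQuotientCoveringMap_toRose.isCoveringMap.hasCanonicalPaths e

theorem hasCanonicalPaths_circle (c : Circle) : HasCanonicalPaths c := by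
  obtain ⟨e, rfl⟩ := Circle.isAddQuotientCoveringMap_exp.surjective c
  exact Circle.isAddQuotientCoveringMap_exp.isCoveringMap.hasCanonicalPaths e

theorem nonempty_fundamentalGroup_rose (n : ℕ) [NeZero n] (v : FreeTree.Rose (Fin n)) :
    Nonempty (FundamentalGroup (FreeTree.Rose (Fin n)) v ≃* FreeGroup (Fin n)) := by
  obtain ⟨e, rfl⟩ := FreeTree.isQuotientCoveringMap_toRose.surjective v
  exact ⟨(FreeTree.isQuotientCoveringMap_toRose.fundamentalGroupEquiv ⟨e, rfl⟩).trans
    (MulEquiv.inv' _).symm⟩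

theorem nonempty_fundamentalGroup_circle (c : Circle) :
    Nonempty (FundamentalGroup Circle c ≃* Multiplicative ℤ) := by
  obtain ⟨e, rfl⟩ := Circle.isAddQuotientCoveringMap_exp.surjective c
  obtain ⟨f⟩ := nonempty_zmultiples_mulEquiv (a := 2 * Real.pi) (by positivity)
  exact ⟨((Circle.isAddQuotientCoveringMap_exp.fundamentalGroupEquiv ⟨e, rfl⟩).trans
    (MulEquiv.inv' _).symm).trans f⟩

/-- The complement of a Hopf link is homeomorphic to the product of the punctured strip with a
circle. -/
theorem nonempty_complement_homeomorph {n : ℕ} {K : Set S3} (hK : IsHopfLink (n + 1) K) :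
    Nonempty ((Kᶜ : Set S3) ≃ₜ PuncturedStrip n × Circle) := by
  obtain ⟨h, hh⟩ := hK
  refine ⟨(h.subtype fun z => ?_).trans (complementHomeomorph n)⟩
  rw [Set.mem_compl_iff, Set.mem_compl_iff, ← hh, h.injective.mem_set_image]

theorem hasCanonicalPaths {n : ℕ} [NeZero n] {K : Set S3} (hK : IsHopfLink (n + 1) K)
    (b : (Kᶜ : Set S3)) : HasCanonicalPaths b := by
  obtain ⟨h⟩ := nonempty_complement_homeomorph hK
  obtain ⟨e⟩ := PuncturedStrip.nonempty_homotopyEquiv_rose n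
  have h1 : HasCanonicalPaths (h b) := by
    refine HasCanonicalPaths.prod (b := (h b).1) (c := (h b).2) ?_ (hasCanonicalPaths_circle _)
    obtain ⟨H⟩ := e.left_inv
    exact HasCanonicalPaths.of_homotopy _ _ H (hasCanonicalPaths_rose n _)
  refine HasCanonicalPaths.of_homotopy (h : C((Kᶜ : Set S3), PuncturedStrip n × Circle))
    (h.symm : C(PuncturedStrip n × Circle, (Kᶜ : Set S3))) ?_ h1
  refine (ContinuousMap.Homotopy.refl _).cast ?_ rfl
  ext z
  simp

/-- The fundamental group of the complement of a Hopf link. The inversion compensates for the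
opposite multiplication in `LoopGroup`. -/
theorem nonempty_loopGroup_mulEquiv {n : ℕ} [NeZero n] {K : Set S3} (hK : IsHopfLink (n + 1) K)
    (b : (Kᶜ : Set S3)) :
    Nonempty (LoopGroup b ≃* FreeGroup (Fin n) × Multiplicative ℤ) := by
  obtain ⟨h⟩ := nonempty_complement_homeomorph hK
  obtain ⟨e⟩ := PuncturedStrip.nonempty_homotopyEquiv_rose n
  obtain ⟨f1⟩ := h.toHomotopyEquiv.nonempty_fundamentalGroup_mulEquiv b
  obtain ⟨f2⟩ := e.nonempty_fundamentalGroup_mulEquiv (h b).1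
  obtain ⟨f3⟩ := nonempty_fundamentalGroup_rose n (e (h b).1)
  obtain ⟨f4⟩ := nonempty_fundamentalGroup_circle (h b).2
  exact ⟨(MulEquiv.inv' _).symm.trans
    (f1.trans ((FundamentalGroup.prodMulEquiv (h b).1 (h b).2).trans
    (MulEquiv.prodCongr (f2.trans f3) f4)))⟩

theorem hopf_commute {n : ℕ} (i : Fin n) :
    Commute (PresentedGroup.of (rels := hopfRelators (n + 1)) 0) (PresentedGroup.of i.succ) := by
  have h : (PresentedGroup.mk (hopfRelators (n + 1))) (FreeGroup.of 0 * FreeGroup.of i.succ *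
      (FreeGroup.of 0)⁻¹ * (FreeGroup.of i.succ)⁻¹) = 1 :=
    PresentedGroup.one_of_mem ⟨0, i.succ, rfl, by simp, rfl⟩
  simp only [map_mul, map_inv] at h
  rw [mul_inv_eq_one, mul_inv_eq_iff_eq_mul] at h
  exact h

/-- The homomorphism from the group of the Hopf link to the product of a free group and an infinite
cyclic group. -/
def toProd (n : ℕ) : HopfGroup (n + 1) →* FreeGroup (Fin n) × Multiplicative ℤ :=
  PresentedGroup.toGroup (rels := hopfRelators (n + 1))
    (f := Fin.cases (1, Multiplicative.ofAdd 1) fun i => (FreeGroup.of i, 1)) (by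
      rintro _ ⟨j, i, hj, hi, rfl⟩
      obtain rfl : j = 0 := Fin.ext hj
      obtain ⟨i, rfl⟩ := Fin.exists_succ_eq.2 (fun h : i = 0 => by simp [h] at hi)
      simp)

theorem toProd_of_zero (n : ℕ) :
    toProd n (PresentedGroup.of 0) = (1, Multiplicative.ofAdd 1) := by
  simp [toProd]

theorem toProd_of_succ {n : ℕ} (i : Fin n) :
    toProd n (PresentedGroup.of i.succ) = (FreeGroup.of i, 1) := by
  simp [toProd]

/-- The inverse of `toProd`. -/
def ofProd (n : ℕ) : FreeGroup (Fin n) × Multiplicative ℤ →* HopfGroup (n + 1) :=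
  MonoidHom.noncommCoprod
    (FreeGroup.lift fun i => PresentedGroup.of (rels := hopfRelators (n + 1)) i.succ)
    (zpowersHom (HopfGroup (n + 1)) (PresentedGroup.of 0)) fun x y => by
      rw [zpowersHom_apply]
      refine Commute.zpow_right (G := HopfGroup (n + 1)) ?_ _
      induction x using FreeGroup.induction_on with
      | C1 => simp
      | of i => simpa using (hopf_commute i).symm
      | inv_of i h => simpa using h.inv_left
      | mul x y hx hy => simpa using hx.mul_left hy

/-- The group of the Hopf link is the product of a free group and an infinite cyclic group. -/
def groupEquiv (n : ℕ) : HopfGroup (n + 1) ≃* FreeGroup (Fin n) × Multiplicative ℤ :=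
  MonoidHom.toMulEquiv (toProd n) (ofProd n)
    (by
      refine PresentedGroup.ext fun i => ?_
      refine Fin.cases ?_ (fun i => ?_) i
      · simp [toProd_of_zero, ofProd]
      · simp [toProd_of_succ, ofProd])
    (by
      have h1 : (toProd n).comp (FreeGroup.lift fun i => PresentedGroup.of i.succ) =
          MonoidHom.inl _ _ := by
        refine FreeGroup.ext_hom _ _ fun i => ?_
        simp [toProd_of_succ]
      refine MonoidHom.ext fun x => ?_
      obtain ⟨a, b⟩ := x
      have h2 := DFunLike.congr_fun h1 a
      simp only [MonoidHom.comp_apply] at h2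
      simp only [ofProd, MonoidHom.comp_apply, MonoidHom.noncommCoprod_apply, map_mul, h2,
        zpowersHom_apply, map_zpow, toProd_of_zero, MonoidHom.id_apply]
      simp [← ofAdd_zsmul])

end HopfLink

/-! ### Permutation representations and singular chains -/

section Exactness

variable {C : Type*} [Category* C] [Abelian C]

/-- A chain complex with an augmentation which is exact everywhere is a resolution. -/
theorem ChainComplex.quasiIso_toSingle₀ {K : ChainComplex C ℕ} {M : C} (f : K.X 0 ⟶ M)
    (hf : K.d 1 0 ≫ f = 0) (h0 : (ShortComplex.mk _ _ hf).Exact) (hepi : Epi f)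
    (h1 : ∀ n, K.ExactAt (n + 1)) : QuasiIso ((K.toSingle₀Equiv M).symm ⟨f, hf⟩) := by
  refine ⟨fun n => ?_⟩
  cases n with
  | zero =>
    rw [ChainComplex.quasiIsoAt₀_iff, ShortComplex.quasiIso_iff_of_zeros']
    · refine (ShortComplex.exact_and_epi_g_iff_of_iso ?_).2 ⟨h0, hepi⟩
      exact ShortComplex.isoMk (Iso.refl _) (Iso.refl _) (Iso.refl _)
        ((Category.id_comp _).trans (Category.comp_id _).symm)
        ((Category.id_comp _).trans ((ChainComplex.toSingle₀Equiv_symm_apply_f_zero f hf).symm.trans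
          (Category.comp_id _).symm))
    · exact K.shape _ _ (by simp)
    all_goals rfl
  | succ n =>
    rw [quasiIsoAt_iff_exactAt']
    · exact h1 n
    · exact ChainComplex.exactAt_succ_single_obj _ _

end Exactness

section PermRep

variable (F : Type v) [Field F]

/-- The free module functor. -/
noncomputable def freeModule : Type ⥤ ModuleCat.{v} F where
  obj S := ModuleCat.of F (S →₀ F)
  map f := ModuleCat.ofHom (Finsupp.lmapDomain F F f)
  map_id S := by
    ext : 1
    exact Finsupp.lmapDomain_id F F
  map_comp f g := by
    ext : 1
    exact Finsupp.lmapDomain_comp F F f g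

variable (G : Type) [Group G] (S : Type) [MulAction G S]

/-- The permutation representation of `G` on the finitely supported functions on a `G`-set. -/
noncomputable def permRepresentation : Representation F G (S →₀ F) where
  toFun α := Finsupp.lmapDomain F F (α • · : S → S)
  map_one' := by
    have : ((1 : G) • · : S → S) = id := funext fun s => one_smul G s
    rw [this]
    exact Finsupp.lmapDomain_id F F
  map_mul' α β := by
    have : ((α * β) • · : S → S) = (α • ·) ∘ (β • ·) := funext fun s => mul_smul α β s
    rw [this]
    exact Finsupp.lmapDomain_comp F F _ _

/-- The permutation representation, as an object of the category of representations. -/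
noncomputable abbrev permRep : Rep.{v} F G := Rep.of (permRepresentation F G S)

variable {G S}

theorem permRepresentation_single (α : G) (s : S) (r : F) :
    permRepresentation F G S α (Finsupp.single s r) = Finsupp.single (α • s) r :=
  Finsupp.mapDomain_single

/-- The morphism of permutation representations induced by an equivariant map. -/
noncomputable def permRepMap {T : Type} [MulAction G T] (f : S → T)
    (hf : ∀ (α : G) s, f (α • s) = α • f s) : permRep F G S ⟶ permRep F G T :=
  Rep.ofHom ⟨Finsupp.lmapDomain F F f, fun α => by
    refine Finsupp.lhom_ext fun s r => ?_
    change Finsupp.mapDomain f (permRepresentation F G S α _) =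
      permRepresentation F G T α (Finsupp.mapDomain f _)
    rw [permRepresentation_single, Finsupp.mapDomain_single, Finsupp.mapDomain_single,
      permRepresentation_single, hf]⟩

/-- The permutation representation on a free `G`-set is projective. -/
theorem projective_permRep (hfree : ∀ (α : G) (s : S), α • s = s → α = 1) :
    Projective (permRep F G S) where
  factors {A B} f e he := by
    rw [Rep.epi_iff_surjective] at he
    -- Every `s` is `γ s • rep s` for a representative `rep s` of its orbit and a unique `γ s`.
    let rep : S → S := fun s => (Quotient.out (Quotient.mk (MulAction.orbitRel G S) s))
    have hrep : ∀ s, ∃ α : G, α • rep s = s := fun s =>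
      MulAction.orbitRel_apply.1 ((MulAction.orbitRel G S).symm (Quotient.mk_out s))
    choose γ hγ using hrep
    have hsmul : ∀ (α : G) s, rep (α • s) = rep s := fun α s =>
      congrArg Quotient.out (Quotient.sound (MulAction.orbitRel_apply.2 ⟨α, rfl⟩))
    have hγ' : ∀ (α : G) s, γ (α • s) = α * γ s := by
      intro α s
      have h1 : (γ s)⁻¹ * α⁻¹ * γ (α • s) = 1 := by
        refine hfree _ (rep s) ?_
        have h2 : γ (α • s) • rep s = α • s :=
          (congrArg (γ (α • s) • ·) (hsmul α s).symm).trans (hγ _)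
        rw [mul_smul, mul_smul, h2, inv_smul_smul, inv_smul_eq_iff, hγ]
      rw [← mul_inv_rev, inv_mul_eq_one] at h1
      exact h1.symm
    choose a ha using fun s : S => he (f.hom (Finsupp.single s 1))
    let φ : (S →₀ F) →ₗ[F] A := Finsupp.linearCombination F fun s => A.ρ (γ s) (a (rep s))
    have hφ : ∀ s, φ (Finsupp.single s 1) = A.ρ (γ s) (a (rep s)) := fun s => by
      simp [φ, Finsupp.linearCombination_single]
    refine ⟨Rep.ofHom ⟨φ, fun α => ?_⟩, ?_⟩
    · refine Finsupp.lhom_ext' fun s => LinearMap.ext_ring ?_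
      change φ (permRepresentation F G S α (Finsupp.single s 1)) = A.ρ α (φ (Finsupp.single s 1))
      rw [permRepresentation_single, hφ, hφ, hγ', hsmul, map_mul]
      rfl
    · refine Rep.hom_ext (Representation.IntertwiningMap.ext (LinearMap.ext fun x => ?_))
      have : e.hom.toLinearMap ∘ₗ φ = f.hom.toLinearMap := by
        refine Finsupp.lhom_ext' fun s => LinearMap.ext_ring ?_
        change e.hom (φ (Finsupp.single s 1)) = f.hom (Finsupp.single s 1)
        rw [hφ, Rep.hom_comm_apply, ha, ← Rep.hom_comm_apply]
        congr 1
        exact (permRepresentation_single F (γ s) (rep s) 1).trans (by rw [hγ])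
      exact DFunLike.congr_fun this x

end PermRep

section Singular

variable {G : Type} [Group G] (E : Type) [TopologicalSpace E] [MulAction G E]
  [ContinuousConstSMul G E]

/-- The action on singular simplices. -/
noncomputable instance (n : SimplexCategoryᵒᵖ) :
    MulAction G ((TopCat.toSSet.obj (TopCat.of E)).obj n) where
  smul α s := (singularSMul E α).app n s
  one_smul s := by
    have h : singularSMul E (1 : G) = 𝟙 _ := by
      rw [← CategoryTheory.Functor.map_id]
      refine congrArg TopCat.toSSet.map (TopCat.hom_ext (ContinuousMap.ext fun e => ?_))
      exact one_smul G e
    change (singularSMul E (1 : G)).app n s = s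
    rw [h]
    rfl
  mul_smul α β s := by
    have h : singularSMul E (α * β) = singularSMul E β ≫ singularSMul E α := by
      rw [singularSMul, singularSMul, singularSMul, ← CategoryTheory.Functor.map_comp]
      refine congrArg TopCat.toSSet.map (TopCat.hom_ext (ContinuousMap.ext fun e => ?_))
      exact mul_smul α β e
    change (singularSMul E (α * β)).app n s = _
    rw [h]
    rfl

theorem singular_smul_free (hfree : ∀ (α : G) (e : E), α • e = e → α = 1) {n : SimplexCategoryᵒᵖ}
    (α : G) (s : (TopCat.toSSet.obj (TopCat.of E)).obj n) (h : α • s = s) : α = 1 := by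
  let x : stdSimplex ℝ (Fin (n.unop.len + 1)) := Classical.arbitrary _
  refine hfree α ((TopCat.of E).toSSetObjEquiv n s x) ?_
  conv_rhs => rw [← h]
  rfl

variable (F : Type v) [Field F]

/-- Singular chains, as a simplicial representation. -/
noncomputable def singularRep : SimplicialObject (Rep.{v} F G) where
  obj n := permRep F G ((TopCat.toSSet.obj (TopCat.of E)).obj n)
  map f := permRepMap F ((TopCat.toSSet.obj (TopCat.of E)).map f) fun α s =>
    (NatTrans.naturality_apply (singularSMul E α) f s).symm
  map_id n := by
    refine Rep.hom_ext (Representation.IntertwiningMap.ext (LinearMap.ext fun x => ?_))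
    change Finsupp.mapDomain ((TopCat.toSSet.obj (TopCat.of E)).map (𝟙 n)) x = x
    rw [CategoryTheory.Functor.map_id]
    exact Finsupp.mapDomain_id
  map_comp f g := by
    refine Rep.hom_ext (Representation.IntertwiningMap.ext (LinearMap.ext fun x => ?_))
    change Finsupp.mapDomain ((TopCat.toSSet.obj (TopCat.of E)).map (f ≫ g)) x = _
    rw [CategoryTheory.Functor.map_comp]
    exact Finsupp.mapDomain_comp (f := (TopCat.toSSet.obj (TopCat.of E)).map f)
      (g := (TopCat.toSSet.obj (TopCat.of E)).map g) (v := x)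

/-- The augmentation of the singular chains, with values in the trivial representation. -/
noncomputable def singularAugmentation : permRep F G
    ((TopCat.toSSet.obj (TopCat.of E)).obj (Opposite.op (SimplexCategory.mk 0))) ⟶
      permRep F G PUnit :=
  permRepMap F (fun _ => PUnit.unit) fun _ _ => rfl

/-- The projection of a simplicial set to a point. -/
def SSet.toPoint (X : SSet.{0}) : X ⟶ (Functor.const _).obj PUnit where
  app _ := ↾fun _ => PUnit.unit

/-- The inclusion of a point of a topological space in its singular simplicial set. -/
noncomputable def TopCat.ofPoint (X : TopCat.{0}) (x : X) :
    (Functor.const _).obj PUnit ⟶ TopCat.toSSet.obj X :=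
  (TopCat.toSSetIsoConst (TopCat.of PUnit)).inv ≫
    TopCat.toSSet.map (TopCat.ofHom (ContinuousMap.const _ x))

theorem toPoint_comp_ofPoint (X : TopCat.{0}) (x : X) :
    SSet.toPoint (TopCat.toSSet.obj X) ≫ TopCat.ofPoint X x =
      TopCat.toSSet.map (TopCat.ofHom (ContinuousMap.const X x)) := by
  have h : SSet.toPoint (TopCat.toSSet.obj X) =
      TopCat.toSSet.map (TopCat.ofHom (ContinuousMap.const X PUnit.unit)) ≫
        (TopCat.toSSetIsoConst (TopCat.of PUnit)).hom := by
    ext n s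
    rfl
  rw [h, TopCat.ofPoint, Category.assoc, Iso.hom_inv_id_assoc, ← CategoryTheory.Functor.map_comp]
  rfl

/-- The chains of a contractible space are homotopy equivalent to the chains of a point. -/
noncomputable def chainsHomotopyEquiv (X : TopCat.{0}) (x : X)
    (H : TopCat.Homotopy (TopCat.ofHom (ContinuousMap.const X x)) (𝟙 X)) :
    HomotopyEquiv
      ((AlgebraicTopology.alternatingFaceMapComplex _).obj
        (((SimplicialObject.whiskering _ _).obj (freeModule F)).obj (TopCat.toSSet.obj X)))
      ((AlgebraicTopology.alternatingFaceMapComplex _).obj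
        (((SimplicialObject.whiskering _ _).obj (freeModule F)).obj
          ((Functor.const _).obj PUnit))) where
  hom := (AlgebraicTopology.alternatingFaceMapComplex _).map
    (((SimplicialObject.whiskering _ _).obj (freeModule F)).map (SSet.toPoint _))
  inv := (AlgebraicTopology.alternatingFaceMapComplex _).map
    (((SimplicialObject.whiskering _ _).obj (freeModule F)).map (TopCat.ofPoint X x))
  homotopyHomInvId := by
    have h := (H.toSSet.toSimplicialObjectHomotopy.whiskerRight (freeModule F)).toChainHomotopy
    refine (Homotopy.ofEq ?_).trans (h.trans (Homotopy.ofEq ?_))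
    · rw [← CategoryTheory.Functor.map_comp, ← CategoryTheory.Functor.map_comp,
        toPoint_comp_ofPoint]
    · rw [CategoryTheory.Functor.map_id, CategoryTheory.Functor.map_id,
        CategoryTheory.Functor.map_id]
  homotopyInvHomId := Homotopy.ofEq (by
    rw [← CategoryTheory.Functor.map_comp, ← CategoryTheory.Functor.map_comp]
    have : TopCat.ofPoint X x ≫ SSet.toPoint _ = 𝟙 _ := by
      ext n s
      rfl
    rw [this, CategoryTheory.Functor.map_id, CategoryTheory.Functor.map_id])

/-- The singular chain complex in the category of representations. -/
noncomputable abbrev singularComplex : ChainComplex (Rep.{v} F G) ℕ :=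
  (AlgebraicTopology.alternatingFaceMapComplex _).obj (singularRep E F)

/-- Forgetting the group action. -/
noncomputable def singularComplexForget :
    ((forget₂ (Rep.{v} F G) (ModuleCat.{v} F)).mapHomologicalComplex _).obj (singularComplex E F) ≅
      (AlgebraicTopology.alternatingFaceMapComplex _).obj
        (((SimplicialObject.whiskering _ _).obj (freeModule F)).obj
          (TopCat.toSSet.obj (TopCat.of E))) :=
  eqToIso (Functor.congr_obj (AlgebraicTopology.map_alternatingFaceMapComplex
    (forget₂ (Rep.{v} F G) (ModuleCat.{v} F))) (singularRep E F))

end Singular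

/-! ### The resolution by singular chains -/

section SingularResolution

variable {G : Type} [Group G] (E : Type) [TopologicalSpace E] [MulAction G E]
  [ContinuousConstSMul G E] (F : Type v) [Field F]

theorem permRepMap_comp {S T U : Type} [MulAction G S] [MulAction G T] [MulAction G U] (f : S → T)
    (hf : ∀ (α : G) s, f (α • s) = α • f s) (g : T → U) (hg : ∀ (α : G) s, g (α • s) = α • g s)
    (k : S → U) (hk : ∀ (α : G) s, k (α • s) = α • k s) (h : g ∘ f = k) :
    permRepMap F f hf ≫ permRepMap F g hg = permRepMap F k hk := by
  subst h
  refine Rep.hom_ext (Representation.IntertwiningMap.ext (LinearMap.ext fun x => ?_))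
  exact (Finsupp.mapDomain_comp (f := f) (g := g) (v := x)).symm

theorem alternatingFaceMapComplex_d_one_zero {C : Type*} [Category* C] [Preadditive C]
    (X : SimplicialObject C) :
    ((AlgebraicTopology.alternatingFaceMapComplex C).obj X).d 1 0 = X.δ 0 - X.δ 1 := by
  rw [AlgebraicTopology.alternatingFaceMapComplex_obj_d,
    AlgebraicTopology.AlternatingFaceMapComplex.objD, Fin.sum_univ_two]
  simp [sub_eq_add_neg]

theorem singularComplex_d_comp_augmentation :
    (singularComplex (G := G) E F).d 1 0 ≫ singularAugmentation E F = 0 := by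
  have h : ∀ i : Fin 2, (singularRep (G := G) E F).δ i ≫ singularAugmentation E F =
      permRepMap F (fun _ => PUnit.unit) fun _ _ => rfl := fun i =>
    permRepMap_comp F _ (fun α s => (NatTrans.naturality_apply (singularSMul E α) _ s).symm)
      _ _ _ _ rfl
  refine (congrArg (· ≫ singularAugmentation E F)
    (alternatingFaceMapComplex_d_one_zero (singularRep E F))).trans ?_
  refine (Preadditive.sub_comp _ _ _).trans ?_
  exact sub_eq_zero.2 ((h 0).trans (h 1).symm)

/-- The complex of singular chains of a contractible space is exact in positive degrees. Exactness
can be checked after forgetting the group action, where the chains are homotopy equivalent to those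
of a point. -/
theorem singularComplex_exactAt [ContractibleSpace E] (n : ℕ) :
    (singularComplex (G := G) E F).ExactAt (n + 1) := by
  obtain ⟨x, ⟨H⟩⟩ := id_nullhomotopic E
  have e := (HomotopyEquiv.ofIso (singularComplexForget (G := G) E F)).trans
    (chainsHomotopyEquiv F (TopCat.of E) x H.symm)
  have h : (((forget₂ (Rep.{v} F G) (ModuleCat.{v} F)).mapHomologicalComplex _).obj
      (singularComplex E F)).ExactAt (n + 1) := by
    rw [exactAt_iff_of_quasiIsoAt e.hom]
    refine (exactAt_iff_of_quasiIsoAt ((AlgebraicTopology.alternatingFaceMapComplex _).mapIso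
      (Functor.constComp SimplexCategoryᵒᵖ PUnit (freeModule F))).hom _).2 ?_
    refine (exactAt_iff_of_quasiIsoAt
      (AlgebraicTopology.alternatingFaceMapComplexConst.hom.app ((freeModule F).obj PUnit)) _).2 ?_
    exact ChainComplex.alternatingConst_exactAt _ _ (by simp)
  exact (ShortComplex.exact_map_iff_of_faithful _ (forget₂ (Rep.{v} F G) (ModuleCat.{v} F))).1 h

/-- In degree zero, the chains of a point are the trivial representation, so a chain of augmentation
zero is the boundary of its image under the homotopy. -/
theorem singularAugmentation_exact [ContractibleSpace E] :
    (ShortComplex.mk _ _ (singularComplex_d_comp_augmentation (G := G) E F)).Exact := by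
  rw [← ShortComplex.exact_map_iff_of_faithful _ (forget₂ (Rep.{v} F G) (ModuleCat.{v} F)),
    ShortComplex.moduleCat_exact_iff]
  intro c hc
  obtain ⟨x, ⟨H⟩⟩ := id_nullhomotopic E
  let e := chainsHomotopyEquiv F (TopCat.of E) x H.symm
  have h := e.homotopyHomInvId.comm 0
  rw [Homotopy.dNext_zero_chainComplex, Homotopy.prevD_chainComplex, zero_add] at h
  have h' := DFunLike.congr_fun (congrArg ModuleCat.Hom.hom h) c
  have h0 : (e.hom ≫ e.inv).f 0 c = 0 := by
    change e.inv.f 0 (e.hom.f 0 c) = 0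
    have : e.hom.f 0 c = 0 := hc
    rw [this, map_zero]
  have h1 : (0 : ((TopCat.toSSet.obj (TopCat.of E)).obj _ →₀ F)) = _ := h0.symm.trans h'
  refine ⟨- e.homotopyHomInvId.hom 0 1 c, ?_⟩
  have h2 : (singularComplex (G := G) E F).d 1 0 = _ :=
    alternatingFaceMapComplex_d_one_zero (singularRep E F)
  have h3 := DFunLike.congr_fun (congrArg ModuleCat.Hom.hom
    (alternatingFaceMapComplex_d_one_zero (((SimplicialObject.whiskering _ _).obj
      (freeModule F)).obj (TopCat.toSSet.obj (TopCat.of E)))))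
    (e.homotopyHomInvId.hom 0 1 c)
  have h4 := DFunLike.congr_fun (congrArg (fun f => f.hom.toLinearMap) h2)
    (e.homotopyHomInvId.hom 0 1 c)
  refine (map_neg (((singularComplex (G := G) E F).d 1 0).hom.toLinearMap) _).trans ?_
  refine (congrArg (- ·) (h4.trans h3.symm)).trans ?_
  exact neg_eq_of_add_eq_zero_right h1.symm

theorem singularAugmentation_epi [ContractibleSpace E] :
    Epi (singularAugmentation (G := G) E F) := by
  rw [Rep.epi_iff_surjective]
  intro c
  obtain ⟨x, -⟩ := id_nullhomotopic E
  refine ⟨Finsupp.single ((TopCat.ofPoint (TopCat.of E) x).app _ PUnit.unit) (c PUnit.unit), ?_⟩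
  refine Finsupp.mapDomain_single.trans ?_
  exact (Finsupp.unique_single c).symm

/-- The singular chains of a contractible space with a free action are a projective resolution of
the trivial representation. -/
noncomputable def singularResolution [ContractibleSpace E]
    (hfree : ∀ (α : G) (e : E), α • e = e → α = 1) :
    ProjectiveResolution (permRep F G PUnit) where
  complex := singularComplex E F
  projective _ := projective_permRep F (singular_smul_free E hfree)
  π := ((singularComplex E F).toSingle₀Equiv _).symm
    ⟨singularAugmentation E F, singularComplex_d_comp_augmentation E F⟩
  quasiIso := ChainComplex.quasiIso_toSingle₀ _ _ (singularAugmentation_exact E F)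
    (singularAugmentation_epi E F) (singularComplex_exactAt E F)

end SingularResolution

/-! ### Functions with given differences -/

section Potentials

variable {A : Type*} [AddCommGroup A]

/-- Every function on `ℤ` is the difference function of another one. The group `ℤ` acts on `ℤ × A`
by a shift with cocycle `a`, and the orbit of `(0, 0)` is the graph of the solution. -/
theorem Int.exists_potential (a : ℤ → A) :
    ∃ S : ℤ → A, S 0 = 0 ∧ ∀ m, S (m + 1) = S m + a m := by
  let τ : Equiv.Perm (ℤ × A) :=
    { toFun := fun p => (p.1 + 1, p.2 + a p.1)
      invFun := fun p => (p.1 - 1, p.2 - a (p.1 - 1))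
      left_inv := fun p => by simp
      right_inv := fun p => by simp }
  have h1 : ∀ m : ℤ, (τ ^ (m + 1)) (0, 0) = τ ((τ ^ m) (0, 0)) := fun m => by
    rw [add_comm, zpow_one_add]
    rfl
  have h2 : ∀ m : ℤ, ((τ ^ m) (0, 0)).1 = m := fun m => by
    induction m using Int.induction_on with
    | zero => rfl
    | succ k hk =>
      rw [h1]
      exact congrArg (· + 1) hk
    | pred k hk =>
      have := h1 (-(k : ℤ) - 1)
      rw [sub_add_cancel] at this
      rw [this] at hk
      exact eq_sub_of_add_eq hk
  refine ⟨fun m => ((τ ^ m) (0, 0)).2, rfl, fun m => ?_⟩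
  refine (congrArg Prod.snd (h1 m)).trans ?_
  exact congrArg (fun k => ((τ ^ m) (0, 0)).2 + a k) (h2 m)

/-- The Cayley graph of a free group is a tree: every function on its edges is the difference
function of a function on its vertices. The free group acts on `FreeGroup ι × A`, and the orbit of
`(1, 0)` is the graph of the solution. -/
theorem FreeGroup.exists_potential {ι : Type*} (a : FreeGroup ι → ι → A) :
    ∃ D : FreeGroup ι → A, D 1 = 0 ∧ ∀ w i, D (w * FreeGroup.of i) = D w + a w i := by
  let τ : ι → Equiv.Perm (FreeGroup ι × A) := fun i =>
    { toFun := fun p => (p.1 * FreeGroup.of i, p.2 + a p.1 i)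
      invFun := fun p => (p.1 * (FreeGroup.of i)⁻¹, p.2 - a (p.1 * (FreeGroup.of i)⁻¹) i)
      left_inv := fun p => by simp
      right_inv := fun p => by simp }
  let ψ : FreeGroup ι →* (Equiv.Perm (FreeGroup ι × A))ᵐᵒᵖ :=
    FreeGroup.lift fun i => MulOpposite.op (τ i)
  have h1 : ∀ w i, (ψ (w * FreeGroup.of i)).unop (1, 0) = τ i ((ψ w).unop (1, 0)) := fun w i => by
    rw [ψ.map_mul, FreeGroup.lift_apply_of]
    rfl
  have h2 : ∀ w v, ((ψ v).unop (w, 0)).1 = w * v := by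
    have h3 : ∀ v p, ((ψ v).unop p).1 = p.1 * v := fun v => by
      induction v using FreeGroup.induction_on with
      | C1 => simp
      | of i => intro p; simp [ψ, τ]
      | inv_of i _ => intro p; simp [ψ, τ]
      | mul x y hx hy =>
        intro p
        rw [ψ.map_mul, MulOpposite.unop_mul, Equiv.Perm.mul_apply, hy, hx, mul_assoc]
    exact fun w v => h3 v _
  refine ⟨fun w => ((ψ w).unop (1, 0)).2, by simp, fun w i => ?_⟩
  refine (congrArg Prod.snd (h1 w i)).trans ?_
  have := h2 1 w
  rw [one_mul] at this
  exact congrArg (fun k => ((ψ w).unop (1, 0)).2 + a k i) this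

theorem Int.eq_of_difference_eq {f g : ℤ → A} (h0 : f 0 = g 0)
    (h : ∀ m, f (m + 1) - f m = g (m + 1) - g m) (m : ℤ) : f m = g m := by
  induction m using Int.induction_on with
  | zero => exact h0
  | succ k hk =>
    have := h k
    rw [hk] at this
    exact sub_left_injective this
  | pred k hk =>
    have := h (-(k : ℤ) - 1)
    rw [sub_add_cancel, hk] at this
    exact sub_right_injective this

theorem FreeGroup.eq_of_difference_eq {ι : Type*} {f g : FreeGroup ι → A} (h0 : f 1 = g 1)
    (h : ∀ w i, f (w * FreeGroup.of i) - f w = g (w * FreeGroup.of i) - g w)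
    (w : FreeGroup ι) : f w = g w := by
  have key : ∀ v w, f (w * v) - f w = g (w * v) - g w := fun v => by
    induction v using FreeGroup.induction_on with
    | C1 => simp
    | of i => exact fun w => h w i
    | inv_of i _ =>
      intro w
      have := h (w * (FreeGroup.of i)⁻¹) i
      rw [inv_mul_cancel_right] at this
      rw [← neg_sub, this, neg_sub]
    | mul x y hx hy =>
      intro w
      rw [← mul_assoc, ← sub_add_sub_cancel _ (f (w * x)), hx, hy, sub_add_sub_cancel]
  have := key w 1
  rw [one_mul, h0] at this
  exact sub_left_injective this

end Potentials

/-! ### Free representations -/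

section FreeGSet

/-- The free `G`-set with one orbit for each element of `ι`. -/
@[ext]
structure FreeGSet (ι : Type) (G : Type) where
  /-- The orbit. -/
  orbit : ι
  /-- The position in the orbit. -/
  elt : G

variable {G : Type} {ι : Type}

instance [Group G] : MulAction G (FreeGSet ι G) where
  smul α s := ⟨s.orbit, α * s.elt⟩
  one_smul s := FreeGSet.ext rfl (one_mul s.elt)
  mul_smul α β s := FreeGSet.ext rfl (mul_assoc α β s.elt)

theorem FreeGSet.smul_mk [Group G] (α g : G) (i : ι) :
    α • (⟨i, g⟩ : FreeGSet ι G) = ⟨i, α * g⟩ := rfl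

theorem FreeGSet.free [Group G] (α : G) (s : FreeGSet ι G) (h : α • s = s) : α = 1 :=
  mul_eq_right.1 (congrArg FreeGSet.elt h)

variable (F : Type v) [Field F]

/-- The element `g • e i` of the free module with basis `e`. -/
noncomputable abbrev freeElt (i : ι) (g : G) : FreeGSet ι G →₀ F := Finsupp.single ⟨i, g⟩ 1

variable {F} in
theorem freeElt_lhom_ext {M : Type*} [AddCommGroup M] [Module F M]
    {f₁ f₂ : (FreeGSet ι G →₀ F) →ₗ[F] M} (h : ∀ i g, f₁ (freeElt F i g) = f₂ (freeElt F i g)) :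
    f₁ = f₂ :=
  Finsupp.lhom_ext' fun s => LinearMap.ext_ring (h s.orbit s.elt)

variable [Group G]

/-- The `G`-map from a free module which takes given values on a basis. -/
noncomputable def freeHom {A : Rep.{v} F G} (a : ι → A) : permRep F G (FreeGSet ι G) ⟶ A :=
  Rep.ofHom ⟨Finsupp.linearCombination F fun s : FreeGSet ι G => A.ρ s.elt (a s.orbit), fun α => by
    refine freeElt_lhom_ext fun i g => ?_
    change Finsupp.linearCombination F (fun s : FreeGSet ι G => A.ρ s.elt (a s.orbit))
      (permRepresentation F G _ α (Finsupp.single _ 1)) =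
        A.ρ α (Finsupp.linearCombination F (fun s : FreeGSet ι G => A.ρ s.elt (a s.orbit)) _)
    rw [permRepresentation_single, Finsupp.linearCombination_single,
      Finsupp.linearCombination_single, FreeGSet.smul_mk, map_mul, one_smul, one_smul]
    rfl⟩

theorem freeHom_freeElt {A : Rep.{v} F G} (a : ι → A) (i : ι) (g : G) :
    (freeHom F a).hom (freeElt F i g) = A.ρ g (a i) := by
  refine (Finsupp.linearCombination_single F _ _).trans ?_
  rw [one_smul]

theorem permRepresentation_freeElt (α g : G) (i : ι) :
    permRepresentation F G _ α (freeElt F i g) = freeElt F i (α * g) :=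
  permRepresentation_single F α _ 1

end FreeGSet

/-! ### The Fox resolution -/

section Fox

variable {G : Type} [Group G] (F : Type v) [Field F] {n : ℕ} (x : Fin (n + 1) → G)

/-- The boundary operator in degree one of the chains of the universal cover of the presentation
complex: `e j ↦ x j - 1`. -/
noncomputable def foxOne :
    permRep F G (FreeGSet (Fin (n + 1)) G) ⟶ permRep F G (FreeGSet Unit G) :=
  freeHom F fun j => (freeElt F () (x j) - freeElt F () 1 : FreeGSet Unit G →₀ F)

/-- The boundary operator in degree two, given by the Fox derivatives of the relators
`x₀ xᵢ x₀⁻¹ xᵢ⁻¹`. -/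
noncomputable def foxTwo :
    permRep F G (FreeGSet (Fin n) G) ⟶ permRep F G (FreeGSet (Fin (n + 1)) G) :=
  freeHom F fun i => (freeElt F 0 1 - freeElt F 0 (x i.succ) + freeElt F i.succ (x 0)
    - freeElt F i.succ 1 : FreeGSet (Fin (n + 1)) G →₀ F)

/-- The augmentation. -/
noncomputable def foxAugmentation : permRep F G (FreeGSet Unit G) ⟶ permRep F G PUnit :=
  permRepMap F (fun _ => PUnit.unit) fun _ _ => rfl

theorem foxOne_freeElt (j : Fin (n + 1)) (g : G) :
    (foxOne F x).hom (freeElt F j g) = (freeElt F () (g * x j) - freeElt F () g :) := by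
  refine (freeHom_freeElt F _ j g).trans ?_
  refine (map_sub (permRepresentation F G (FreeGSet Unit G) g) _ _).trans ?_
  rw [permRepresentation_freeElt, permRepresentation_freeElt, mul_one]

theorem foxTwo_freeElt (i : Fin n) (g : G) :
    (foxTwo F x).hom (freeElt F i g) = (freeElt F 0 g - freeElt F 0 (g * x i.succ) +
      freeElt F i.succ (g * x 0) - freeElt F i.succ g :) := by
  refine (freeHom_freeElt F _ i g).trans ?_
  change permRepresentation F G (FreeGSet (Fin (n + 1)) G) g _ = _
  simp only [map_sub, map_add, permRepresentation_freeElt, mul_one]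

theorem foxAugmentation_freeElt (g : G) :
    (foxAugmentation F).hom (freeElt F () g) = (Finsupp.single PUnit.unit 1 : PUnit.{1} →₀ F) :=
  Finsupp.mapDomain_single

theorem foxAugmentation_epi : Epi (foxAugmentation (G := G) F) := by
  rw [Rep.epi_iff_surjective]
  intro c
  refine ⟨Finsupp.single ⟨(), 1⟩ (c PUnit.unit), ?_⟩
  refine Finsupp.mapDomain_single.trans ?_
  exact (Finsupp.unique_single c).symm

theorem foxOne_comp_foxAugmentation : foxOne F x ≫ foxAugmentation F = 0 := by
  refine Rep.hom_ext (Representation.IntertwiningMap.ext ?_)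
  refine freeElt_lhom_ext fun j g => ?_
  change (foxAugmentation F).hom ((foxOne F x).hom (freeElt F j g)) = 0
  rw [foxOne_freeElt]
  refine (map_sub (foxAugmentation F).hom.toLinearMap _ _).trans ?_
  exact sub_eq_zero.2 ((foxAugmentation_freeElt F _).trans (foxAugmentation_freeElt F _).symm)

theorem foxTwo_comp_foxOne (hx : ∀ i : Fin n, Commute (x 0) (x i.succ)) :
    foxTwo F x ≫ foxOne F x = 0 := by
  refine Rep.hom_ext (Representation.IntertwiningMap.ext ?_)
  refine freeElt_lhom_ext fun i g => ?_
  change (foxOne F x).hom ((foxTwo F x).hom (freeElt F i g)) = 0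
  rw [foxTwo_freeElt]
  change (foxOne F x).hom.toLinearMap _ = 0
  rw [map_sub, map_add, map_sub]
  have h := fun j g => foxOne_freeElt F x j g
  change ∀ j g, (foxOne F x).hom.toLinearMap (freeElt F j g) = _ at h
  rw [h, h, h, h, mul_assoc, mul_assoc, (hx i).eq]
  abel

section Contraction

variable (e : G ≃* FreeGroup (Fin n) × Multiplicative ℤ)
  (hx0 : e (x 0) = (1, Multiplicative.ofAdd 1)) (hx : ∀ i, e (x i.succ) = (FreeGroup.of i, 1))

include hx0 hx in
/-- The free resolution attached to `⟨x₀, …, xₙ | x₀ xᵢ = xᵢ x₀⟩` has a contracting homotopy. If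
`g = w x₀ ^ m`, with `w` in the free group on `x₁, …, xₙ`, it sends `g` to the path which runs
from `1` to `w` along the tree of the free group, and then from `w` to `g`; it sends the edge from
`g` to `g xᵢ` to the band between the lines from `w` to `g` and from `w xᵢ` to `g xᵢ`. -/
theorem exists_foxContraction :
    ∃ (s₀ : (FreeGSet Unit G →₀ F) →ₗ[F] (FreeGSet (Fin (n + 1)) G →₀ F))
      (s₁ : (FreeGSet (Fin (n + 1)) G →₀ F) →ₗ[F] (FreeGSet (Fin n) G →₀ F)),
      (∀ g, (foxOne F x).hom (s₀ (freeElt F () g)) = (freeElt F () g - freeElt F () 1 :)) ∧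
      (∀ c, (foxTwo F x).hom (s₁ c) + s₀ ((foxOne F x).hom c) = c) ∧
      ∀ c, s₁ ((foxTwo F x).hom c) = c := by
  let c : FreeGroup (Fin n) → ℤ → G := fun w m => e.symm (w, Multiplicative.ofAdd m)
  have hc0 : ∀ w m, c w m * x 0 = c w (m + 1) := fun w m => by
    rw [← e.symm_apply_apply (x 0), hx0, ← map_mul]
    exact congrArg e.symm (Prod.ext (mul_one w) rfl)
  have hc : ∀ w m i, c w m * x (Fin.succ i) = c (w * FreeGroup.of i) m := fun w m i => by
    rw [← e.symm_apply_apply (x i.succ), hx, ← map_mul]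
    exact congrArg e.symm (Prod.ext rfl (mul_one _))
  have hc1 : c 1 0 = 1 := map_one e.symm
  have hsurj : ∀ g, ∃ w m, c w m = g := fun g =>
    ⟨(e g).1, (e g).2.toAdd, e.symm_apply_apply g⟩
  -- `S w m` is the line from `w` to `w x₀ ^ m`, `T i w m` is the band between this line and the one
  -- from `w xᵢ`, and `D w` is the path in the tree from `1` to `w`.
  choose S hS0 hS using fun w => Int.exists_potential fun m => freeElt F (0 : Fin (n + 1)) (c w m)
  choose T hT0 hT using fun (i : Fin n) w => Int.exists_potential fun m => freeElt F i (c w m)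
  obtain ⟨D, hD1, hD⟩ := FreeGroup.exists_potential fun w i => freeElt F (Fin.succ i) (c w 0)
  have hd1 : ∀ j g, (foxOne F x).hom.toLinearMap (freeElt F j g) =
    (freeElt F () (g * x j) - freeElt F () g :) := foxOne_freeElt F x
  have hd2 : ∀ i g, (foxTwo F x).hom.toLinearMap (freeElt F i g) = (freeElt F 0 g -
    freeElt F 0 (g * x (Fin.succ i)) + freeElt F i.succ (g * x 0) - freeElt F i.succ g :) :=
    foxTwo_freeElt F x
  have hd1S : ∀ w m, (foxOne F x).hom.toLinearMap (S w m) =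
      (freeElt F () (c w m) - freeElt F () (c w 0) :) := fun w =>
    Int.eq_of_difference_eq (by rw [hS0, map_zero, sub_self]) fun m => by
      rw [hS, map_add, hd1, hc0]
      abel
  have hd1D : ∀ w, (foxOne F x).hom.toLinearMap (D w) =
      (freeElt F () (c w 0) - freeElt F () 1 :) :=
    FreeGroup.eq_of_difference_eq (by rw [hD1, hc1, map_zero, sub_self]) fun w i => by
      rw [hD, map_add, hd1, hc]
      abel
  have hd2T : ∀ i w m, (foxTwo F x).hom.toLinearMap (T i w m) =
      (S w m - S (w * FreeGroup.of i) m + freeElt F i.succ (c w m) -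
        freeElt F i.succ (c w 0) :) := fun i w =>
    Int.eq_of_difference_eq (by simp [hT0, hS0]) fun m => by
      rw [hT, map_add, hd2, hc0, hc, hS, hS]
      abel
  let s₀ : (FreeGSet Unit G →₀ F) →ₗ[F] (FreeGSet (Fin (n + 1)) G →₀ F) :=
    Finsupp.linearCombination F fun s => D (e s.elt).1 + S (e s.elt).1 (e s.elt).2.toAdd
  let s₁ : (FreeGSet (Fin (n + 1)) G →₀ F) →ₗ[F] (FreeGSet (Fin n) G →₀ F) :=
    Finsupp.linearCombination F fun s =>
      Fin.cases 0 (fun i => T i (e s.elt).1 (e s.elt).2.toAdd) s.orbit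
  have hs₀ : ∀ w m, s₀ (freeElt F () (c w m)) = D w + S w m := fun w m => by
    refine (Finsupp.linearCombination_single F _ _).trans ?_
    simp [c]
  have hs₁0 : ∀ g, s₁ (freeElt F 0 g) = 0 := fun g =>
    (Finsupp.linearCombination_single F _ _).trans (one_smul _ _)
  have hs₁ : ∀ i w m, s₁ (freeElt F (Fin.succ i) (c w m)) = T i w m := fun i w m => by
    refine (Finsupp.linearCombination_single F _ _).trans ?_
    simp [c]
  refine ⟨s₀, s₁, fun g => ?_, fun a => ?_, fun a => ?_⟩
  · obtain ⟨w, m, rfl⟩ := hsurj g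
    rw [hs₀]
    refine (map_add (foxOne F x).hom.toLinearMap _ _).trans ?_
    rw [hd1S, hd1D]
    abel
  · have : (foxTwo F x).hom.toLinearMap ∘ₗ s₁ + s₀ ∘ₗ (foxOne F x).hom.toLinearMap =
        LinearMap.id := by
      refine freeElt_lhom_ext fun j g => ?_
      obtain ⟨w, m, rfl⟩ := hsurj g
      rw [LinearMap.add_apply, LinearMap.comp_apply, LinearMap.comp_apply, hd1, LinearMap.id_apply]
      induction j using Fin.cases with
      | zero =>
        rw [hs₁0, hc0, map_sub, hs₀, hs₀, hS, map_zero]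
        abel
      | succ i =>
        rw [hs₁, hc, map_sub, hs₀, hs₀, hD, hd2T]
        abel
    exact DFunLike.congr_fun this a
  · have : s₁ ∘ₗ (foxTwo F x).hom.toLinearMap = LinearMap.id := by
      refine freeElt_lhom_ext fun i g => ?_
      obtain ⟨w, m, rfl⟩ := hsurj g
      rw [LinearMap.comp_apply, hd2, hc0]
      simp only [map_sub, map_add]
      rw [hs₁0, hs₁0, hs₁, hs₁, hT, LinearMap.id_apply]
      abel
    exact DFunLike.congr_fun this a

/-- Index sets for the bases of the free resolution. -/
abbrev FoxIndex (n : ℕ) : ℕ → Type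
  | 0 => Unit
  | 1 => Fin (n + 1)
  | 2 => Fin n
  | _ => Empty

/-- The boundary operators of the free resolution. -/
noncomputable def foxBoundary : ∀ k : ℕ,
    permRep F G (FreeGSet (FoxIndex n (k + 1)) G) ⟶ permRep F G (FreeGSet (FoxIndex n k) G)
  | 0 => foxOne F x
  | 1 => foxTwo F x
  | _ + 2 => 0

/-- The chain complex of the universal cover of the presentation complex of
`⟨x₀, …, xₙ | x₀ xᵢ x₀⁻¹ xᵢ⁻¹⟩`. -/
noncomputable def foxComplex (hcomm : ∀ i : Fin n, Commute (x 0) (x i.succ)) :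
    ChainComplex (Rep.{v} F G) ℕ :=
  ChainComplex.of (fun k => permRep F G (FreeGSet (FoxIndex n k) G)) (foxBoundary F x) fun k =>
    match k with
    | 0 => foxTwo_comp_foxOne F x hcomm
    | _ + 1 => Limits.zero_comp

theorem foxComplex_d (hcomm : ∀ i : Fin n, Commute (x 0) (x i.succ)) (k : ℕ) :
    (foxComplex F x hcomm).d (k + 1) k = foxBoundary F x k :=
  by simp [foxComplex]

theorem foxComplex_d_apply (hcomm : ∀ i : Fin n, Commute (x 0) (x i.succ)) (k : ℕ)
    (c : FreeGSet (FoxIndex n (k + 1)) G →₀ F) :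
    ((foxComplex F x hcomm).d (k + 1) k).hom c = (foxBoundary F x k).hom c :=
  DFunLike.congr_fun (congrArg (fun f => f.hom.toLinearMap) (foxComplex_d F x hcomm k)) c

theorem Rep.exact_of_forall {S : ShortComplex (Rep.{v} F G)}
    (h : ∀ c, S.g.hom c = 0 → ∃ b, S.f.hom b = c) : S.Exact := by
  rw [← ShortComplex.exact_map_iff_of_faithful _ (forget₂ (Rep.{v} F G) (ModuleCat.{v} F)),
    ShortComplex.moduleCat_exact_iff]
  exact h

include hx0 hx in
theorem commute_of_mulEquiv (i : Fin n) : Commute (x 0) (x i.succ) := by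
  refine e.injective ?_
  rw [map_mul, map_mul, hx0, hx]
  exact Prod.ext ((one_mul _).trans (mul_one _).symm) ((mul_one _).trans (one_mul _).symm)

include hx0 hx in
theorem foxComplex_exactAt (hcomm : ∀ i : Fin n, Commute (x 0) (x i.succ)) (k : ℕ) :
    (foxComplex F x hcomm).ExactAt (k + 1) := by
  obtain ⟨s₀, s₁, -, h2, h3⟩ := exists_foxContraction F x e hx0 hx
  rw [HomologicalComplex.exactAt_iff' _ (k + 2) (k + 1) k (by simp) (by simp)]
  match k with
  | 0 =>
    refine Rep.exact_of_forall F fun c hc => ⟨s₁ c, ?_⟩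
    have hc' : (foxOne F x).hom c = 0 := (foxComplex_d_apply F x hcomm 0 c).symm.trans hc
    refine (foxComplex_d_apply F x hcomm 1 (s₁ c)).trans ?_
    have := h2 c
    rw [hc', map_zero, add_zero] at this
    exact this
  | 1 =>
    refine Rep.exact_of_forall F fun c hc => ⟨0, (map_zero _).trans ?_⟩
    have hc' : (foxTwo F x).hom c = 0 := (foxComplex_d_apply F x hcomm 1 c).symm.trans hc
    have := h3 c
    rw [hc', map_zero] at this
    exact this
  | k + 2 =>
    refine Rep.exact_of_forall F fun c hc => ⟨0, (map_zero _).trans ?_⟩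
    change FreeGSet Empty G →₀ F at c
    exact Finsupp.ext fun s => s.orbit.elim

theorem foxComplex_d_comp_foxAugmentation (hcomm : ∀ i : Fin n, Commute (x 0) (x i.succ)) :
    (foxComplex F x hcomm).d 1 0 ≫ foxAugmentation F = 0 := by
  rw [foxComplex_d]
  exact foxOne_comp_foxAugmentation F x

include hx0 hx in
theorem foxAugmentation_exact (hcomm : ∀ i : Fin n, Commute (x 0) (x i.succ)) :
    (ShortComplex.mk _ _ (foxComplex_d_comp_foxAugmentation F x hcomm)).Exact := by
  obtain ⟨s₀, s₁, h1, -, -⟩ := exists_foxContraction F x e hx0 hx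
  refine Rep.exact_of_forall F fun c hc => ⟨s₀ c, ?_⟩
  refine (foxComplex_d_apply F x hcomm 0 (s₀ c)).trans ?_
  have h : (foxOne F x).hom.toLinearMap ∘ₗ s₀ + Finsupp.lsingle ⟨(), 1⟩ ∘ₗ
      Finsupp.lapply PUnit.unit ∘ₗ (foxAugmentation F).hom.toLinearMap = LinearMap.id := by
    refine freeElt_lhom_ext fun j g => ?_
    have h2 : (foxOne F x).hom.toLinearMap (s₀ (freeElt F () g)) = _ := h1 g
    have h3 : (foxAugmentation F).hom.toLinearMap (freeElt F () g) = _ :=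
      foxAugmentation_freeElt F g
    rw [LinearMap.add_apply, LinearMap.comp_apply, LinearMap.comp_apply, LinearMap.comp_apply, h2,
      h3]
    simp
  have h4 : ∀ a : FreeGSet Unit G →₀ F, (foxAugmentation F).hom a = 0 →
      (foxOne F x).hom (s₀ a) = a := fun a ha => by
    have h5 : (foxAugmentation F).hom.toLinearMap a = 0 := ha
    have h6 := DFunLike.congr_fun h a
    rw [LinearMap.add_apply, LinearMap.comp_apply, LinearMap.comp_apply, LinearMap.comp_apply, h5,
      map_zero, map_zero, add_zero] at h6
    exact h6
  exact h4 c hc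

/-- The trivial representation has a free resolution of length two. -/
noncomputable def foxResolution : ProjectiveResolution (permRep F G PUnit.{1}) where
  complex := foxComplex F x (commute_of_mulEquiv x e hx0 hx)
  projective _ := projective_permRep F FreeGSet.free
  π := (ChainComplex.toSingle₀Equiv _ _).symm ⟨foxAugmentation F,
    foxComplex_d_comp_foxAugmentation F x _⟩
  quasiIso := ChainComplex.quasiIso_toSingle₀ _ _ (foxAugmentation_exact F x e hx0 hx _)
    (foxAugmentation_epi F) (foxComplex_exactAt F x e hx0 hx _)

end Contraction

end Fox

/-! ### Base change from the group ring to Laurent polynomials -/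

section TwistedFunctor

variable {F : Type v} [Field F] {G : Type} [Group G] {l : ℕ} (ε : G →* Multiplicative ℤ)
  (ρ : G →* GL (Fin l) F)

/-- The relations which define the tensor product over the group ring of the right module
`F[t,t⁻¹] ⊗ V` with a representation. -/
noncomputable def repRelations (N : Rep.{v} F G) : Submodule F[T;T⁻¹] ((Fin l → F[T;T⁻¹]) ⊗[F] N) :=
  Submodule.span F[T;T⁻¹] {z | ∃ (α : G) (m : Fin l → F[T;T⁻¹]) (c : N),
    z = twistedAct ε ρ α m ⊗ₜ[F] c - m ⊗ₜ[F] N.ρ α c}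

theorem repRelations_le {N M : Rep.{v} F G} (f : N ⟶ M) :
    repRelations ε ρ N ≤ (repRelations ε ρ M).comap
      (TensorProduct.AlgebraTensorModule.lTensor F[T;T⁻¹] (Fin l → F[T;T⁻¹])
        f.hom.toLinearMap) := by
  refine Submodule.span_le.2 ?_
  rintro _ ⟨α, m, c, rfl⟩
  refine Submodule.subset_span ⟨α, m, f.hom c, ?_⟩
  rw [← Rep.hom_comm_apply]
  exact map_sub _ _ _

/-- The tensor product over the group ring of the right module `F[t,t⁻¹] ⊗ V` with a
representation, as a functor. -/
noncomputable def twistedFunctor : Rep.{v} F G ⥤ ModuleCat.{v} F[T;T⁻¹] where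
  obj N := ModuleCat.of _ (((Fin l → F[T;T⁻¹]) ⊗[F] N) ⧸ repRelations ε ρ N)
  map f := ModuleCat.ofHom (Submodule.mapQ _ _ (TensorProduct.AlgebraTensorModule.lTensor F[T;T⁻¹]
    (Fin l → F[T;T⁻¹]) f.hom.toLinearMap) (repRelations_le ε ρ f))
  map_id N := by
    refine ModuleCat.hom_ext (LinearMap.ext fun x => ?_)
    obtain ⟨x, rfl⟩ := Submodule.Quotient.mk_surjective _ x
    refine congrArg (Submodule.Quotient.mk (p := repRelations ε ρ N)) ?_
    exact DFunLike.congr_fun (LinearMap.lTensor_id _ _) x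
  map_comp {N M L} f g := by
    refine ModuleCat.hom_ext (LinearMap.ext fun x => ?_)
    obtain ⟨x, rfl⟩ := Submodule.Quotient.mk_surjective _ x
    refine congrArg (Submodule.Quotient.mk (p := repRelations ε ρ L)) ?_
    exact DFunLike.congr_fun (LinearMap.lTensor_comp _ g.hom.toLinearMap f.hom.toLinearMap) x

instance : (twistedFunctor ε ρ).Additive where
  map_add {N M f g} := by
    refine ModuleCat.hom_ext (LinearMap.ext fun x => ?_)
    obtain ⟨x, rfl⟩ := Submodule.Quotient.mk_surjective _ x
    refine congrArg (Submodule.Quotient.mk (p := repRelations ε ρ M)) ?_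
    exact DFunLike.congr_fun (LinearMap.lTensor_add _ f.hom.toLinearMap g.hom.toLinearMap) x

variable (E : Type) [TopologicalSpace E] [MulAction G E] [ContinuousConstSMul G E]

/-- The twisted chains of a contractible space with a free action can be computed by any
projective resolution of the trivial representation. -/
theorem nonempty_twisted_homotopyEquiv [ContractibleSpace E]
    (hfree : ∀ (α : G) (e : E), α • e = e → α = 1)
    (Q : ProjectiveResolution (permRep F G PUnit.{1})) :
    Nonempty (HomotopyEquiv
      (AlgebraicTopology.AlternatingFaceMapComplex.obj (twistedSimplicialModule E ε ρ))
      (((twistedFunctor ε ρ).mapHomologicalComplex _).obj Q.complex)) := by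
  -- The twisted simplicial module is by definition the image of the singular chains under
  -- `twistedFunctor ε ρ`.
  have h : AlgebraicTopology.AlternatingFaceMapComplex.obj (twistedSimplicialModule E ε ρ) =
      ((twistedFunctor ε ρ).mapHomologicalComplex _).obj (singularComplex E F) :=
    (Functor.congr_obj (AlgebraicTopology.map_alternatingFaceMapComplex (twistedFunctor ε ρ))
      (singularRep E F)).symm
  rw [h]
  exact ⟨(twistedFunctor ε ρ).mapHomotopyEquiv
    ((singularResolution E F hfree).homotopyEquiv Q)⟩

end TwistedFunctor

section FreeCoordinates

variable {F : Type v} [Field F] {G : Type} [Group G] {l : ℕ} (ε : G →* Multiplicative ℤ)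
  (ρ : G →* GL (Fin l) F)

theorem twistedAct_one (m : Fin l → F[T;T⁻¹]) : twistedAct ε ρ 1 m = m := by
  have : twistedMatrix ε ρ 1 = 1 := by
    rw [twistedMatrix, ε.map_one, ρ.map_one, toAdd_one, LaurentPolynomial.T_zero, one_smul,
      Units.val_one, Matrix.map_one _ (map_zero _) (map_one _)]
  rw [twistedAct, this, Matrix.vecMulLinear_apply, Matrix.vecMul_one]

variable (ι : Type) [DecidableEq ι]

/-- The map `m ⊗ g e i ↦ m g` in the coordinate `i`, on the tensor product over `F`. -/
noncomputable def twistedCoordinates :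
    ((Fin l → F[T;T⁻¹]) ⊗[F] (FreeGSet ι G →₀ F)) →ₗ[F[T;T⁻¹]] (ι → Fin l → F[T;T⁻¹]) :=
  TensorProduct.AlgebraTensorModule.lift
    { toFun := fun m => Finsupp.linearCombination F fun s : FreeGSet ι G =>
        (Pi.single s.orbit (twistedAct ε ρ s.elt m) : ι → Fin l → F[T;T⁻¹])
      map_add' := fun m m' => freeElt_lhom_ext fun i g => by
        simp [Finsupp.linearCombination_single, Pi.single_add]
      map_smul' := fun r m => freeElt_lhom_ext fun i g => by
        simp [Finsupp.linearCombination_single, Pi.single_smul] }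

theorem twistedCoordinates_tmul (m : Fin l → F[T;T⁻¹]) (i : ι) (g : G) :
    twistedCoordinates ε ρ ι (m ⊗ₜ freeElt F i g) = Pi.single i (twistedAct ε ρ g m) :=
  (Finsupp.linearCombination_single F _ _).trans (one_smul _ _)

/-- The coordinates are well defined on the tensor product over the group ring. -/
theorem twistedCoordinates_relations :
    repRelations ε ρ (permRep F G (FreeGSet ι G)) ≤ LinearMap.ker (twistedCoordinates ε ρ ι) := by
  refine Submodule.span_le.2 ?_
  rintro _ ⟨α, m, c, rfl⟩
  refine (map_sub _ _ _).trans (sub_eq_zero.2 ?_)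
  have h : ((twistedCoordinates ε ρ ι).restrictScalars F ∘ₗ
      TensorProduct.mk F (Fin l → F[T;T⁻¹]) (FreeGSet ι G →₀ F) (twistedAct ε ρ α m)) =
      ((twistedCoordinates ε ρ ι).restrictScalars F ∘ₗ
      TensorProduct.mk F (Fin l → F[T;T⁻¹]) (FreeGSet ι G →₀ F) m ∘ₗ
        permRepresentation F G (FreeGSet ι G) α) := by
    refine freeElt_lhom_ext fun i g => ?_
    change twistedCoordinates ε ρ ι (_ ⊗ₜ _) =
      twistedCoordinates ε ρ ι (_ ⊗ₜ permRepresentation F G _ α (freeElt F i g))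
    rw [permRepresentation_freeElt, twistedCoordinates_tmul, twistedCoordinates_tmul,
      twistedAct_mul]
  exact DFunLike.congr_fun h c

/-- The class of `m ⊗ c`. -/
noncomputable def twistedMk {N : Rep.{v} F G} (m : Fin l → F[T;T⁻¹]) (c : N) :
    ((Fin l → F[T;T⁻¹]) ⊗[F] N) ⧸ repRelations ε ρ N :=
  Submodule.Quotient.mk (m ⊗ₜ c)

theorem twistedMk_act {N : Rep.{v} F G} (m : Fin l → F[T;T⁻¹]) (α : G) (c : N) :
    twistedMk ε ρ m (N.ρ α c) = twistedMk ε ρ (twistedAct ε ρ α m) c :=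
  ((Submodule.Quotient.eq (repRelations ε ρ N)).2 (Submodule.subset_span ⟨α, m, c, rfl⟩)).symm

theorem twistedMk_sub {N : Rep.{v} F G} (m : Fin l → F[T;T⁻¹]) (c c' : N) :
    twistedMk ε ρ m (c - c') = twistedMk ε ρ m c - twistedMk ε ρ m c' :=
  congrArg (Submodule.Quotient.mk (p := repRelations ε ρ N)) (TensorProduct.tmul_sub _ _ _)

theorem twistedMk_add {N : Rep.{v} F G} (m : Fin l → F[T;T⁻¹]) (c c' : N) :
    twistedMk ε ρ m (c + c') = twistedMk ε ρ m c + twistedMk ε ρ m c' :=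
  congrArg (Submodule.Quotient.mk (p := repRelations ε ρ N)) (TensorProduct.tmul_add _ _ _)

/-- The class of `m ⊗ c`, for a chain `c` of a free module. -/
noncomputable def twistedFreeMk {ι : Type} (m : Fin l → F[T;T⁻¹]) (c : FreeGSet ι G →₀ F) :
    ((Fin l → F[T;T⁻¹]) ⊗[F] (FreeGSet ι G →₀ F)) ⧸
      repRelations ε ρ (permRep F G (FreeGSet ι G)) :=
  twistedMk ε ρ (N := permRep F G (FreeGSet ι G)) m c

/-- The map `v ↦ ∑ i, v i ⊗ e i`. -/
noncomputable def ofTwistedCoordinates [Fintype ι] : (ι → Fin l → F[T;T⁻¹]) →ₗ[F[T;T⁻¹]]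
    (((Fin l → F[T;T⁻¹]) ⊗[F] (FreeGSet ι G →₀ F)) ⧸
      repRelations ε ρ (permRep F G (FreeGSet ι G))) :=
  LinearMap.lsum F[T;T⁻¹] (fun _ : ι => Fin l → F[T;T⁻¹]) ℕ fun i =>
    (repRelations ε ρ (permRep F G (FreeGSet ι G))).mkQ ∘ₗ
      (TensorProduct.AlgebraTensorModule.mk F F[T;T⁻¹] (Fin l → F[T;T⁻¹])
        (FreeGSet ι G →₀ F)).flip (freeElt F i 1)

theorem ofTwistedCoordinates_single [Fintype ι] (i : ι) (m : Fin l → F[T;T⁻¹]) :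
    ofTwistedCoordinates ε ρ ι (Pi.single i m) = twistedFreeMk ε ρ m (freeElt F i (1 : G)) :=
  LinearMap.lsum_piSingle _ _ _ _ _ _

/-- The tensor product of `F[t,t⁻¹] ⊗ V` with a free module is a sum of copies of
`F[t,t⁻¹] ⊗ V`. -/
noncomputable def twistedFreeEquiv [Fintype ι] :
    (((Fin l → F[T;T⁻¹]) ⊗[F] (FreeGSet ι G →₀ F)) ⧸
      repRelations ε ρ (permRep F G (FreeGSet ι G))) ≃ₗ[F[T;T⁻¹]] (ι → Fin l → F[T;T⁻¹]) :=
  LinearEquiv.ofLinearMap (Submodule.liftQ _ _ (twistedCoordinates_relations ε ρ ι))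
    (ofTwistedCoordinates ε ρ ι)
    (by
      refine LinearMap.pi_ext fun i m => ?_
      rw [LinearMap.comp_apply, ofTwistedCoordinates_single]
      refine (twistedCoordinates_tmul ε ρ ι m i 1).trans ?_
      rw [twistedAct_one, LinearMap.id_apply])
    (by
      refine Submodule.linearMap_qext _ (TensorProduct.AlgebraTensorModule.ext fun m c => ?_)
      have h : (ofTwistedCoordinates ε ρ ι ∘ₗ twistedCoordinates ε ρ ι).restrictScalars F ∘ₗ
          TensorProduct.mk F (Fin l → F[T;T⁻¹]) (FreeGSet ι G →₀ F) m =
          (repRelations ε ρ (permRep F G (FreeGSet ι G))).mkQ.restrictScalars F ∘ₗ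
            TensorProduct.mk F (Fin l → F[T;T⁻¹]) (FreeGSet ι G →₀ F) m := by
        refine freeElt_lhom_ext fun i g => ?_
        change ofTwistedCoordinates ε ρ ι (twistedCoordinates ε ρ ι (_ ⊗ₜ _)) =
          twistedFreeMk ε ρ m (freeElt F i g)
        rw [twistedCoordinates_tmul, ofTwistedCoordinates_single]
        refine (twistedMk_act ε ρ (N := permRep F G (FreeGSet ι G)) m g _).symm.trans ?_
        refine congrArg (twistedFreeMk ε ρ m) ((permRepresentation_freeElt F g 1 i).trans ?_)
        rw [mul_one]
      exact DFunLike.congr_fun h c)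

theorem twistedFreeEquiv_twistedFreeMk [Fintype ι] (m : Fin l → F[T;T⁻¹]) (i : ι) (g : G) :
    twistedFreeEquiv ε ρ ι (twistedFreeMk ε ρ m (freeElt F i g)) =
      Pi.single i (twistedAct ε ρ g m) :=
  twistedCoordinates_tmul ε ρ ι m i g

theorem twistedFreeEquiv_symm_single [Fintype ι] (m : Fin l → F[T;T⁻¹]) (i : ι) :
    (twistedFreeEquiv ε ρ ι).symm (Pi.single i m) = twistedFreeMk ε ρ m (freeElt F i (1 : G)) :=
  ofTwistedCoordinates_single ε ρ ι i m

end FreeCoordinates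

/-! ### The homology of the twisted Fox complex -/

section Homology

/-- A surjection from the cycles whose kernel consists of the boundaries computes the homology. -/
theorem ModuleCat.nonempty_homology_equiv {R : Type v} [CommRing R]
    (S : ShortComplex (ModuleCat.{v} R))
    {M : Type*} [AddCommGroup M] [Module R M] (π : LinearMap.ker S.g.hom →ₗ[R] M)
    (hπ : Function.Surjective π) (hker : ∀ z, π z = 0 ↔ ∃ y, S.f y = z.1) :
    Nonempty (S.homology ≃ₗ[R] M) := by
  have h : LinearMap.range S.moduleCatToCycles = LinearMap.ker π := by
    ext z
    rw [LinearMap.mem_ker, hker]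
    exact exists_congr fun y => Subtype.ext_iff
  exact ⟨S.moduleCatHomologyIso.toLinearEquiv.trans ((Submodule.quotEquivOfEq _ _ h).trans
    (π.quotKerEquivOfSurjective hπ))⟩

end Homology

section Boundaries

variable {F : Type v} [Field F] {G : Type} [Group G] {l : ℕ} (ε : G →* Multiplicative ℤ)
  (ρ : G →* GL (Fin l) F) {n : ℕ} (x : Fin (n + 1) → G)

theorem alexanderBlock_vecMul (α : G) (m : Fin l → F[T;T⁻¹]) :
    Matrix.vecMul m (alexanderBlock ε ρ α) = twistedAct ε ρ α m - m := by
  rw [alexanderBlock, Matrix.vecMul_sub, Matrix.vecMul_one]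
  rfl

/-- The boundary operator in degree one, `w ↦ ∑ w j A j`. -/
noncomputable def alexanderOne {R : Type*} [CommRing R]
    (A : Fin (n + 1) → Matrix (Fin l) (Fin l) R) :
    (Fin (n + 1) → Fin l → R) →ₗ[R] (Fin l → R) :=
  LinearMap.lsum R (fun _ => Fin l → R) ℕ fun j => Matrix.vecMulLinear (A j)

theorem alexanderOne_apply {R : Type*} [CommRing R] (A : Fin (n + 1) → Matrix (Fin l) (Fin l) R)
    (w : Fin (n + 1) → Fin l → R) :
    alexanderOne A w = ∑ j, Matrix.vecMul (w j) (A j) := by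
  simp [alexanderOne]

/-- The boundary operator in degree two, which takes the `i`-th row vector `w` to the vector with
the coordinates `-w A (i + 1)` at `0` and `w A 0` at `i + 1`. -/
noncomputable def alexanderTwo {R : Type*} [CommRing R]
    (A : Fin (n + 1) → Matrix (Fin l) (Fin l) R) :
    (Fin n → Fin l → R) →ₗ[R] (Fin (n + 1) → Fin l → R) :=
  LinearMap.pi (Fin.cases (- LinearMap.lsum R (fun _ => Fin l → R) ℕ fun i =>
    Matrix.vecMulLinear (A i.succ)) fun i => Matrix.vecMulLinear (A 0) ∘ₗ LinearMap.proj i)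

theorem alexanderTwo_zero {R : Type*} [CommRing R] (A : Fin (n + 1) → Matrix (Fin l) (Fin l) R)
    (w : Fin n → Fin l → R) :
    alexanderTwo A w 0 = - ∑ i, Matrix.vecMul (w i) (A i.succ) := by
  simp [alexanderTwo]

theorem alexanderTwo_succ {R : Type*} [CommRing R] (A : Fin (n + 1) → Matrix (Fin l) (Fin l) R)
    (w : Fin n → Fin l → R) (i : Fin n) :
    alexanderTwo A w i.succ = Matrix.vecMul (w i) (A 0) := by
  simp [alexanderTwo]

/-- In coordinates, the first boundary operator becomes `alexanderOne`. -/
theorem twistedFreeEquiv_foxOne (w : Fin (n + 1) → Fin l → F[T;T⁻¹]) :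
    twistedFreeEquiv ε ρ Unit (((twistedFunctor ε ρ).map (foxOne F x)).hom
      ((twistedFreeEquiv ε ρ (Fin (n + 1))).symm w)) = fun _ =>
      alexanderOne (fun j => alexanderBlock ε ρ (x j)) w := by
  have h : (twistedFreeEquiv ε ρ Unit).toLinearMap ∘ₗ ((twistedFunctor ε ρ).map (foxOne F x)).hom ∘ₗ
      (twistedFreeEquiv ε ρ (Fin (n + 1))).symm.toLinearMap = LinearMap.pi fun _ =>
      alexanderOne (fun j => alexanderBlock ε ρ (x j)) := by
    refine LinearMap.pi_ext fun i m => funext fun _ => ?_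
    have h1 : ((twistedFunctor ε ρ).map (foxOne F x)).hom
      (twistedFreeMk ε ρ m (freeElt F i (1 : G))) =
        twistedFreeMk ε ρ m (freeElt F () (x i)) - twistedFreeMk ε ρ m (freeElt F () 1) := by
      refine (congrArg (twistedFreeMk ε ρ m) (foxOne_freeElt F x i 1)).trans ?_
      rw [one_mul]
      exact twistedMk_sub ε ρ (N := permRep F G (FreeGSet Unit G)) m _ _
    refine (congrFun (congrArg (fun c => twistedFreeEquiv ε ρ Unit (((twistedFunctor ε ρ).map
      (foxOne F x)).hom c)) (twistedFreeEquiv_symm_single ε ρ (Fin (n + 1)) m i)) _).trans ?_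
    refine (congrFun (congrArg (twistedFreeEquiv ε ρ Unit) h1) _).trans ?_
    rw [map_sub, twistedFreeEquiv_twistedFreeMk, twistedFreeEquiv_twistedFreeMk, twistedAct_one,
      LinearMap.pi_apply, alexanderOne, LinearMap.lsum_piSingle, Matrix.vecMulLinear_apply,
      alexanderBlock_vecMul]
    simp
  exact DFunLike.congr_fun h w

/-- In coordinates, the second boundary operator becomes `alexanderTwo`. -/
theorem twistedFreeEquiv_foxTwo (w : Fin n → Fin l → F[T;T⁻¹]) :
    twistedFreeEquiv ε ρ (Fin (n + 1)) (((twistedFunctor ε ρ).map (foxTwo F x)).hom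
      ((twistedFreeEquiv ε ρ (Fin n)).symm w)) =
      alexanderTwo (fun j => alexanderBlock ε ρ (x j)) w := by
  have h : (twistedFreeEquiv ε ρ (Fin (n + 1))).toLinearMap ∘ₗ
      ((twistedFunctor ε ρ).map (foxTwo F x)).hom ∘ₗ
      (twistedFreeEquiv ε ρ (Fin n)).symm.toLinearMap =
      alexanderTwo (fun j => alexanderBlock ε ρ (x j)) := by
    refine LinearMap.pi_ext fun i m => ?_
    have h1 : ((twistedFunctor ε ρ).map (foxTwo F x)).hom
      (twistedFreeMk ε ρ m (freeElt F i (1 : G))) =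
        (twistedFreeMk ε ρ m (freeElt F 0 1) - twistedFreeMk ε ρ m (freeElt F 0 (x i.succ)) +
          twistedFreeMk ε ρ m (freeElt F i.succ (x 0)) -
            twistedFreeMk ε ρ m (freeElt F i.succ 1) :) := by
      refine (congrArg (twistedFreeMk ε ρ m) (foxTwo_freeElt F x i 1)).trans ?_
      rw [one_mul, one_mul]
      refine (twistedMk_sub ε ρ (N := permRep F G (FreeGSet (Fin (n + 1)) G)) m _ _).trans ?_
      refine congrArg (· - _) ?_
      refine (twistedMk_add ε ρ (N := permRep F G (FreeGSet (Fin (n + 1)) G)) m _ _).trans ?_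
      refine congrArg (· + _) ?_
      exact twistedMk_sub ε ρ (N := permRep F G (FreeGSet (Fin (n + 1)) G)) m _ _
    refine (congrArg (fun c => twistedFreeEquiv ε ρ (Fin (n + 1)) (((twistedFunctor ε ρ).map
      (foxTwo F x)).hom c)) (twistedFreeEquiv_symm_single ε ρ (Fin n) m i)).trans ?_
    refine (congrArg (twistedFreeEquiv ε ρ (Fin (n + 1))) h1).trans ?_
    rw [map_sub, map_add, map_sub, twistedFreeEquiv_twistedFreeMk, twistedFreeEquiv_twistedFreeMk,
      twistedFreeEquiv_twistedFreeMk, twistedFreeEquiv_twistedFreeMk, twistedAct_one]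
    refine funext fun j => ?_
    induction j using Fin.cases with
    | zero =>
      rw [alexanderTwo_zero, Finset.sum_eq_single i _ (by simp)]
      · rw [Pi.single_eq_same, alexanderBlock_vecMul]
        simp
      · intro k _ hk
        rw [Pi.single_eq_of_ne hk, Matrix.zero_vecMul]
    | succ j =>
      rw [alexanderTwo_succ]
      by_cases h : j = i
      · subst h
        simp [alexanderBlock_vecMul]
      · simp [Pi.single_eq_of_ne h, Pi.single_eq_of_ne ((Fin.succ_injective n).ne h)]
  exact DFunLike.congr_fun h w

/-- The complex of the free resolution, after base change. -/
noncomputable abbrev twistedFoxComplex (hcomm : ∀ i : Fin n, Commute (x 0) (x i.succ)) :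
    ChainComplex (ModuleCat.{v} F[T;T⁻¹]) ℕ :=
  ((twistedFunctor ε ρ).mapHomologicalComplex _).obj (foxComplex F x hcomm)

theorem twistedFoxComplex_d (hcomm : ∀ i : Fin n, Commute (x 0) (x i.succ)) (k : ℕ) :
    (twistedFoxComplex ε ρ x hcomm).d (k + 1) k = (twistedFunctor ε ρ).map (foxBoundary F x k) :=
  congrArg (twistedFunctor ε ρ).map (foxComplex_d F x hcomm k)

theorem twistedFoxComplex_d_one (hcomm : ∀ i : Fin n, Commute (x 0) (x i.succ))
    (w : Fin (n + 1) → Fin l → F[T;T⁻¹]) :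
    ((twistedFoxComplex ε ρ x hcomm).d 1 0).hom ((twistedFreeEquiv ε ρ (Fin (n + 1))).symm w) =
      (twistedFreeEquiv ε ρ Unit).symm fun _ =>
        alexanderOne (fun j => alexanderBlock ε ρ (x j)) w := by
  refine (DFunLike.congr_fun (congrArg ModuleCat.Hom.hom (twistedFoxComplex_d ε ρ x hcomm 0))
    ((twistedFreeEquiv ε ρ (Fin (n + 1))).symm w)).trans ?_
  exact (LinearEquiv.eq_symm_apply _).2 (twistedFreeEquiv_foxOne ε ρ x w)

theorem twistedFoxComplex_d_two (hcomm : ∀ i : Fin n, Commute (x 0) (x i.succ))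
    (w : Fin n → Fin l → F[T;T⁻¹]) :
    ((twistedFoxComplex ε ρ x hcomm).d 2 1).hom ((twistedFreeEquiv ε ρ (Fin n)).symm w) =
      (twistedFreeEquiv ε ρ (Fin (n + 1))).symm
        (alexanderTwo (fun j => alexanderBlock ε ρ (x j)) w) := by
  refine (DFunLike.congr_fun (congrArg ModuleCat.Hom.hom (twistedFoxComplex_d ε ρ x hcomm 1))
    ((twistedFreeEquiv ε ρ (Fin n)).symm w)).trans ?_
  exact (LinearEquiv.eq_symm_apply _).2 (twistedFreeEquiv_foxTwo ε ρ x w)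

/-- The homology in degree zero is the cokernel of the boundary operator. -/
theorem nonempty_twistedFox_homology_zero (hcomm : ∀ i : Fin n, Commute (x 0) (x i.succ)) :
    Nonempty ((twistedFoxComplex ε ρ x hcomm).homology 0 ≃ₗ[F[T;T⁻¹]]
      (Fin l → F[T;T⁻¹]) ⧸ LinearMap.range (alexanderOne fun j => alexanderBlock ε ρ (x j))) := by
  have hd : (twistedFoxComplex ε ρ x hcomm).d 0 0 = 0 :=
    (twistedFoxComplex ε ρ x hcomm).shape 0 0 (by simp)
  obtain ⟨e⟩ := ModuleCat.nonempty_homology_equiv ((twistedFoxComplex ε ρ x hcomm).sc' 1 0 0)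
    (M := (Fin l → F[T;T⁻¹]) ⧸ LinearMap.range (alexanderOne fun j => alexanderBlock ε ρ (x j)))
    (Submodule.mkQ _ ∘ₗ LinearMap.proj () ∘ₗ (twistedFreeEquiv ε ρ Unit).toLinearMap ∘ₗ
      (LinearMap.ker ((twistedFoxComplex ε ρ x hcomm).d 0 0).hom).subtype)
    (fun y => by
      obtain ⟨w, rfl⟩ := Submodule.mkQ_surjective _ y
      refine ⟨⟨(twistedFreeEquiv ε ρ Unit).symm fun _ => w, ?_⟩, ?_⟩
      · exact DFunLike.congr_fun (congrArg ModuleCat.Hom.hom hd) _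
      · refine congrArg (Submodule.mkQ _) ?_
        exact congrFun ((twistedFreeEquiv ε ρ Unit).apply_symm_apply fun _ => w) ())
    (fun z => by
      refine (Submodule.Quotient.mk_eq_zero _).trans ?_
      constructor
      · rintro ⟨w, hw⟩
        refine ⟨(twistedFreeEquiv ε ρ (Fin (n + 1))).symm w, ?_⟩
        refine (twistedFoxComplex_d_one ε ρ x hcomm w).trans ?_
        refine (LinearEquiv.symm_apply_eq _).2 (funext fun _ => hw)
      · rintro ⟨y, hy⟩
        obtain ⟨w, rfl⟩ := (twistedFreeEquiv ε ρ (Fin (n + 1))).symm.surjective y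
        refine ⟨w, ?_⟩
        have h := (twistedFoxComplex_d_one ε ρ x hcomm w).symm.trans hy
        exact congrFun ((LinearEquiv.symm_apply_eq _).1 h) ())
  exact ⟨(ShortComplex.homologyMapIso ((twistedFoxComplex ε ρ x hcomm).isoSc' 1 0 0 (by simp)
    (by simp))).toLinearEquiv.trans e⟩

/-- The homology in degree one, as any quotient of the cycles by the boundaries. -/
theorem nonempty_twistedFox_homology_one (hcomm : ∀ i : Fin n, Commute (x 0) (x i.succ))
    {M : Type*} [AddCommGroup M] [Module F[T;T⁻¹] M]
    (π : LinearMap.ker (alexanderOne fun j => alexanderBlock ε ρ (x j)) →ₗ[F[T;T⁻¹]] M)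
    (hπ : Function.Surjective π)
    (hker : ∀ z, π z = 0 ↔ ∃ w, alexanderTwo (fun j => alexanderBlock ε ρ (x j)) w = z.1) :
    Nonempty ((twistedFoxComplex ε ρ x hcomm).homology 1 ≃ₗ[F[T;T⁻¹]] M) := by
  have h : ∀ w, alexanderOne (fun j => alexanderBlock ε ρ (x j)) w = 0 ↔
      ((twistedFoxComplex ε ρ x hcomm).d 1 0).hom
        ((twistedFreeEquiv ε ρ (Fin (n + 1))).symm w) = 0 := fun w => by
    have h1 := twistedFoxComplex_d_one ε ρ x hcomm w
    constructor
    · intro hw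
      refine h1.trans ?_
      rw [hw]
      exact map_zero (twistedFreeEquiv ε ρ Unit).symm
    · intro hw
      have h2 := (LinearEquiv.symm_apply_eq _).1 (h1.symm.trans hw)
      exact (congrFun h2 ()).trans (congrFun (map_zero (twistedFreeEquiv ε ρ Unit)) ())
  let θ : LinearMap.ker ((twistedFoxComplex ε ρ x hcomm).d 1 0).hom →ₗ[F[T;T⁻¹]]
      LinearMap.ker (alexanderOne fun j => alexanderBlock ε ρ (x j)) :=
    LinearMap.codRestrict _ ((twistedFreeEquiv ε ρ (Fin (n + 1))).toLinearMap ∘ₗ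
      (LinearMap.ker ((twistedFoxComplex ε ρ x hcomm).d 1 0).hom).subtype) fun z => by
        refine (h _).2 ?_
        refine Eq.trans (congrArg _ ?_) z.2
        exact (twistedFreeEquiv ε ρ (Fin (n + 1))).symm_apply_apply z.1
  obtain ⟨e⟩ := ModuleCat.nonempty_homology_equiv ((twistedFoxComplex ε ρ x hcomm).sc' 2 1 0)
    (M := M) (π ∘ₗ θ)
    (fun y => by
      obtain ⟨w, rfl⟩ := hπ y
      refine ⟨⟨(twistedFreeEquiv ε ρ (Fin (n + 1))).symm w.1, (h _).1 w.2⟩, congrArg π ?_⟩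
      exact Subtype.ext ((twistedFreeEquiv ε ρ (Fin (n + 1))).apply_symm_apply w.1))
    (fun z => by
      refine (hker (θ z)).trans ?_
      constructor
      · rintro ⟨w, hw⟩
        refine ⟨(twistedFreeEquiv ε ρ (Fin n)).symm w, ?_⟩
        exact (twistedFoxComplex_d_two ε ρ x hcomm w).trans ((LinearEquiv.symm_apply_eq _).2 hw)
      · rintro ⟨y, hy⟩
        obtain ⟨w, rfl⟩ := (twistedFreeEquiv ε ρ (Fin n)).symm.surjective y
        refine ⟨w, ?_⟩
        have h := (twistedFoxComplex_d_two ε ρ x hcomm w).symm.trans hy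
        exact (LinearEquiv.symm_apply_eq (twistedFreeEquiv ε ρ (Fin (n + 1)))).1 h)
  exact ⟨(ShortComplex.homologyMapIso ((twistedFoxComplex ε ρ x hcomm).isoSc' 2 1 0 (by simp)
    (by simp))).toLinearEquiv.trans e⟩

/-- The homology vanishes in degrees at least two if the second boundary operator is injective. -/
theorem subsingleton_twistedFox_homology (hcomm : ∀ i : Fin n, Commute (x 0) (x i.succ))
    (h : Function.Injective (alexanderTwo fun j => alexanderBlock ε ρ (x j))) (k : ℕ) :
    Subsingleton ((twistedFoxComplex ε ρ x hcomm).homology (k + 2)) := by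
  have hz : ∀ z : (twistedFoxComplex ε ρ x hcomm).X (k + 2),
      ((twistedFoxComplex ε ρ x hcomm).d (k + 2) (k + 1)).hom z = 0 → z = 0 := by
    cases k with
    | zero =>
      intro z hz
      obtain ⟨w, rfl⟩ := (twistedFreeEquiv ε ρ (Fin n)).symm.surjective z
      have h1 := (LinearEquiv.symm_apply_eq (twistedFreeEquiv ε ρ (Fin (n + 1)))).1
        ((twistedFoxComplex_d_two ε ρ x hcomm w).symm.trans hz)
      have h2 : w = 0 := h ((h1.trans (map_zero _)).trans (map_zero _).symm)
      rw [h2]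
      exact map_zero (twistedFreeEquiv ε ρ (Fin n)).symm
    | succ k =>
      intro z _
      exact (twistedFreeEquiv (G := G) ε ρ Empty).injective (Subsingleton.elim _ _)
  obtain ⟨e⟩ := ModuleCat.nonempty_homology_equiv
    ((twistedFoxComplex ε ρ x hcomm).sc' (k + 3) (k + 2) (k + 1)) (M := PUnit.{1})
    0 (fun y => ⟨0, Subsingleton.elim _ _⟩)
    (fun z => iff_of_true (Subsingleton.elim _ _) ⟨0, (map_zero _).trans (hz z.1 z.2).symm⟩)
  exact ((ShortComplex.homologyMapIso ((twistedFoxComplex ε ρ x hcomm).isoSc' (k + 3) (k + 2)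
    (k + 1) (by simp) (by simp))).toLinearEquiv.trans e).toEquiv.subsingleton

end Boundaries

/-! ### Square presentation matrices and orders -/

section Presentation

variable {R : Type*} [CommRing R] {ι κ : Type*} [Fintype ι] [Fintype κ] [DecidableEq ι]
  [DecidableEq κ] {M M' M'' : Type*} [AddCommGroup M] [AddCommGroup M'] [AddCommGroup M'']
  [Module R M] [Module R M'] [Module R M'']

/-- The module `M` is the cokernel of the square matrix `A`, acting on row vectors. -/
def IsPresentedBy (M : Type*) [AddCommGroup M] [Module R M] (A : Matrix ι ι R) : Prop :=
  ∃ π : (ι → R) →ₗ[R] M, Function.Surjective π ∧ ∀ v, π v = 0 ↔ ∃ w, Matrix.vecMul w A = v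

omit [DecidableEq ι] in
theorem IsPresentedBy.of_equiv {A : Matrix ι ι R} (h : IsPresentedBy M A) (e : M ≃ₗ[R] M') :
    IsPresentedBy M' A := by
  obtain ⟨π, h1, h2⟩ := h
  refine ⟨e.toLinearMap ∘ₗ π, e.surjective.comp h1, fun v => ?_⟩
  rw [← h2]
  exact e.map_eq_zero_iff

omit [DecidableEq ι] in
theorem isPresentedBy_quotient (A : Matrix ι ι R) (N : Submodule R (ι → R))
    (hN : N = LinearMap.range A.vecMulLinear) : IsPresentedBy ((ι → R) ⧸ N) A := by
  subst hN
  exact ⟨Submodule.mkQ _, Submodule.mkQ_surjective _, fun v => Submodule.Quotient.mk_eq_zero _⟩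

omit [DecidableEq ι] [Fintype ι] in
/-- Linear maps between free modules lift along presentations. -/
theorem exists_vecMul_lift (π : (ι → R) →ₗ[R] M) (hπ : Function.Surjective π)
    (f : (κ → R) →ₗ[R] M) :
    ∃ C : Matrix κ ι R, ∀ w, π (Matrix.vecMul w C) = f w := by
  obtain ⟨h, hh⟩ := Module.projective_lifting_property π f hπ
  refine ⟨LinearMap.toMatrixRight' h, fun w => ?_⟩
  rw [← hh]
  refine congrArg π ?_
  rw [← Matrix.toLinearMapRight'_apply]
  exact DFunLike.congr_fun (LinearMap.toMatrixRight'.symm_apply_apply h) w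

theorem det_dvd_of_forall_mem {A B : Matrix ι ι R}
    (h : ∀ w, ∃ w', Matrix.vecMul w' B = Matrix.vecMul w A) : B.det ∣ A.det := by
  choose U hU using fun i => h (Pi.single i 1)
  have : Matrix.of U * B = A := by
    refine Matrix.ext fun i j => ?_
    have := congrFun (hU i) j
    rw [Matrix.single_one_vecMul] at this
    exact this
  rw [← this, Matrix.det_mul]
  exact dvd_mul_left _ _

/-- Fitting ideals increase under surjections: a presentation matrix of a quotient of `M` has a
determinant which divides that of a presentation matrix of `M`. -/
theorem IsPresentedBy.det_dvd {A : Matrix ι ι R} {B : Matrix κ κ R} (hA : IsPresentedBy M A)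
    (hB : IsPresentedBy M' B) (g : M →ₗ[R] M') (hg : Function.Surjective g) : B.det ∣ A.det := by
  obtain ⟨π, hπ, hA⟩ := hA
  obtain ⟨π', hπ', hB⟩ := hB
  obtain ⟨C, hC⟩ := exists_vecMul_lift (g ∘ₗ π) (hg.comp hπ) π'
  obtain ⟨D, hD⟩ := exists_vecMul_lift π' hπ' (g ∘ₗ π)
  -- The rows of both block matrices are relations between the generators `g (π i)` and `π' k`
  -- of `M'`, and the rows of the second one span these relations.
  have hX : (Matrix.fromBlocks A 0 (-C) 1).det = A.det := by
    rw [Matrix.det_fromBlocks_zero₁₂, Matrix.det_one, mul_one]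
  have hY : (Matrix.fromBlocks 1 (-D) 0 B).det = B.det := by
    rw [Matrix.det_fromBlocks_zero₂₁, Matrix.det_one, one_mul]
  rw [← hX, ← hY]
  refine det_dvd_of_forall_mem fun w => ?_
  obtain ⟨x, y, rfl⟩ : ∃ x y, w = Sum.elim x y := ⟨_, _, (Sum.elim_comp_inl_inr w).symm⟩
  have h1 : π' (y + Matrix.vecMul (Matrix.vecMul x A - Matrix.vecMul y C) D) = 0 := by
    have h3 : π (Matrix.vecMul x A) = 0 := (hA _).2 ⟨x, rfl⟩
    have h4 := hC y
    rw [LinearMap.comp_apply] at h4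
    rw [map_add, hD, LinearMap.comp_apply, map_sub, h3, map_sub, h4, map_zero]
    abel
  obtain ⟨z, hz⟩ := (hB _).1 h1
  refine ⟨Sum.elim (Matrix.vecMul x A - Matrix.vecMul y C) z, ?_⟩
  simp only [Matrix.vecMul_fromBlocks, Sum.elim_comp_inl, Sum.elim_comp_inr, Matrix.vecMul_zero,
    Matrix.vecMul_one, Matrix.vecMul_neg, hz]
  congr 1
  · abel
  · abel

/-- The determinant of a square presentation matrix depends only on the module. -/
theorem IsPresentedBy.associated_det [IsDomain R] {A : Matrix ι ι R} {B : Matrix κ κ R}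
    (hA : IsPresentedBy M A) (hB : IsPresentedBy M B) : Associated A.det B.det :=
  associated_of_dvd_dvd (hB.det_dvd hA LinearMap.id Function.surjective_id)
    (hA.det_dvd hB LinearMap.id Function.surjective_id)

omit [DecidableEq ι] in
/-- The extension of a module presented by `B` by one presented by `A` has a block triangular
presentation matrix, with determinant `det A * det B`. -/
theorem IsPresentedBy.extension {A : Matrix ι ι R} {B : Matrix κ κ R} (hA : IsPresentedBy M' A)
    (hB : IsPresentedBy M'' B) (f : M' →ₗ[R] M) (g : M →ₗ[R] M'') (hf : Function.Injective f)
    (hg : Function.Surjective g) (hfg : ∀ m, g m = 0 ↔ ∃ m', f m' = m) :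
    ∃ C, IsPresentedBy M (Matrix.fromBlocks A 0 C B) := by
  obtain ⟨p, hp, hA⟩ := hA
  obtain ⟨q, hq, hB⟩ := hB
  obtain ⟨q', hq'⟩ := Module.projective_lifting_property g q hg
  have hq'' : ∀ y, g (q' y) = q y := fun y => DFunLike.congr_fun hq' y
  let h : (κ → R) →ₗ[R] LinearMap.range f := LinearMap.codRestrict _ (q' ∘ₗ B.vecMulLinear)
    fun y => (hfg _).1 (by
      rw [LinearMap.comp_apply, hq'']
      exact (hB _).2 ⟨y, rfl⟩)
  obtain ⟨C, hC⟩ := exists_vecMul_lift (f.rangeRestrict ∘ₗ p)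
    (f.surjective_rangeRestrict.comp hp) h
  have hC' : ∀ y, f (p (Matrix.vecMul y C)) = q' (Matrix.vecMul y B) := fun y =>
    congrArg Subtype.val (hC y)
  refine ⟨-C, f ∘ₗ p ∘ₗ LinearMap.funLeft R R Sum.inl + q' ∘ₗ LinearMap.funLeft R R Sum.inr,
    fun m => ?_, fun v => ?_⟩
  · obtain ⟨y, hy⟩ := hq (g m)
    obtain ⟨m', hm'⟩ := (hfg (m - q' y)).1 (by rw [map_sub, hq'', hy, sub_self])
    obtain ⟨x, rfl⟩ := hp m'
    refine ⟨Sum.elim x y, ?_⟩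
    change f (p x) + q' y = m
    rw [hm', sub_add_cancel]
  · obtain ⟨x, y, rfl⟩ : ∃ x y, v = Sum.elim x y := ⟨_, _, (Sum.elim_comp_inl_inr v).symm⟩
    change f (p x) + q' y = 0 ↔ _
    constructor
    · intro hv
      have h1 : q y = 0 := by
        have := congrArg g hv
        rwa [map_add, (hfg _).2 ⟨_, rfl⟩, zero_add, hq'', map_zero] at this
      obtain ⟨z, rfl⟩ := (hB _).1 h1
      have h2 : p (x + Matrix.vecMul z C) = 0 := hf (by rw [map_add, map_add, hC', hv, map_zero])
      obtain ⟨w, hw⟩ := (hA _).1 h2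
      refine ⟨Sum.elim w z, ?_⟩
      simp [Matrix.vecMul_fromBlocks, hw, Matrix.vecMul_neg]
    · rintro ⟨w, hw⟩
      obtain ⟨a, b, rfl⟩ : ∃ a b, w = Sum.elim a b := ⟨_, _, (Sum.elim_comp_inl_inr w).symm⟩
      rw [Matrix.vecMul_fromBlocks] at hw
      have hx := congrArg (· ∘ Sum.inl) hw
      have hy := congrArg (· ∘ Sum.inr) hw
      simp only [Sum.elim_comp_inl, Sum.elim_comp_inr, Matrix.vecMul_zero, Matrix.vecMul_neg,
        zero_add] at hx hy
      have h3 : p (Matrix.vecMul a A) = 0 := (hA _).2 ⟨a, rfl⟩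
      rw [← hx, ← hy, map_add, map_add, h3, map_zero, zero_add, map_neg, map_neg, hC',
        neg_add_cancel]

omit [DecidableEq ι] in
/-- A power of `M` is presented by copies of the presentation matrix of `M`. -/
theorem IsPresentedBy.pi {A : Matrix ι ι R} (hA : IsPresentedBy M A) :
    IsPresentedBy (κ → M) (Matrix.blockDiagonal fun _ : κ => A) := by
  obtain ⟨π, hπ, hA⟩ := hA
  refine ⟨LinearMap.pi fun k => π ∘ₗ LinearMap.funLeft R R fun i => (i, k), fun m => ?_,
    fun v => ?_⟩
  · choose x hx using fun k => hπ (m k)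
    exact ⟨fun s => x s.2 s.1, funext hx⟩
  · have h1 : ∀ (w : ι × κ → R) (i k),
        Matrix.vecMul w (Matrix.blockDiagonal fun _ : κ => A) (i, k) =
        Matrix.vecMul (fun j => w (j, k)) A i := fun w i k => by
      simp [Matrix.vecMul, dotProduct, Fintype.sum_prod_type, Matrix.blockDiagonal_apply]
    constructor
    · intro hv
      choose w hw using fun k => (hA _).1 (congrFun hv k)
      refine ⟨fun s => w s.2 s.1, funext fun s => ?_⟩
      refine (h1 _ s.1 s.2).trans ?_
      exact congrFun (hw s.2) s.1
    · rintro ⟨w, rfl⟩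
      exact funext fun k => (hA _).2 ⟨fun j => w (j, k), funext fun i => (h1 w i k).symm⟩

theorem det_blockDiagonal_const (A : Matrix ι ι R) :
    (Matrix.blockDiagonal fun _ : κ => A).det = A.det ^ Fintype.card κ := by
  rw [Matrix.det_blockDiagonal, Finset.prod_const, Finset.card_univ]

/-- An order is the determinant of a square presentation matrix. -/
theorem IsModuleOrder.exists_isPresentedBy {p : R} (h : IsModuleOrder R M p) [IsDomain R] :
    ∃ (n : ℕ) (A : Matrix (Fin n) (Fin n) R), IsPresentedBy M A ∧ A.det ≠ 0 ∧
      Associated p A.det := by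
  obtain ⟨n, q, hq, ⟨e⟩, hp⟩ := h
  refine ⟨n, Matrix.diagonal q, IsPresentedBy.of_equiv ⟨LinearMap.pi fun i =>
    (Ideal.span {q i}).mkQ ∘ₗ LinearMap.proj i, fun y => ?_, fun v => ?_⟩ e.symm, ?_, ?_⟩
  · choose x hx using fun i => Submodule.mkQ_surjective _ (y i)
    exact ⟨x, funext hx⟩
  · refine funext_iff.trans ?_
    have : ∀ i, (LinearMap.pi fun i => (Ideal.span {q i}).mkQ ∘ₗ LinearMap.proj i) v i = 0 ↔
        ∃ c, c * q i = v i := fun i =>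
      (Submodule.Quotient.mk_eq_zero _).trans Ideal.mem_span_singleton'
    refine (forall_congr' this).trans ⟨fun h => ?_, fun ⟨w, hw⟩ i => ⟨w i, ?_⟩⟩
    · choose w hw using h
      exact ⟨w, funext fun i => by rw [Matrix.vecMul_diagonal, hw]⟩
    · rw [← hw, Matrix.vecMul_diagonal]
  · rw [Matrix.det_diagonal]
    exact Finset.prod_ne_zero_iff.2 fun i _ => hq i
  · rwa [Matrix.det_diagonal]

theorem IsModuleOrder.of_equiv {p : R} (h : IsModuleOrder R M p) (e : M ≃ₗ[R] M') :
    IsModuleOrder R M' p := by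
  obtain ⟨n, q, hq, ⟨e'⟩, hp⟩ := h
  exact ⟨n, q, hq, ⟨e.symm.trans e'⟩, hp⟩

/-- Finitely generated torsion modules over principal ideal domains have an order. -/
theorem exists_isModuleOrder [IsDomain R] [IsPrincipalIdealRing R] [Module.Finite R M]
    (h : Module.IsTorsion R M) : ∃ p, IsModuleOrder R M p := by
  classical
  obtain ⟨ι, _, p, hp, k, ⟨e⟩⟩ := Module.equiv_directSum_of_isTorsion h
  let σ' := (Fintype.equivFin ι).symm
  refine ⟨∏ i, p (σ' i) ^ k (σ' i), Fintype.card ι, fun i => p (σ' i) ^ k (σ' i),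
    fun i => pow_ne_zero _ (hp _).ne_zero, ⟨?_⟩, Associated.refl _⟩
  exact (e.trans (DirectSum.linearEquivFunOnFintype R ι _)).trans
    (LinearEquiv.piCongrLeft R (fun i => R ⧸ Ideal.span {p i ^ k i}) σ').symm

end Presentation

/-! ### Maximal minors -/

section Minors

variable {R : Type*} [CommRing R] {m : Type*} [Fintype m] [DecidableEq m] {l : ℕ}

/-- A common divisor of the maximal minors divides the determinant of every square matrix whose
rows are combinations of the rows of the given matrix. -/
theorem dvd_det_mul_of_forall_minor (A : Matrix m (Fin l) R) {c : R}
    (h : ∀ s ∈ maximalMinors A, c ∣ s) (U : Matrix (Fin l) m R) : c ∣ (U * A).det := by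
  have h1 : (U * A).det = ∑ f : Fin l → m, (∏ i, U i (f i)) * (A.submatrix f id).det := by
    have h2 : U * A = Matrix.of fun i => ∑ r, U i r • A r := by
      ext i j
      simp [Matrix.mul_apply]
    rw [h2]
    refine (MultilinearMap.map_sum (Matrix.detRowAlternating (n := Fin l)
      (R := R)).toMultilinearMap fun i r => U i r • A r).trans ?_
    refine Finset.sum_congr rfl fun f _ => ?_
    exact MultilinearMap.map_smul_univ _ (fun i => U i (f i)) fun i => A (f i)
  rw [h1]
  refine Finset.dvd_sum fun f _ => Dvd.dvd.mul_left ?_ _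
  by_cases hf : Function.Injective f
  · exact h _ ⟨⟨f, hf⟩, rfl⟩
  · rw [Function.not_injective_iff] at hf
    obtain ⟨i, j, hij, hne⟩ := hf
    rw [Matrix.det_zero_of_row_eq hne (by ext; simp [hij])]
    exact dvd_zero c

end Minors

/-! ### The orders of the homology of the twisted complex -/

section Alexander

variable {R : Type*} [CommRing R] {n l : ℕ} (A : Fin (n + 1) → Matrix (Fin l) (Fin l) R)

/-- The column of the blocks `A j`. -/
def blockColumn : Matrix (Fin (n + 1) × Fin l) (Fin l) R := Matrix.of fun r c => A r.1 r.2 c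

theorem mem_range_alexanderOne (v : Fin l → R) : v ∈ LinearMap.range (alexanderOne A) ↔
    ∃ w, Matrix.vecMul w (blockColumn A) = v := by
  have h : ∀ w : Fin (n + 1) × Fin l → R, Matrix.vecMul w (blockColumn A) =
      alexanderOne A fun i j => w (i, j) := fun w => by
    ext j
    simp [alexanderOne_apply, Matrix.vecMul, dotProduct, Fintype.sum_prod_type, blockColumn]
  constructor
  · rintro ⟨w, rfl⟩
    exact ⟨fun s => w s.1 s.2, h _⟩
  · rintro ⟨w, rfl⟩
    exact ⟨_, (h w).symm⟩

theorem mem_range_alexanderOne_of_block (j : Fin (n + 1)) (w : Fin l → R) :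
    Matrix.vecMul w (A j) ∈ LinearMap.range (alexanderOne A) :=
  ⟨Pi.single j w, LinearMap.lsum_piSingle _ _ _ _ _ _⟩

theorem vecMul_det_smul (B : Matrix (Fin l) (Fin l) R) (v : Fin l → R) :
    Matrix.vecMul (Matrix.vecMul v B.adjugate) B = B.det • v := by
  rw [Matrix.vecMul_vecMul, Matrix.adjugate_mul, Matrix.vecMul_smul, Matrix.vecMul_one]

/-- The cokernel of the block `A 0`. -/
abbrev BlockCokernel : Type _ := (Fin l → R) ⧸ LinearMap.range (A 0).vecMulLinear

theorem det_smul_blockCokernel (y : BlockCokernel A) : (A 0).det • y = 0 := by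
  obtain ⟨v, rfl⟩ := Submodule.Quotient.mk_surjective _ y
  rw [← Submodule.Quotient.mk_smul, ← vecMul_det_smul]
  exact (Submodule.Quotient.mk_eq_zero _).2 ⟨_, rfl⟩

variable (hcomm : ∀ i : Fin n, A 0 * A i.succ = A i.succ * A 0)

/-- The map `w ↦ ∑ w i A (i + 1)` from a power of the cokernel of `A 0` to this cokernel. It is well
defined because `A 0` commutes with the other blocks. -/
noncomputable def blockMap : (Fin n → BlockCokernel A) →ₗ[R] BlockCokernel A :=
  LinearMap.lsum R (fun _ => BlockCokernel A) ℕ fun i => Submodule.mapQ _ _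
    (A i.succ).vecMulLinear (by
      rintro _ ⟨w, rfl⟩
      refine ⟨Matrix.vecMul w (A i.succ), ?_⟩
      simp only [Matrix.vecMulLinear_apply, Matrix.vecMul_vecMul, hcomm])

theorem blockMap_mk (w : Fin n → Fin l → R) :
    blockMap A hcomm (fun i => Submodule.Quotient.mk (w i)) =
      Submodule.Quotient.mk (∑ i, Matrix.vecMul (w i) (A i.succ)) := by
  rw [blockMap, LinearMap.lsum_apply, LinearMap.sum_apply]
  refine Eq.trans ?_ (map_sum (LinearMap.range (A 0).vecMulLinear).mkQ _ _).symm
  rfl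

theorem alexanderOne_eq (w : Fin (n + 1) → Fin l → R) : alexanderOne A w =
    Matrix.vecMul (w 0) (A 0) + ∑ i : Fin n, Matrix.vecMul (w i.succ) (A i.succ) := by
  rw [alexanderOne_apply, Fin.sum_univ_succ]

theorem range_block_le :
    LinearMap.range (A 0).vecMulLinear ≤ LinearMap.range (alexanderOne A) := by
  rintro _ ⟨w, rfl⟩
  exact mem_range_alexanderOne_of_block A 0 w

/-- The projection of the cokernel of `A 0` to the cokernel of the column of blocks. -/
noncomputable def blockProjection :
    BlockCokernel A →ₗ[R] (Fin l → R) ⧸ LinearMap.range (alexanderOne A) :=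
  Submodule.factor (range_block_le A)

theorem blockProjection_surjective : Function.Surjective (blockProjection A) :=
  Submodule.factor_surjective (range_block_le A)

/-- The cokernel of `blockMap` is the cokernel of `alexanderOne`. -/
theorem blockProjection_eq_zero_iff (y : BlockCokernel A) :
    blockProjection A y = 0 ↔ ∃ w, blockMap A hcomm w = y := by
  obtain ⟨v, rfl⟩ := Submodule.Quotient.mk_surjective _ y
  refine (Submodule.Quotient.mk_eq_zero (LinearMap.range (alexanderOne A))).trans ?_
  constructor
  · rintro ⟨w, rfl⟩
    refine ⟨fun i => Submodule.Quotient.mk (w i.succ), ?_⟩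
    rw [blockMap_mk, Submodule.Quotient.eq, alexanderOne_eq]
    exact ⟨-(w 0), by simp⟩
  · rintro ⟨y, hy⟩
    choose w hw using fun i => Submodule.Quotient.mk_surjective _ (y i)
    obtain rfl : (fun i => Submodule.Quotient.mk (w i)) = y := funext hw
    rw [blockMap_mk, Submodule.Quotient.eq] at hy
    obtain ⟨u, hu⟩ := hy
    refine ⟨Fin.cons (-u) w, ?_⟩
    rw [alexanderOne_eq]
    simp only [Fin.cons_zero, Fin.cons_succ]
    rw [Matrix.neg_vecMul, ← Matrix.vecMulLinear_apply, hu]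
    abel

/-- The cycles in degree one, as elements of the kernel of `blockMap`. -/
noncomputable def cyclesToKer : LinearMap.ker (alexanderOne A) →ₗ[R]
    LinearMap.ker (blockMap A hcomm) :=
  LinearMap.codRestrict _ (LinearMap.pi fun i : Fin n =>
    (LinearMap.range (A 0).vecMulLinear).mkQ ∘ₗ LinearMap.proj i.succ ∘ₗ
      (LinearMap.ker (alexanderOne A)).subtype) fun z => by
    have hz : alexanderOne A z.1 = 0 := z.2
    refine LinearMap.mem_ker.2 ((blockMap_mk A hcomm fun i => z.1 i.succ).trans ?_)
    refine (Submodule.Quotient.mk_eq_zero _).2 ⟨-(z.1 0), ?_⟩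
    rw [alexanderOne_eq] at hz
    rw [Matrix.vecMulLinear_apply, Matrix.neg_vecMul]
    exact neg_eq_of_add_eq_zero_right hz

theorem cyclesToKer_surjective : Function.Surjective (cyclesToKer A hcomm) := by
  rintro ⟨y, hy⟩
  choose w hw using fun i => Submodule.Quotient.mk_surjective _ (y i)
  obtain rfl : (fun i => Submodule.Quotient.mk (w i)) = y := funext hw
  rw [LinearMap.mem_ker, blockMap_mk, Submodule.Quotient.mk_eq_zero] at hy
  obtain ⟨u, hu⟩ := hy
  refine ⟨⟨Fin.cons (-u) w, ?_⟩, Subtype.ext (funext fun i => ?_)⟩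
  · rw [LinearMap.mem_ker, alexanderOne_eq]
    simp only [Fin.cons_zero, Fin.cons_succ]
    rw [Matrix.neg_vecMul, ← Matrix.vecMulLinear_apply, hu, neg_add_cancel]
  · rfl

variable [IsDomain R]

theorem vecMul_injective (hA : (A 0).det ≠ 0) {v : Fin l → R} (hv : Matrix.vecMul v (A 0) = 0) :
    v = 0 := by
  by_contra h
  exact hA (Matrix.exists_vecMul_eq_zero_iff.1 ⟨v, h, hv⟩)

theorem alexanderTwo_injective (hA : (A 0).det ≠ 0) : Function.Injective (alexanderTwo A) := by
  refine (injective_iff_map_eq_zero _).2 fun w hw => funext fun i => vecMul_injective A hA ?_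
  rw [← alexanderTwo_succ, hw]
  rfl

theorem isTorsion_of_forall_det_smul {M : Type*} [AddCommGroup M] [Module R M] {a : R} (ha : a ≠ 0)
    (h : ∀ m : M, a • m = 0) : Module.IsTorsion R M := fun {m} =>
  ⟨⟨a, mem_nonZeroDivisors_of_ne_zero ha⟩, h m⟩

theorem isTorsion_alexander_zero (hA : (A 0).det ≠ 0) :
    Module.IsTorsion R ((Fin l → R) ⧸ LinearMap.range (alexanderOne A)) := by
  refine isTorsion_of_forall_det_smul hA fun y => ?_
  obtain ⟨y, rfl⟩ := blockProjection_surjective A y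
  rw [← map_smul, det_smul_blockCokernel, map_zero]

/-- The order of the cokernel is the greatest common divisor of the maximal minors. -/
theorem isGCDOfSet_maximalMinors [IsPrincipalIdealRing R] {p : R}
    (hA : (A 0).det ≠ 0)
    (hp : IsModuleOrder R ((Fin l → R) ⧸ LinearMap.range (alexanderOne A)) p) :
    IsGCDOfSet (maximalMinors (blockColumn A)) p := by
  obtain ⟨k, D, hD, -, hpD⟩ := hp.exists_isPresentedBy
  constructor
  · rintro _ ⟨f, rfl⟩
    refine hpD.dvd.trans ?_
    -- The cokernel of a maximal square submatrix surjects onto the cokernel of the column.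
    have hle : LinearMap.range ((blockColumn A).submatrix f id).vecMulLinear ≤
        LinearMap.range (alexanderOne A) := by
      rintro _ ⟨w, rfl⟩
      refine (mem_range_alexanderOne A _).2 ⟨fun r => ∑ i, if f i = r then w i else 0, ?_⟩
      ext j
      simp only [Matrix.vecMul, dotProduct, Matrix.vecMulLinear_apply, Matrix.submatrix_apply,
        Finset.sum_mul, ite_mul, zero_mul, id]
      rw [Finset.sum_comm]
      simp
    exact (isPresentedBy_quotient _ _ rfl).det_dvd hD (Submodule.factor hle)
      (Submodule.factor_surjective hle)
  · intro c hc
    -- The range is free of rank `l`, so that a basis of it is a square presentation matrix. Its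
    -- rows are combinations of the rows of the column.
    obtain ⟨r, ⟨b⟩⟩ := Submodule.nonempty_basis_of_pid (Pi.basisFun R (Fin l))
      (LinearMap.range (alexanderOne A))
    have hr : r = l := by
      have h1 := Module.finrank_eq_card_basis b
      rw [Fintype.card_fin] at h1
      refine le_antisymm ?_ ?_
      · have := Submodule.finrank_le (LinearMap.range (alexanderOne A))
        rwa [h1, Module.finrank_fin_fun] at this
      · have h2 : Function.Injective (LinearMap.codRestrict (LinearMap.range (alexanderOne A))
            (A 0).vecMulLinear (mem_range_alexanderOne_of_block A 0)) := by
          refine (injective_iff_map_eq_zero _).2 fun v hv => vecMul_injective A hA ?_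
          exact congrArg Subtype.val hv
        have := LinearMap.finrank_le_finrank_of_injective h2
        rwa [h1, Module.finrank_fin_fun] at this
    subst hr
    choose U hU using fun i => (mem_range_alexanderOne A _).1 (b i).2
    have hS : IsPresentedBy ((Fin r → R) ⧸ LinearMap.range (alexanderOne A))
        (Matrix.of U * blockColumn A) := by
      refine isPresentedBy_quotient _ _ (le_antisymm (fun v hv => ?_) ?_)
      · refine ⟨b.repr ⟨v, hv⟩, ?_⟩
        have h1 := congrArg Subtype.val (b.sum_repr ⟨v, hv⟩)
        rw [AddSubmonoidClass.coe_finsetSum] at h1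
        refine Eq.trans ?_ h1
        rw [Matrix.vecMulLinear_apply, ← Matrix.vecMul_vecMul]
        have h2 : ∀ w, Matrix.vecMul w (Matrix.of U) = ∑ i, w i • U i := fun w =>
          Matrix.vecMul_eq_sum w _
        rw [h2, Matrix.sum_vecMul]
        refine Finset.sum_congr rfl fun i _ => ?_
        rw [Matrix.smul_vecMul, hU]
        rfl
      · rintro _ ⟨w, rfl⟩
        refine (mem_range_alexanderOne A _).2 ⟨Matrix.vecMul w (Matrix.of U), ?_⟩
        rw [Matrix.vecMul_vecMul]
        rfl
    refine (dvd_det_mul_of_forall_minor _ hc (Matrix.of U)).trans ?_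
    exact (hS.associated_det hD).dvd.trans hpD.symm.dvd

/-- The kernel of `cyclesToKer` consists of the boundaries. Together with the surjectivity of this
map, this identifies the homology in degree one with the kernel of `blockMap`. -/
theorem cyclesToKer_eq_zero_iff (hA : (A 0).det ≠ 0) (z : LinearMap.ker (alexanderOne A)) :
    cyclesToKer A hcomm z = 0 ↔ ∃ w, alexanderTwo A w = z.1 := by
  constructor
  · intro h
    have h1 : ∀ i : Fin n, ∃ w, Matrix.vecMul w (A 0) = z.1 i.succ := fun i =>
      (Submodule.Quotient.mk_eq_zero _).1 (congrFun (congrArg Subtype.val h) i)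
    choose w hw using h1
    refine ⟨w, funext fun j => ?_⟩
    induction j using Fin.cases with
    | zero =>
      have hz : alexanderOne A z.1 = 0 := z.2
      rw [alexanderOne_eq] at hz
      rw [alexanderTwo_zero, neg_eq_iff_add_eq_zero]
      refine vecMul_injective A hA ?_
      rw [add_comm, Matrix.add_vecMul, Matrix.sum_vecMul, ← hz]
      refine congrArg _ (Finset.sum_congr rfl fun i _ => ?_)
      rw [← hw, Matrix.vecMul_vecMul, Matrix.vecMul_vecMul, hcomm]
    | succ i => rw [alexanderTwo_succ, hw]
  · rintro ⟨w, hw⟩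
    refine Subtype.ext (funext fun i => (Submodule.Quotient.mk_eq_zero _).2 ⟨w i, ?_⟩)
    exact (alexanderTwo_succ A w i).symm.trans (congrFun hw i.succ)

theorem isTorsion_ker_blockMap (hA : (A 0).det ≠ 0) :
    Module.IsTorsion R (LinearMap.ker (blockMap A hcomm)) :=
  isTorsion_of_forall_det_smul hA fun y =>
    Subtype.ext (funext fun i => det_smul_blockCokernel A (y.1 i))

/-- The orders of the two homology modules, computed from the exact sequence
`0 → H₁ → Cⁿ → C → H₀ → 0`, where `C` is the cokernel of `A 0`. It is split into two short exact
sequences at the range of `blockMap`. -/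
theorem associated_order [IsPrincipalIdealRing R] (hA : (A 0).det ≠ 0) {p₀ p₁ : R}
    (h0 : IsModuleOrder R ((Fin l → R) ⧸ LinearMap.range (alexanderOne A)) p₀)
    (h1 : IsModuleOrder R (LinearMap.ker (blockMap A hcomm)) p₁) :
    Associated (p₁ * (A 0).det) (p₀ * (A 0).det ^ n) := by
  have htors : Module.IsTorsion R (LinearMap.range (blockMap A hcomm)) :=
    isTorsion_of_forall_det_smul hA fun y => Subtype.ext (det_smul_blockCokernel A y.1)
  obtain ⟨q, hq⟩ := exists_isModuleOrder htors
  obtain ⟨k₀, D₀, hD₀, -, e₀⟩ := h0.exists_isPresentedBy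
  obtain ⟨k₁, D₁, hD₁, -, e₁⟩ := h1.exists_isPresentedBy
  obtain ⟨k, D, hD, hne, e⟩ := hq.exists_isPresentedBy
  obtain ⟨C, hC⟩ := hD.extension hD₀ (LinearMap.range (blockMap A hcomm)).subtype
    (blockProjection A) Subtype.val_injective (blockProjection_surjective A) fun y => by
      rw [blockProjection_eq_zero_iff A hcomm]
      simp
  obtain ⟨C', hC'⟩ := hD₁.extension hD (LinearMap.ker (blockMap A hcomm)).subtype
    (blockMap A hcomm).rangeRestrict Subtype.val_injective
    (blockMap A hcomm).surjective_rangeRestrict fun y => by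
      rw [← LinearMap.mem_ker, LinearMap.ker_rangeRestrict]
      simp
  have hP : IsPresentedBy (BlockCokernel A) (A 0) := isPresentedBy_quotient _ _ rfl
  have h2 := hP.associated_det hC
  have h3 := (hP.pi (κ := Fin n)).associated_det hC'
  rw [det_blockDiagonal_const, Fintype.card_fin, Matrix.det_fromBlocks_zero₁₂] at h3
  rw [Matrix.det_fromBlocks_zero₁₂] at h2
  have h4 := (e₁.mul_right (A 0).det).trans ((h2.mul_left D₁.det).trans (Associated.of_eq
    (mul_assoc D₁.det D.det D₀.det).symm))
  exact h4.trans ((h3.symm.mul_right D₀.det).trans ((Associated.of_eq (mul_comm _ _)).trans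
    (e₀.symm.mul_right _)))

end Alexander

/-! ### Laurent polynomials -/

section Laurent

variable {F : Type v} [Field F]

/-- Laurent polynomials are a localization of polynomials, so every ideal is generated by a
polynomial. -/
instance LaurentPolynomial.isPrincipalIdealRing : IsPrincipalIdealRing F[T;T⁻¹] :=
  ⟨fun J => by
    obtain ⟨a, ha⟩ := IsPrincipalIdealRing.principal (J.under (Polynomial F))
    refine ⟨algebraMap _ _ a, ?_⟩
    have h := IsLocalization.map_under (Submonoid.powers (Polynomial.X : Polynomial F)) F[T;T⁻¹] J
    rw [ha] at h
    rw [← h]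
    exact (Ideal.map_span _ _).trans (congrArg Ideal.span Set.image_singleton)⟩

/-- A power `t ^ k` with `k ≠ 0` is transcendental. -/
theorem LaurentPolynomial.aeval_T_ne_zero {k : ℤ} (hk : k ≠ 0) {p : Polynomial F} (hp : p ≠ 0) :
    Polynomial.aeval (LaurentPolynomial.T k : F[T;T⁻¹]) p ≠ 0 := by
  have key : ∀ (q : Polynomial F) (i : ℕ),
      (Polynomial.aeval (LaurentPolynomial.T k : F[T;T⁻¹]) q).coeff (i * k) = q.coeff i := by
    intro q i
    induction q using Polynomial.induction_on' with
    | add q r hq hr => simp [hq, hr]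
    | monomial j a =>
      rw [Polynomial.aeval_monomial, ← LaurentPolynomial.C_eq_algebraMap, LaurentPolynomial.T_pow,
        ← LaurentPolynomial.single_eq_C_mul_T, Polynomial.coeff_monomial]
      rw [AddMonoidAlgebra.coeff_single, Finsupp.single_apply]
      simp [hk]
  intro h
  refine hp (Polynomial.ext fun i => ?_)
  rw [← key, h]
  rfl

/-- The determinant of `M t ^ k - 1` is not zero, because it is up to units the characteristic
polynomial of `M⁻¹` at `t ^ k`. -/
theorem det_alexanderBlock_ne_zero {G : Type u} [Group G] {l : ℕ} (ε : G →* Multiplicative ℤ)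
    (ρ : G →* GL (Fin l) F) (α : G) (h : ε α ≠ 1) : (alexanderBlock ε ρ α).det ≠ 0 := by
  have hk : (ε α).toAdd ≠ 0 := h
  let N : Matrix (Fin l) (Fin l) F := ((ρ α)⁻¹ : GL (Fin l) F)
  have hN : (ρ α : Matrix (Fin l) (Fin l) F) * N = 1 := (ρ α).mul_inv
  let f : Polynomial F →ₐ[F] F[T;T⁻¹] := Polynomial.aeval (LaurentPolynomial.T (ε α).toAdd)
  have h1 : (alexanderBlock ε ρ α) * N.map LaurentPolynomial.C = f.mapMatrix N.charmatrix := by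
    rw [alexanderBlock, twistedMatrix, sub_mul, Matrix.smul_mul, ← Matrix.map_mul, hN, one_mul,
      Matrix.charmatrix, map_sub, Matrix.map_one _ (map_zero _) (map_one _)]
    congr 1
    · ext i j
      by_cases hij : i = j
      · subst hij
        simp [f]
      · simp [hij, f]
    · ext1 i j
      exact (Polynomial.aeval_C (LaurentPolynomial.T (ε α).toAdd : F[T;T⁻¹]) (N i j)).symm
  intro h0
  refine LaurentPolynomial.aeval_T_ne_zero hk (N.charpoly_monic).ne_zero ?_
  change f N.charmatrix.det = 0
  rw [AlgHom.map_det, ← h1, Matrix.det_mul, h0, zero_mul]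

theorem commute_alexanderBlock {G : Type u} [Group G] {l : ℕ} (ε : G →* Multiplicative ℤ)
    (ρ : G →* GL (Fin l) F) {α β : G} (h : Commute α β) :
    Commute (alexanderBlock ε ρ α) (alexanderBlock ε ρ β) := by
  have hmul : ∀ α β : G, twistedMatrix ε ρ (α * β) = twistedMatrix ε ρ α * twistedMatrix ε ρ β :=
    fun α β => by
      simp only [twistedMatrix, map_mul, toAdd_mul, LaurentPolynomial.T_add, Units.val_mul,
        Matrix.map_mul, Matrix.smul_mul, Matrix.mul_smul, mul_smul]
      exact smul_comm _ _ _
  have h1 : Commute (twistedMatrix ε ρ α) (twistedMatrix ε ρ β) := by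
    rw [Commute, SemiconjBy, ← hmul, ← hmul, h.eq]
  exact (h1.sub_left (Commute.one_left _)).sub_right
    ((Commute.one_right _).sub_left (Commute.one_left _))

end Laurent

/-! ### The twisted Alexander modules -/

section Final

theorem isModuleOrder_torsion_iff {R M : Type*} [CommRing R] [IsDomain R] [AddCommGroup M]
    [Module R M] (h : Module.IsTorsion R M) (p : R) :
    IsModuleOrder R (Submodule.torsion R M) p ↔ IsModuleOrder R M p := by
  have e : Submodule.torsion R M ≃ₗ[R] M :=
    LinearEquiv.ofTop _ (Submodule.eq_top_iff'.2 fun m => @h m)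
  exact ⟨fun hp => hp.of_equiv e, fun hp => hp.of_equiv e.symm⟩

/-- The loops act freely on the universal cover, by cancellation in the fundamental groupoid. -/
theorem UniversalCover.smul_free {X : Type u} [TopologicalSpace X] {b : X} (α : LoopGroup b)
    (e : UniversalCover b) (h : α • e = e) : α = 1 := by
  obtain ⟨y, p⟩ := e
  have h1 := eq_of_heq (Sigma.mk.inj h).2
  let q : (⟨b⟩ : FundamentalGroupoid X) ⟶ ⟨y⟩ := p
  have h2 : (α.unop : (⟨b⟩ : FundamentalGroupoid X) ⟶ ⟨b⟩) = 𝟙 _ := (cancel_mono_id q).1 h1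
  exact MulOpposite.unop_injective h2

theorem Module.IsTorsion.of_equiv {R M N : Type*} [CommRing R] [AddCommGroup M] [AddCommGroup N]
    [Module R M] [Module R N] (h : Module.IsTorsion R M) (e : M ≃ₗ[R] N) : Module.IsTorsion R N :=
  fun {y} => by
    obtain ⟨a, ha⟩ := @h (e.symm y)
    refine ⟨a, e.symm.injective ?_⟩
    rw [map_zero, ← ha]
    exact e.symm.map_smul _ _

theorem proposition2p4 (d : ℕ) (hd : 2 ≤ d) (K : Set S3) (hK : IsHopfLink d K)
    (b : (Kᶜ : Set S3)) :
    Nonempty (HopfGroup d ≃* LoopGroup b) ∧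
    ∀ (φ : HopfGroup d ≃* LoopGroup b) (x : Fin d → LoopGroup b)
      (_ : ∀ i, x i = φ (PresentedGroup.of i))
      (F : Type v) [Field F] (l : ℕ)
      (ε : LoopGroup b →* Multiplicative ℤ) (ρ : LoopGroup b →* GL (Fin l) F)
      (_ : Function.Surjective ε) (_ : ε (x ⟨0, by omega⟩) ≠ 1),
      Module.IsTorsion F[T;T⁻¹] (twistedAlexanderModule ε ρ 0) ∧
      Module.IsTorsion F[T;T⁻¹] (twistedAlexanderModule ε ρ 1) ∧
      (∀ i, 2 ≤ i → Subsingleton (twistedAlexanderModule ε ρ i)) ∧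
      (∃ Δ₀, IsTwistedAlexanderPolynomial ε ρ 0 Δ₀) ∧
      (∃ Δ₁, IsTwistedAlexanderPolynomial ε ρ 1 Δ₁) ∧
      (∀ Δ₀, IsTwistedAlexanderPolynomial ε ρ 0 Δ₀ →
        IsGCDOfSet (maximalMinors (alexanderColumn ε ρ x)) Δ₀) ∧
      (∀ Δ₀ Δ₁, IsTwistedAlexanderPolynomial ε ρ 0 Δ₀ → IsTwistedAlexanderPolynomial ε ρ 1 Δ₁ →
        Associated Δ₁ (Δ₀ * (alexanderBlock ε ρ (x ⟨0, by omega⟩)).det ^ (d - 2))) := by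
  obtain ⟨n, rfl⟩ : ∃ n, d = n + 1 + 1 := ⟨d - 2, by omega⟩
  constructor
  · obtain ⟨e⟩ := HopfLink.nonempty_loopGroup_mulEquiv hK b
    exact ⟨(HopfLink.groupEquiv (n + 1)).trans e.symm⟩
  intro φ x hφ F _ l ε ρ _ hε
  let e : LoopGroup b ≃* FreeGroup (Fin (n + 1)) × Multiplicative ℤ :=
    φ.symm.trans (HopfLink.groupEquiv (n + 1))
  have he : ∀ i, e (x i) = HopfLink.toProd (n + 1) (PresentedGroup.of i) := fun i => by
    rw [hφ]
    exact congrArg (HopfLink.groupEquiv (n + 1)) (φ.symm_apply_apply _)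
  have hx0 : e (x 0) = (1, Multiplicative.ofAdd 1) :=
    (he 0).trans (HopfLink.toProd_of_zero _)
  have hx : ∀ i : Fin (n + 1), e (x i.succ) = (FreeGroup.of i, 1) := fun i =>
    (he i.succ).trans (HopfLink.toProd_of_succ i)
  have hcomm := commute_of_mulEquiv x e hx0 hx
  have := (HopfLink.hasCanonicalPaths hK b).contractibleSpace
  obtain ⟨H⟩ := nonempty_twisted_homotopyEquiv ε ρ (UniversalCover b) UniversalCover.smul_free
    (foxResolution F x e hx0 hx)
  have hH : ∀ i, Nonempty (twistedAlexanderModule ε ρ i ≃ₗ[F[T;T⁻¹]]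
      (twistedFoxComplex ε ρ x hcomm).homology i) := fun i =>
    ⟨(H.toHomologyIso i).toLinearEquiv⟩
  let A := fun j => alexanderBlock ε ρ (x j)
  have hA : (A 0).det ≠ 0 := det_alexanderBlock_ne_zero ε ρ (x 0) hε
  have hAcomm : ∀ i : Fin (n + 1), A 0 * A i.succ = A i.succ * A 0 := fun i =>
    commute_alexanderBlock ε ρ (hcomm i)
  obtain ⟨h0⟩ := hH 0
  obtain ⟨h0'⟩ := nonempty_twistedFox_homology_zero ε ρ x hcomm
  obtain ⟨h1⟩ := hH 1
  obtain ⟨h1'⟩ := nonempty_twistedFox_homology_one ε ρ x hcomm (cyclesToKer A hAcomm)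
    (cyclesToKer_surjective A hAcomm) (cyclesToKer_eq_zero_iff A hAcomm hA)
  have t0 := (isTorsion_alexander_zero A hA).of_equiv (h0.trans h0').symm
  have t1 := (isTorsion_ker_blockMap A hAcomm hA).of_equiv (h1.trans h1').symm
  have d0 : ∀ p, IsTwistedAlexanderPolynomial ε ρ 0 p ↔
      IsModuleOrder F[T;T⁻¹] ((Fin l → F[T;T⁻¹]) ⧸ LinearMap.range (alexanderOne A)) p := fun p =>
    (isModuleOrder_torsion_iff t0 p).trans
      ⟨fun h => h.of_equiv (h0.trans h0'), fun h => h.of_equiv (h0.trans h0').symm⟩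
  have d1 : ∀ p, IsTwistedAlexanderPolynomial ε ρ 1 p ↔
      IsModuleOrder F[T;T⁻¹] (LinearMap.ker (blockMap A hAcomm)) p := fun p =>
    (isModuleOrder_torsion_iff t1 p).trans
      ⟨fun h => h.of_equiv (h1.trans h1'), fun h => h.of_equiv (h1.trans h1').symm⟩
  refine ⟨t0, t1, fun i hi => ?_, ?_, ?_, fun p hp => ?_, fun p q hp hq => ?_⟩
  · obtain ⟨k, rfl⟩ := Nat.exists_eq_add_of_le' hi
    obtain ⟨h⟩ := hH (k + 2)
    have := subsingleton_twistedFox_homology ε ρ x hcomm (alexanderTwo_injective A hA) k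
    exact h.toEquiv.subsingleton
  · obtain ⟨p, hp⟩ := exists_isModuleOrder (isTorsion_alexander_zero A hA)
    exact ⟨p, (d0 p).2 hp⟩
  · obtain ⟨p, hp⟩ := exists_isModuleOrder (isTorsion_ker_blockMap A hAcomm hA)
    exact ⟨p, (d1 p).2 hp⟩
  · exact isGCDOfSet_maximalMinors A hA ((d0 p).1 hp)
  -- The exponent is `n + 1` in the exact sequence, and one factor `det (A 0)` cancels.
  · have h := associated_order A hAcomm hA ((d0 p).1 hp) ((d1 q).1 hq)
    rw [pow_succ, ← mul_assoc] at h
    exact h.of_mul_right (Associated.refl _) hA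

end Final
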